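/- Let $X,Z,H,P$ denote the one-qubit NOT, Pauli-$Z$, Hadamard and PHASE gates ($P|a\rangle=i^a|a\rangle$), let CNOT map $|a,b\rangle\mapsto|a,a+b\rangle$ and CPHASE map $|a,b\rangle\mapsto(-1)^{ab}|a,b\rangle$. An $n$-qubit Clifford operation is a unitary $2^n\times 2^n$ matrix that maps the $n$-qubit Pauli group into itself under conjugation; a Clifford circuit is a circuit of Hadamard, PHASE and CNOT gates. There is a polynomial $q$ such that the following holds. (i) For every $n$ and every $n$-qubit Clifford operation $\mathcal C$ there are a circuit $M_1$ of at most $q(n)$ CNOT, PHASE and CPHASE gates, a circuit $M_2$ of at most $q(n)$ NOT, CNOT, PHASE and CPHASE gates, and a set $S$ of qubits such that, as full $2^n\times 2^n$ matrices, $$\mathcal C = c\, M_2\,\mathcal H\,M_1,\qquad \mathcal H = H^{S}\otimes I,$$ where $c$ is a complex number with $|c|=1$ and $H^S\otimes I$ is the tensor product of a Hadamard gate on every qubit in $S$ and the identity on every other qubit. (ii) Such factors can be computed efficiently: there are an algorithm (a program of a random access machine with addition and truncated subtraction) and a polynomial $p$ such that, given $n$ and an $n$-qubit Clifford circuit $\mathcal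 C$ with $m$ gates (as a list of gates), the algorithm halts within $p(n+m)$ steps and outputs $M_1$, $S$ and $M_2$ with all the properties of (i) for the matrix of $\mathcal C$. -/

import Mathlib

open Matrix

namespace CliffordNF

noncomputable section

/-! ### Qubits and matrices -/

/-- Bit strings of length `n`; they label the computational basis `|x⟩` of `n` qubits. -/
abbrev Bits (n : ℕ) : Type := Fin n → ZMod 2

/-- `2 ^ n × 2 ^ n` complex matrices, written in the computational basis. -/
abbrev Op (n : ℕ) : Type := Matrix (Bits n) (Bits n) ℂ

/-- The tensor product `A 0 ⊗ A 1 ⊗ ⋯ ⊗ A (n - 1)` of one-qubit matrices. -/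
def tensor {n : ℕ} (A : Fin n → Matrix (ZMod 2) (ZMod 2) ℂ) : Op n :=
  Matrix.of fun y x => ∏ k, A k (y k) (x k)

/-- The one-qubit matrix `A` acting on qubit `i`, identity elsewhere. -/
def onQubit {n : ℕ} (i : Fin n) (A : Matrix (ZMod 2) (ZMod 2) ℂ) : Op n :=
  tensor (Function.update (fun _ => 1) i A)

/-- Pauli `X` (the NOT gate): `|a⟩ ↦ |a + 1⟩`. -/
def matX : Matrix (ZMod 2) (ZMod 2) ℂ := Matrix.of fun b a => if b = a + 1 then 1 else 0

/-- Pauli `Z`: `|a⟩ ↦ (-1) ^ a |a⟩`. -/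
def matZ : Matrix (ZMod 2) (ZMod 2) ℂ := Matrix.diagonal fun a => (-1) ^ a.val

/-- Pauli `Y = i X Z`. -/
def matY : Matrix (ZMod 2) (ZMod 2) ℂ := Complex.I • (matX * matZ)

/-- The Hadamard gate: `|a⟩ ↦ (|0⟩ + (-1) ^ a |1⟩) / √2`. -/
def matH : Matrix (ZMod 2) (ZMod 2) ℂ :=
  Matrix.of fun b a => (-1) ^ (a.val * b.val) / (Real.sqrt 2 : ℂ)

/-- The PHASE gate: `|a⟩ ↦ i ^ a |a⟩`. -/
def matP : Matrix (ZMod 2) (ZMod 2) ℂ := Matrix.diagonal fun a => Complex.I ^ a.val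

/-! ### The Pauli group and Clifford operations -/

/-- `σ` is one of the four one-qubit matrices `I`, `X`, `Y`, `Z`. -/
def IsPauliMatrix (σ : Matrix (ZMod 2) (ZMod 2) ℂ) : Prop :=
  σ = 1 ∨ σ = matX ∨ σ = matY ∨ σ = matZ

/-- The `n`-qubit Pauli group: all `i ^ k (P₁ ⊗ ⋯ ⊗ Pₙ)` with each `Pⱼ` one of `I`, `X`, `Y`, `Z`. -/
def pauliGroup (n : ℕ) : Set (Op n) :=
  {Q | ∃ (k : ℕ) (σ : Fin n → Matrix (ZMod 2) (ZMod 2) ℂ),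
    (∀ j, IsPauliMatrix (σ j)) ∧ Q = Complex.I ^ k • tensor σ}

/-- An `n`-qubit Clifford operation: a unitary that maps the Pauli group into itself under
conjugation. -/
def IsClifford {n : ℕ} (U : Op n) : Prop :=
  U ∈ Matrix.unitaryGroup (Bits n) ℂ ∧ ∀ Q ∈ pauliGroup n, U * Q * Uᴴ ∈ pauliGroup n

/-! ### Gates and circuits -/

/-- Gates on `n` qubits. In `cnot i j` the control is `i` and the target is `j`. -/
inductive Gate (n : ℕ) : Type
  | hadamard (i : Fin n) : Gate n
  | phase (i : Fin n) : Gate n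
  | not (i : Fin n) : Gate n
  | cnot (i j : Fin n) (h : i ≠ j) : Gate n
  | cphase (i j : Fin n) (h : i ≠ j) : Gate n

/-- The matrix of a gate. CNOT is `|x⟩ ↦ |x'⟩`, where `x'` is `x` with bit `j` replaced by
`x i + x j`; CPHASE is `|x⟩ ↦ (-1) ^ (x i * x j) |x⟩`. -/
def Gate.matrix {n : ℕ} : Gate n → Op n
  | .hadamard i => onQubit i matH
  | .phase i => onQubit i matP
  | .not i => onQubit i matX
  | .cnot i j _ => Matrix.of fun y x => if y = Function.update x j (x i + x j) then 1 else 0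
  | .cphase i j _ => Matrix.diagonal fun x => (-1) ^ ((x i).val * (x j).val)

/-- A circuit is a list of gates; the head of the list is applied first. -/
abbrev Circuit (n : ℕ) : Type := List (Gate n)

/-- The matrix of a circuit. -/
def Circuit.matrix {n : ℕ} : Circuit n → Op n
  | [] => 1
  | g :: C => Circuit.matrix C * g.matrix

/-- The gates of Clifford circuits: Hadamard, PHASE and CNOT. -/
def Gate.IsCliffordGate {n : ℕ} : Gate n → Prop
  | .hadamard _ | .phase _ | .cnot _ _ _ => True
  | .not _ | .cphase _ _ _ => False

/-- CNOT, PHASE and CPHASE gates. -/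
def Gate.IsLinearGate {n : ℕ} : Gate n → Prop
  | .cnot _ _ _ | .phase _ | .cphase _ _ _ => True
  | .hadamard _ | .not _ => False

/-- NOT, CNOT, PHASE and CPHASE gates. -/
def Gate.IsAffineGate {n : ℕ} : Gate n → Prop
  | .not _ | .cnot _ _ _ | .phase _ | .cphase _ _ _ => True
  | .hadamard _ => False

/-- `H^S ⊗ I`: a Hadamard gate on every qubit of `S`, the identity on all others. -/
def hadamardOn {n : ℕ} (S : Finset (Fin n)) : Op n :=
  tensor fun k => if k ∈ S then matH else 1

/-- `M₂ (H^S ⊗ I) M₁` is a normal form of `U`, and neither circuit has more than `s` gates.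
The circuit `M₁` uses CNOT, PHASE and CPHASE gates only, and `M₂` may use NOT gates as well. -/
structure IsNormalForm {n : ℕ} (s : ℕ) (U : Op n)
    (M₁ : Circuit n) (S : Finset (Fin n)) (M₂ : Circuit n) : Prop where
  gates₁ : ∀ g ∈ M₁, g.IsLinearGate
  gates₂ : ∀ g ∈ M₂, g.IsAffineGate
  size₁ : M₁.length ≤ s
  size₂ : M₂.length ≤ s
  prop : ∃ c : ℂ, ‖c‖ = 1 ∧ U = c • (M₂.matrix * hadamardOn S * M₁.matrix)

/-! ### Random access machines

A structured random access machine. Its memory consists of arrays of natural numbers, of which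
a program can name only finitely many. One assignment or one test is one step. The only arithmetic
operations are addition and truncated subtraction (no multiplication), so that polynomial time on
this machine is the same as polynomial time on a Turing machine. -/

/-- `m a i` is the content of cell `i` of array `a`. -/
abbrev Mem : Type := ℕ → ℕ → ℕ

/-- Expressions: constants, the content of a cell (whose index is computed), sums and truncated
differences. -/
inductive Expr : Type
  | const (k : ℕ) : Expr
  | get (a : ℕ) (e : Expr) : Expr
  | add (e f : Expr) : Expr
  | sub (e f : Expr) : Expr

/-- The value of an expression. -/
def Expr.eval (m : Mem) : Expr → ℕ
  | .const k => k
  | .get a e => m a (e.eval m)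
  | .add e f => e.eval m + f.eval m
  | .sub e f => e.eval m - f.eval m

/-- Write `v` into cell `i` of array `a`. -/
def Mem.write (m : Mem) (a i v : ℕ) : Mem :=
  Function.update m a (Function.update (m a) i v)

/-- Programs: the empty program, the assignment `a[e] := f`, composition, branching on
`e ≠ 0`, and the loop `while e ≠ 0 do p`. -/
inductive Prog : Type
  | skip : Prog
  | assign (a : ℕ) (e f : Expr) : Prog
  | seq (p q : Prog) : Prog
  | ite (e : Expr) (p q : Prog) : Prog
  | loop (e : Expr) (p : Prog) : Prog

/-- `Runs p m t m'`: started on the memory `m`, the program `p` halts after exactly `t` steps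
with memory `m'`. -/
inductive Runs : Prog → Mem → ℕ → Mem → Prop
  | skip (m : Mem) : Runs .skip m 0 m
  | assign (a : ℕ) (e f : Expr) (m : Mem) :
      Runs (.assign a e f) m 1 (m.write a (e.eval m) (f.eval m))
  | seq {p q : Prog} {m m' m'' : Mem} {s t : ℕ} :
      Runs p m s m' → Runs q m' t m'' → Runs (.seq p q) m (s + t) m''
  | ite_true {e : Expr} {p q : Prog} {m m' : Mem} {t : ℕ} :
      e.eval m ≠ 0 → Runs p m t m' → Runs (.ite e p q) m (t + 1) m'
  | ite_false {e : Expr} {p q : Prog} {m m' : Mem} {t : ℕ} :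
      e.eval m = 0 → Runs q m t m' → Runs (.ite e p q) m (t + 1) m'
  | loop_done {e : Expr} {p : Prog} {m : Mem} :
      e.eval m = 0 → Runs (.loop e p) m 1 m
  | loop_step {e : Expr} {p : Prog} {m m' m'' : Mem} {s t : ℕ} :
      e.eval m ≠ 0 → Runs p m s m' → Runs (.loop e p) m' t m'' →
      Runs (.loop e p) m (s + t + 1) m''

/-- The initial memory on input `w`: array `0` holds the length of `w` followed by the entries
of `w`; every other cell is `0`. -/
def inputMem (w : List ℕ) : Mem := fun a i =>
  if a = 0 then (w.length :: w).getD i 0 else 0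

/-- The output is read from array `1`, in the same format. -/
def outputOf (m : Mem) : List ℕ := (List.range (m 1 0)).map fun i => m 1 (i + 1)

/-- On input `w` the program `p` halts within `t` steps with output `w'`. -/
def OutputsWithin (p : Prog) (w : List ℕ) (t : ℕ) (w' : List ℕ) : Prop :=
  ∃ s ≤ t, ∃ m, Runs p (inputMem w) s m ∧ outputOf m = w'

/-! ### Encodings -/

/-- A gate is written as three numbers: its kind and the qubits that it acts on. -/
def Gate.code {n : ℕ} : Gate n → List ℕ
  | .hadamard i => [0, i, 0]
  | .phase i => [1, i, 0]
  | .cnot i j _ => [2, i, j]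
  | .cphase i j _ => [3, i, j]
  | .not i => [4, i, 0]

/-- A circuit is written as the number of its gates followed by the gates. -/
def Circuit.code {n : ℕ} (C : Circuit n) : List ℕ := C.length :: C.flatMap Gate.code

/-- A set of qubits is written as its indicator vector, of length `n`. -/
def subsetCode {n : ℕ} (S : Finset (Fin n)) : List ℕ :=
  List.ofFn fun k => if k ∈ S then 1 else 0

end

end CliffordNF

open CliffordNF

namespace CliffordNF

variable {n : ℕ}

/-! ### Pauli operators as vectors over `ℤ/2` with a phase, and conjugation by gates -/

/-! ### Signs and powers of `i` -/

/-! Up to a scalar, a Clifford operation is determined by the automorphism of the Pauli group that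
it induces by conjugation, because a matrix that commutes with all `X k` and `Z k` is scalar
(`eq_smul_one_of_commute`). Modulo phases this automorphism is a symplectic matrix over `ℤ/2`, and
multiplying the operation by the inverse of a gate, on the left or on the right, is an elementary
operation on that matrix. The aim is to reach an automorphism that, for every qubit `k`, either
fixes `X k` and `Z k` or swaps them; it is induced by Hadamard gates on the qubits of the second
type.

Let the `X` parts of the images of the `Z k` be the rows of a matrix. CNOT gates on the right add
rows, CNOT gates on the left add columns, and Gaussian elimination without swaps makes this matrix
diagonal (`sweep_stepsX`). Let `S` be the set of qubits with diagonal entry `1`. For `k` outside of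
`S` the image of `Z k` has only a `Z` part. CNOT gates outside of `S` diagonalize these `Z` parts
there (`sweep_stepsZ`); inside `S` they vanish because the images of the `Z j` commute, and the
diagonal entries are `1` because the image of `Z k` anticommutes with that of `X k`
(`halfReduced_of_diagonal`). For `k` in `S`, PHASE and CPHASE on the left clear the `Z` part of the
image of `Z k` (`sweep_stepsL`). Now, up to scalars, every `Z k` goes to `Z k` or `X k`. What is
superfluous in the image of `X k` is a product of images of the `Z j`. Its exponents form a
symmetric matrix, since the images of the `X k` commute, and PHASE and CPHASE on the right remove it
(`sweep_stepsR`). The signs are removed by NOT and `PHASE ^ 2 = Z` on the left (`sweep_stepsSign`).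
NOT is needed on the left only, and Hadamard nowhere.

The algorithm performs the same sweeps. It keeps no table of images: it stores the input circuit and
the two circuits found so far, and whenever a test needs the image of a generator, it sends that
Pauli operator through the three circuits gate by gate (`stored_query`). Every loop is a bounded
repetition, so that a polynomial time bound can be read off from the syntax (`LProg.compile_runs`);
the number `N` of repetitions is linear in `n + m`, and `N ^ 3` exceeds every count that occurs. -/

/-- `(-1) ^ b`. -/
noncomputable def sgn (b : ZMod 2) : ℂ := (-1) ^ b.val

/-- `i ^ c`. -/
noncomputable def ipow (c : ZMod 4) : ℂ := Complex.I ^ c.val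

/-- Multiplication by `2`, as a homomorphism from `ℤ/2` to `ℤ/4`. -/
def two (b : ZMod 2) : ZMod 4 := 2 * (b.val : ZMod 4)

theorem two_zero : two 0 = 0 := by decide

theorem two_add : ∀ a b, two (a + b) = two a + two b := by decide

theorem two_injective : Function.Injective two := by decide

theorem zmod2_cases : ∀ a : ZMod 2, a = 0 ∨ a = 1 := by decide

theorem sgn_zero : sgn 0 = 1 := by simp [sgn]

theorem sgn_one : sgn 1 = -1 := by simp [sgn, ZMod.val_one]

theorem sgn_add (a b : ZMod 2) : sgn (a + b) = sgn a * sgn b := by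
  have h : (1 + 1 : ZMod 2) = 0 := by decide
  rcases zmod2_cases a with rfl | rfl <;> rcases zmod2_cases b with rfl | rfl <;>
    simp [sgn_zero, sgn_one, h]

theorem sgn_sum {ι : Type*} (s : Finset ι) (f : ι → ZMod 2) :
    sgn (∑ i ∈ s, f i) = ∏ i ∈ s, sgn (f i) := by
  classical
  induction s using Finset.induction_on with
  | empty => simp [sgn_zero]
  | insert a s ha ih => rw [Finset.sum_insert ha, Finset.prod_insert ha, sgn_add, ih]

theorem sgn_injective : Function.Injective sgn := by
  intro a b h
  rcases zmod2_cases a with rfl | rfl <;> rcases zmod2_cases b with rfl | rfl <;>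
    first
    | rfl
    | (exfalso; norm_num [sgn_zero, sgn_one, Complex.ext_iff] at h)

theorem ipow_natCast (k : ℕ) : ipow (k : ZMod 4) = Complex.I ^ k := by
  rw [ipow, ZMod.val_natCast]
  conv_rhs => rw [← Nat.div_add_mod k 4, pow_add, pow_mul, Complex.I_pow_four, one_pow, one_mul]

theorem ipow_zero : ipow 0 = 1 := by simp [ipow]

theorem ipow_add (a b : ZMod 4) : ipow (a + b) = ipow a * ipow b := by
  have h : a + b = ((a.val + b.val : ℕ) : ZMod 4) := by simp
  rw [h, ipow_natCast, pow_add, ipow, ipow]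

theorem ipow_ne_zero (a : ZMod 4) : ipow a ≠ 0 := by simp [ipow]

theorem ipow_two (b : ZMod 2) : ipow (two b) = sgn b := by
  have h : two b = ((2 * b.val : ℕ) : ZMod 4) := by simp [two]
  rw [h, ipow_natCast, pow_mul, Complex.I_sq, sgn]

theorem ipow_injective : Function.Injective ipow := by
  have h : ∀ c : ZMod 4, c = 0 ∨ c = 1 ∨ c = 2 ∨ c = 3 := by decide
  have h2 : (2 : ZMod 4).val = 2 := rfl
  have h3 : (3 : ZMod 4).val = 3 := rfl
  have h1 : (1 : ZMod 4).val = 1 := rfl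
  intro a b hab
  rcases h a with rfl | rfl | rfl | rfl <;> rcases h b with rfl | rfl | rfl | rfl <;>
    first
    | rfl
    | (exfalso; norm_num [ipow, h1, h2, h3, Complex.ext_iff, pow_succ] at hab)

/-! ### Pauli operators as vectors -/

/-- The vector `(c, x, z)` stands for the Pauli operator `i ^ c X ^ x Z ^ z`. -/
@[ext] structure PV (n : ℕ) : Type where
  ph : ZMod 4
  x : Bits n
  z : Bits n

namespace PV

/-- The product of Pauli operators. -/
def mul (v w : PV n) : PV n := ⟨v.ph + w.ph + two (v.z ⬝ᵥ w.x), v.x + w.x, v.z + w.z⟩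

/-- The symplectic form; it vanishes if and only if the Pauli operators commute. -/
def symp (v w : PV n) : ZMod 2 := v.z ⬝ᵥ w.x + w.z ⬝ᵥ v.x

/-- The scalar `i ^ c`. -/
def scalar (c : ZMod 4) : PV n := ⟨c, 0, 0⟩

/-- Pauli `X` on qubit `i`. -/
def X (i : Fin n) : PV n := ⟨0, Pi.single i 1, 0⟩

/-- Pauli `Z` on qubit `i`. -/
def Z (i : Fin n) : PV n := ⟨0, 0, Pi.single i 1⟩

end PV

/-- The monomial matrix `|w⟩ ↦ a w |φ w⟩`. -/
def mono (φ : Bits n → Bits n) (a : Bits n → ℂ) : Op n :=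
  Matrix.of fun y w => if y = φ w then a w else 0

theorem mono_mul (φ ψ : Bits n → Bits n) (a b : Bits n → ℂ) :
    mono φ a * mono ψ b = mono (φ ∘ ψ) (fun w => a (ψ w) * b w) := by
  ext y w
  rw [Matrix.mul_apply, Finset.sum_eq_single (ψ w)]
  · by_cases h : y = φ (ψ w) <;> simp [mono, h]
  · intro u _ hu
    simp [mono, hu]
  · simp

theorem mono_congr {φ ψ : Bits n → Bits n} {a b : Bits n → ℂ} (h : ∀ w, φ w = ψ w)
    (h' : ∀ w, a w = b w) : mono φ a = mono ψ b := by
  rw [funext h, funext h']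

/-- The matrix of a Pauli operator. -/
noncomputable def W (v : PV n) : Op n :=
  mono (fun w => w + v.x) (fun w => ipow v.ph * sgn (v.z ⬝ᵥ w))

/-- Moving `Z ^ v.z` past `X ^ w.x` costs the sign `(-1) ^ (v.z ⬝ᵥ w.x)`. -/
theorem W_mul (v w : PV n) : W v * W w = W (v.mul w) := by
  rw [W, W, mono_mul]
  refine mono_congr (fun y => ?_) (fun y => ?_)
  · simp only [Function.comp, PV.mul]
    abel
  · simp only [PV.mul, dotProduct_add, add_dotProduct, ipow_add, ipow_two, sgn_add]
    ring

theorem W_scalar (c : ZMod 4) : W (PV.scalar c : PV n) = ipow c • 1 := by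
  ext y w
  simp [W, mono, PV.scalar, sgn_zero, Matrix.one_apply]

/-- Column `0` reveals the `X` part and the phase; the column of the `i`-th unit vector then reveals
`z i`. -/
theorem W_injective : Function.Injective (W : PV n → Op n) := by
  intro v w h
  have key : ∀ y u, W v y u = W w y u := fun y u => by rw [h]
  have hx : v.x = w.x := by
    have := key v.x 0
    by_contra hne
    simp [W, mono, hne, sgn_zero, ipow_ne_zero] at this
  have hph : v.ph = w.ph := by
    have := key v.x 0
    simp [W, mono, hx, sgn_zero] at this
    exact ipow_injective this
  have hz : v.z = w.z := by
    funext i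
    have := key (Pi.single i 1 + v.x) (Pi.single i 1)
    simp [W, mono, hx, hph, ipow_ne_zero] at this
    exact sgn_injective this
  exact PV.ext hph hx hz

/-! ### Tensor products -/

theorem tensor_mul (A B : Fin n → Matrix (ZMod 2) (ZMod 2) ℂ) :
    tensor A * tensor B = tensor (fun k => A k * B k) := by
  ext y w
  simp only [tensor, Matrix.mul_apply, Matrix.of_apply, ← Finset.prod_mul_distrib]
  rw [Finset.prod_univ_sum, Fintype.piFinset_univ]

theorem tensor_smul (c : Fin n → ℂ) (A : Fin n → Matrix (ZMod 2) (ZMod 2) ℂ) :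
    tensor (fun k => c k • A k) = (∏ k, c k) • tensor A := by
  ext y w
  simp [tensor, Finset.prod_mul_distrib]

theorem tensor_one : tensor (fun _ : Fin n => (1 : Matrix (ZMod 2) (ZMod 2) ℂ)) = 1 := by
  ext y w
  simp only [tensor, Matrix.of_apply, Matrix.one_apply]
  by_cases h : y = w
  · simp [h]
  · obtain ⟨k, hk⟩ := Function.ne_iff.mp h
    rw [if_neg h]
    exact Finset.prod_eq_zero (Finset.mem_univ k) (by simp [hk])

theorem tensor_conjTranspose (A : Fin n → Matrix (ZMod 2) (ZMod 2) ℂ) :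
    (tensor A)ᴴ = tensor (fun k => (A k)ᴴ) := by
  ext y w
  simp [tensor, Matrix.conjTranspose_apply]

/-- The one-qubit Pauli operator `X ^ x Z ^ z`. -/
noncomputable def pauli1 (x z : ZMod 2) : Matrix (ZMod 2) (ZMod 2) ℂ :=
  Matrix.of fun b a => if b = a + x then sgn (z * a) else 0

theorem W_eq_tensor (v : PV n) :
    W v = ipow v.ph • tensor (fun k => pauli1 (v.x k) (v.z k)) := by
  ext y w
  simp only [W, mono, tensor, pauli1, Matrix.of_apply, Matrix.smul_apply, smul_eq_mul]
  by_cases h : y = w + v.x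
  · subst h
    simp [dotProduct, sgn_sum]
  · obtain ⟨k, hk⟩ := Function.ne_iff.mp h
    rw [if_neg h, Finset.prod_eq_zero (Finset.mem_univ k), mul_zero]
    rw [if_neg (by simpa using hk)]

theorem matrix_zmod2_ext {A B : Matrix (ZMod 2) (ZMod 2) ℂ} (h00 : A 0 0 = B 0 0)
    (h01 : A 0 1 = B 0 1) (h10 : A 1 0 = B 1 0) (h11 : A 1 1 = B 1 1) : A = B := by
  ext i j
  rcases zmod2_cases i with rfl | rfl <;> rcases zmod2_cases j with rfl | rfl <;> assumption

theorem sum_zmod2 (f : ZMod 2 → ℂ) : ∑ i, f i = f 0 + f 1 := Fin.sum_univ_two f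

/-! ### Conjugation of Pauli operators by gates -/

/-- The action of a gate on Pauli operators by conjugation; of its inverse, if `inv` holds. -/
def Gate.act (inv : Bool) (g : Gate n) (v : PV n) : PV n :=
  match g with
  | .hadamard i =>
    ⟨v.ph + two (v.x i * v.z i), Function.update v.x i (v.z i), Function.update v.z i (v.x i)⟩
  | .phase i =>
    ⟨v.ph + (if inv then 3 else 1) * ((v.x i).val : ZMod 4), v.x,
      Function.update v.z i (v.z i + v.x i)⟩
  | .not i => ⟨v.ph + two (v.z i), v.x, v.z⟩
  | .cnot i j _ =>
    ⟨v.ph, Function.update v.x j (v.x j + v.x i), Function.update v.z i (v.z i + v.z j)⟩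
  | .cphase i j _ =>
    ⟨v.ph + two (v.x i * v.x j), v.x,
      Function.update (Function.update v.z i (v.z i + v.x j)) j (v.z j + v.x i)⟩

theorem zmod2_add_self (a : ZMod 2) : a + a = 0 := CharTwo.add_self_eq_zero a

theorem add_add_cancel_zmod2 (a b : ZMod 2) : a + b + b = a := by
  rw [add_assoc, zmod2_add_self, add_zero]

theorem two_add_two (a : ZMod 2) : two a + two a = 0 := by
  rw [← two_add, zmod2_add_self, two_zero]

/-- Of the five kinds of gates only PHASE is not an involution; its inverse contributes `i ^ 3` in
place of `i`. -/
theorem Gate.act_false_true (g : Gate n) (v : PV n) : g.act false (g.act true v) = v := by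
  cases g with
  | hadamard i =>
    refine PV.ext ?_ ?_ ?_
    · simp [Gate.act, add_assoc, mul_comm, two_add_two]
    · simp [Gate.act]
    · simp [Gate.act]
  | phase i =>
    refine PV.ext ?_ ?_ ?_
    · have h : (4 : ZMod 4) = 0 := rfl
      simp only [Gate.act, if_true, if_neg Bool.false_ne_true]
      linear_combination ((v.x i).val : ZMod 4) * h
    · simp [Gate.act]
    · simp [Gate.act, add_add_cancel_zmod2]
  | not i =>
    refine PV.ext ?_ ?_ ?_
    · simp [Gate.act, add_assoc, two_add_two]
    · simp [Gate.act]
    · simp [Gate.act]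
  | cnot i j h =>
    refine PV.ext ?_ ?_ ?_
    · simp [Gate.act]
    · simp [Gate.act, h, add_add_cancel_zmod2]
    · simp [Gate.act, h.symm, add_add_cancel_zmod2]
  | cphase i j h =>
    refine PV.ext ?_ ?_ ?_
    · simp [Gate.act, add_assoc, two_add_two]
    · simp [Gate.act]
    · funext k
      rcases eq_or_ne k j with rfl | hj
      · simp [Gate.act, add_add_cancel_zmod2]
      · rcases eq_or_ne k i with rfl | hi
        · simp [Gate.act, hj, add_add_cancel_zmod2]
        · simp [Gate.act, hi, hj]

/-- Reduces conjugation by a one-qubit gate to an identity of `2 × 2` matrices: the scalar of the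
`i`-th tensor factor becomes a global phase. -/
theorem onQubit_mul_W (i : Fin n) (G : Matrix (ZMod 2) (ZMod 2) ℂ) (v : PV n) (c : ZMod 4)
    (x z : ZMod 2) (h : G * pauli1 (v.x i) (v.z i) = ipow c • (pauli1 x z * G)) :
    onQubit i G * W v =
      W ⟨v.ph + c, Function.update v.x i x, Function.update v.z i z⟩ * onQubit i G := by
  have key : (fun k => Function.update (fun _ => (1 : Matrix (ZMod 2) (ZMod 2) ℂ)) i G k *
      pauli1 (v.x k) (v.z k)) = fun k : Fin n => (if k = i then ipow c else 1) •
        (pauli1 (Function.update v.x i x k) (Function.update v.z i z k) *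
          Function.update (fun _ => (1 : Matrix (ZMod 2) (ZMod 2) ℂ)) i G k) := by
    funext k
    rcases eq_or_ne k i with rfl | hk
    · simpa using h
    · simp [hk]
  rw [W_eq_tensor, W_eq_tensor, onQubit, Matrix.mul_smul, tensor_mul, Matrix.smul_mul, tensor_mul,
    key, tensor_smul, smul_smul, ipow_add]
  simp

theorem one_add_one_zmod2 : (1 + 1 : ZMod 2) = 0 := by decide

theorem ipow_one : ipow 1 = Complex.I := by
  have h : (1 : ZMod 4).val = 1 := rfl
  simp [ipow, h]

theorem val_one_zmod2 : (1 : ZMod 2).val = 1 := rfl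

theorem matH_mul_pauli1 (x z : ZMod 2) :
    matH * pauli1 x z = ipow (two (x * z)) • (pauli1 z x * matH) := by
  rw [ipow_two]
  rcases zmod2_cases x with rfl | rfl <;> rcases zmod2_cases z with rfl | rfl <;>
    apply matrix_zmod2_ext <;>
    simp [matH, pauli1, Matrix.mul_apply, sum_zmod2, sgn_zero, sgn_one, one_add_one_zmod2,
      val_one_zmod2, neg_div]

theorem matP_mul_pauli1 (x z : ZMod 2) :
    matP * pauli1 x z = ipow (x.val : ZMod 4) • (pauli1 x (z + x) * matP) := by
  rcases zmod2_cases x with rfl | rfl <;> rcases zmod2_cases z with rfl | rfl <;>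
    apply matrix_zmod2_ext <;>
    simp [matP, pauli1, Matrix.mul_apply, sgn_zero, sgn_one, one_add_one_zmod2,
      val_one_zmod2, ipow_zero, ipow_one, Matrix.diagonal]

theorem matX_mul_pauli1 (x z : ZMod 2) :
    matX * pauli1 x z = ipow (two z) • (pauli1 x z * matX) := by
  rw [ipow_two]
  rcases zmod2_cases x with rfl | rfl <;> rcases zmod2_cases z with rfl | rfl <;>
    apply matrix_zmod2_ext <;>
    simp [matX, pauli1, Matrix.mul_apply, sgn_zero, sgn_one, one_add_one_zmod2]

theorem update_dotProduct' (z w : Bits n) (i : Fin n) (a : ZMod 2) :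
    Function.update z i (z i + a) ⬝ᵥ w = z ⬝ᵥ w + a * w i := by
  have : Function.update z i (z i + a) = z + Pi.single i a := by
    funext k
    rcases eq_or_ne k i with rfl | hk <;> simp [*]
  rw [this, add_dotProduct, single_dotProduct]

theorem dotProduct_update' (z w : Bits n) (i : Fin n) (a : ZMod 2) :
    z ⬝ᵥ Function.update w i (w i + a) = z ⬝ᵥ w + z i * a := by
  rw [dotProduct_comm, update_dotProduct', dotProduct_comm, mul_comm]

theorem cnot_eq_mono (i j : Fin n) (h : i ≠ j) :
    (Gate.cnot i j h).matrix = mono (fun w => Function.update w j (w j + w i)) fun _ => 1 := by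
  ext y w
  simp [Gate.matrix, mono, add_comm]

theorem cphase_eq_mono (i j : Fin n) (h : i ≠ j) :
    (Gate.cphase i j h).matrix = mono id (fun w => sgn (w i * w j)) := by
  ext y w
  simp only [Gate.matrix, mono, Matrix.diagonal_apply, Matrix.of_apply, id]
  by_cases hyw : y = w
  · subst hyw
    simp only [if_true]
    rcases zmod2_cases (y i) with hi | hi <;> rcases zmod2_cases (y j) with hj | hj <;>
      simp [hi, hj, sgn_zero, sgn_one, val_one_zmod2]
  · simp [hyw]

theorem Gate.matrix_mul_W (g : Gate n) (v : PV n) :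
    g.matrix * W v = W (g.act false v) * g.matrix := by
  cases g with
  | hadamard i =>
    exact onQubit_mul_W i matH v _ _ _ (matH_mul_pauli1 _ _)
  | phase i =>
    have := onQubit_mul_W i matP v _ _ _ (matP_mul_pauli1 _ _)
    rw [Function.update_eq_self] at this
    simpa [Gate.act, Gate.matrix] using this
  | not i =>
    have := onQubit_mul_W i matX v _ _ _ (matX_mul_pauli1 _ _)
    rw [Function.update_eq_self, Function.update_eq_self] at this
    simpa [Gate.act, Gate.matrix] using this
  | cnot i j h =>
    rw [cnot_eq_mono, W, W, mono_mul, mono_mul]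
    refine mono_congr (fun w => ?_) (fun w => ?_)
    · funext k
      rcases eq_or_ne k j with rfl | hk
      · simp [Gate.act]
        ring
      · simp [Gate.act, hk]
    · simp only [Gate.act, update_dotProduct', dotProduct_update', one_mul, mul_one]
      rw [Function.update_of_ne h.symm, add_add_cancel_zmod2]
  | cphase i j h =>
    rw [cphase_eq_mono, W, W, mono_mul, mono_mul]
    refine mono_congr (fun w => ?_) (fun w => ?_)
    · simp [Gate.act]
    -- `update_dotProduct'` needs an update of the form "old entry plus `a`"; as `i ≠ j`, the first
    -- update has not changed entry `j`.
    · have hz : v.z j + v.x i = Function.update v.z i (v.z i + v.x j) j + v.x i := by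
        rw [Function.update_of_ne h.symm]
      simp only [Gate.act, id]
      rw [hz, update_dotProduct', update_dotProduct', ipow_add, ipow_two]
      simp only [Pi.add_apply, add_mul, mul_add, sgn_add]
      rw [mul_comm (w i) (v.x j)]
      ring

theorem onQubit_unitary (i : Fin n) (G : Matrix (ZMod 2) (ZMod 2) ℂ) (h : Gᴴ * G = 1) :
    (onQubit i G)ᴴ * onQubit i G = 1 := by
  rw [onQubit, tensor_conjTranspose, tensor_mul, ← tensor_one]
  congr 1
  funext k
  rcases eq_or_ne k i with rfl | hk <;> simp [*]

theorem sqrt_two_mul_sqrt_two : ((Real.sqrt 2 : ℝ) : ℂ) * (Real.sqrt 2 : ℝ) = 2 := by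
  rw [← Complex.ofReal_mul, Real.mul_self_sqrt (by norm_num)]
  norm_num

theorem matH_unitary : matHᴴ * matH = 1 := by
  have hs := sqrt_two_mul_sqrt_two
  have hs0 : ((Real.sqrt 2 : ℝ) : ℂ) ≠ 0 := by
    intro h
    rw [h] at hs
    norm_num at hs
  apply matrix_zmod2_ext <;>
    simp [matH, Matrix.mul_apply, Matrix.conjTranspose_apply, sum_zmod2, val_one_zmod2] <;>
    field_simp <;> ring_nf <;>
    first
    | linear_combination hs
    | linear_combination -hs

theorem matP_unitary : matPᴴ * matP = 1 := by
  apply matrix_zmod2_ext <;>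
    simp [matP, Matrix.diagonal, Matrix.mul_apply, Matrix.conjTranspose_apply,
      val_one_zmod2]

theorem matX_unitary : matXᴴ * matX = 1 := by
  apply matrix_zmod2_ext <;>
    simp [matX, Matrix.mul_apply, Matrix.conjTranspose_apply, one_add_one_zmod2]

theorem mono_conjTranspose_mul_self (φ : Bits n → Bits n) (a : Bits n → ℂ)
    (hφ : Function.Injective φ) (ha : ∀ w, star (a w) * a w = 1) :
    (mono φ a)ᴴ * mono φ a = 1 := by
  ext y w
  rw [Matrix.mul_apply, Finset.sum_eq_single (φ w)]
  · by_cases h : y = w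
    · subst h
      simpa [mono] using ha y
    · simp [mono, Matrix.conjTranspose_apply, h, hφ.ne (Ne.symm h)]
  · intro u _ hu
    simp [mono, hu]
  · simp

theorem star_sgn_mul_sgn (b : ZMod 2) : star (sgn b) * sgn b = 1 := by
  rcases zmod2_cases b with rfl | rfl <;> simp [sgn_zero, sgn_one]

theorem Gate.matrix_unitary (g : Gate n) : g.matrixᴴ * g.matrix = 1 := by
  cases g with
  | hadamard i => exact onQubit_unitary i _ matH_unitary
  | phase i => exact onQubit_unitary i _ matP_unitary
  | not i => exact onQubit_unitary i _ matX_unitary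
  | cnot i j h =>
    rw [cnot_eq_mono]
    refine mono_conjTranspose_mul_self _ _ (Function.LeftInverse.injective
      (g := fun w => Function.update w j (w j + w i)) fun w => ?_) (fun w => by simp)
    funext k
    rcases eq_or_ne k j with rfl | hk
    · simp [h, add_add_cancel_zmod2]
    · simp [hk]
  | cphase i j h =>
    rw [cphase_eq_mono]
    exact mono_conjTranspose_mul_self _ _ Function.injective_id fun w => star_sgn_mul_sgn _

/-! ### Unitary matrices that permute the Pauli operators -/

/-- `U` is unitary and conjugation by `U` maps the Pauli operator `v` to `F v`. -/
structure Implements (U : Op n) (F : PV n → PV n) : Prop where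
  unitary : Uᴴ * U = 1
  conj : ∀ v, U * W v = W (F v) * U

theorem Gate.implements (g : Gate n) : Implements g.matrix (g.act false) :=
  ⟨g.matrix_unitary, g.matrix_mul_W⟩

theorem Gate.implements_conjTranspose (g : Gate n) : Implements g.matrixᴴ (g.act true) := by
  have h := mul_eq_one_comm.mp g.matrix_unitary
  refine ⟨by rwa [conjTranspose_conjTranspose], fun v => ?_⟩
  have key := g.matrix_mul_W (g.act true v)
  rw [g.act_false_true] at key
  calc g.matrixᴴ * W v = g.matrixᴴ * (W v * g.matrix) * g.matrixᴴ := by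
        rw [mul_assoc, mul_assoc, h, mul_one]
    _ = W (g.act true v) * g.matrixᴴ := by
        rw [← key, ← mul_assoc, g.matrix_unitary, one_mul]

theorem Implements.comp {U V : Op n} {F G : PV n → PV n} (hU : Implements U F)
    (hV : Implements V G) : Implements (U * V) (F ∘ G) := by
  refine ⟨?_, fun v => ?_⟩
  · rw [conjTranspose_mul, mul_assoc, ← mul_assoc Uᴴ, hU.unitary, one_mul, hV.unitary]
  · rw [mul_assoc, hV.conj, ← mul_assoc, hU.conj, mul_assoc, Function.comp]

theorem Implements.one : Implements (1 : Op n) id := ⟨by simp, fun v => by simp⟩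

/-- An automorphism of the Pauli group that fixes the scalars. -/
structure IsPauliAut (F : PV n → PV n) : Prop where
  map_mul : ∀ v w, F (v.mul w) = (F v).mul (F w)
  map_scalar : ∀ c, F (PV.scalar c) = PV.scalar c

/-- Conjugation is multiplicative and fixes scalars; `F` inherits this because `U` can be cancelled
and `W` is injective. -/
theorem Implements.isPauliAut {U : Op n} {F : PV n → PV n} (h : Implements U F) :
    IsPauliAut F := by
  have h1 := mul_eq_one_comm.mp h.unitary
  have cancel : ∀ A B : Op n, A * U = B * U → A = B := fun A B hAB => by
    have := congrArg (· * Uᴴ) hAB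
    simpa [mul_assoc, h1] using this
  refine ⟨fun v w => W_injective (cancel _ _ ?_), fun c => W_injective (cancel _ _ ?_)⟩
  · rw [← h.conj, ← W_mul, ← mul_assoc, h.conj, mul_assoc, h.conj, ← mul_assoc, W_mul]
  · rw [← h.conj, W_scalar]
    simp

namespace IsPauliAut

variable {F : PV n → PV n}

/-- Modulo scalars the Pauli group is a vector space over `ℤ/2`, on which `F` is linear: `v` differs
from the product of `a` and `b` by a scalar only. -/
theorem map_add (hF : IsPauliAut F) {v a b : PV n} (hx : v.x = a.x + b.x) (hz : v.z = a.z + b.z) :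
    (F v).x = (F a).x + (F b).x ∧ (F v).z = (F a).z + (F b).z := by
  have h : v = (PV.scalar (v.ph - (a.mul b).ph)).mul (a.mul b) := by
    refine PV.ext ?_ ?_ ?_ <;> simp [PV.mul, PV.scalar, two_zero, hx, hz]
  rw [h, hF.map_mul, hF.map_mul, hF.map_scalar]
  simp [PV.mul, PV.scalar]

/-- The symplectic form is the exponent of the commutation sign, a scalar, and `F` fixes scalars. -/
theorem symp_map (hF : IsPauliAut F) (v w : PV n) : (F v).symp (F w) = v.symp w := by
  have h : ∀ v w : PV n, v.mul w = (PV.scalar (two (v.symp w))).mul (w.mul v) := by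
    intro v w
    refine PV.ext ?_ ?_ ?_
    · have := two_add_two (w.z ⬝ᵥ v.x)
      simp only [PV.mul, PV.scalar, PV.symp, zero_dotProduct, two_zero, two_add]
      linear_combination -this
    · simp [PV.mul, PV.scalar, add_comm]
    · simp [PV.mul, PV.scalar, add_comm]
  have h1 := congrArg F (h v w)
  rw [hF.map_mul, hF.map_mul, hF.map_mul, hF.map_scalar, h (F v)] at h1
  have h2 := congrArg PV.ph h1
  simp only [PV.mul, PV.scalar, zero_dotProduct, two_zero, add_zero, add_left_inj] at h2
  exact two_injective h2

theorem comp {G : PV n → PV n} (hF : IsPauliAut F) (hG : IsPauliAut G) : IsPauliAut (F ∘ G) :=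
  ⟨fun v w => by simp [hG.map_mul, hF.map_mul], fun c => by simp [hG.map_scalar, hF.map_scalar]⟩

end IsPauliAut

/-! ### Reduction of an automorphism of the Pauli group by five sweeps -/

/-! ### The reduction -/

/-- Shapes of the gates that one step of the reduction may emit for a pair `(k, j)`. -/
inductive Shape : Type
  | cnot | cnotRev | cphase | phase | not | z

/-- The gates of a shape. Two-qubit gates need `k ≠ j`, one-qubit gates need `k = j`. -/
def Shape.gates (s : Shape) (k j : Fin n) : List (Gate n) :=
  match s with
  | .cnot => if h : k ≠ j then [.cnot k j h] else []
  | .cnotRev => if h : k ≠ j then [.cnot j k h.symm] else []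
  | .cphase => if h : k ≠ j then [.cphase k j h] else []
  | .phase => if k = j then [.phase k] else []
  | .not => if k = j then [.not k] else []
  | .z => if k = j then [.phase k, .phase k] else []

/-- A step of the reduction: gates of the given shape are split off on the left or on the right
if all the tests, which refer to entries of `view`, have the given results. -/
structure Step : Type where
  left : Bool
  shape : Shape
  tests : List (ℕ × Bool)

/-- The data that the tests for the pair `(k, j)` may refer to. -/
def view (F : PV n → PV n) (k j : Fin n) : ℕ → ℕ
  | 0 => ((F (.Z k)).x k).val
  | 1 => ((F (.Z k)).x j).val
  | 2 => ((F (.Z k)).z k).val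
  | 3 => ((F (.Z k)).z j).val
  | 4 => ((F (.Z j)).x j).val
  | 5 => ((F (.Z j)).x k).val
  | 6 => ((F (.Z j)).z k).val
  -- Entry 7 is `zPart F (.X k) j`; entries 8 and 9 are the phases of the images of `preZ F k` and
  -- `preX F k`.
  | 7 => if (F (.Z j)).x j = 0 then ((F (.X k)).z j).val else ((F (.X k)).x j).val
  | 8 => if (F (.Z k)).x k = 0 then (F (.Z k)).ph.val else (F (.X k)).ph.val
  | 9 => if (F (.Z k)).x k = 0 then (F (.X k)).ph.val else (F (.Z k)).ph.val
  | _ => 0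

/-- The step applies to the pair `(k, j)`. -/
def Step.Fires (s : Step) (F : PV n → PV n) (k j : Fin n) : Prop :=
  ∀ t ∈ s.tests, (view F k j t.1 ≠ 0 ↔ t.2 = true)

instance (s : Step) (F : PV n → PV n) (k j : Fin n) : Decidable (s.Fires F k j) :=
  inferInstanceAs (Decidable (∀ t ∈ s.tests, (view F k j t.1 ≠ 0 ↔ t.2 = true)))

/-- The effect of splitting off the given gates on the left or on the right. -/
def splitOff (left : Bool) (gs : List (Gate n)) (F : PV n → PV n) : PV n → PV n :=
  if left then fun v => gs.foldr (Gate.act true) (F v)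
  else fun v => F (gs.foldl (fun v g => g.act true v) v)

/-- The effect of a step on automorphisms of the Pauli group. -/
def Step.onAut (s : Step) (k j : Fin n) (F : PV n → PV n) : PV n → PV n :=
  if s.Fires F k j then splitOff s.left (s.shape.gates k j) F else F

/-- Apply the steps of a list: for every `k`, for every step of the list, for every `j`. -/
def sweep {α : Type*} (ss : List (Fin n → Fin n → α → α)) (a : α) : α :=
  (List.finRange n).foldl (fun a k => ss.foldl
    (fun a s => (List.finRange n).foldl (fun a j => s k j a) a) a) a

/-- Clear the `X` parts of the images of the `Z k` outside of the diagonal. -/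
def stepsX : List Step :=
  -- On the matrix `xOfZ F` these steps act as `pivot`, `clearRow` and `clearCol`.
  [⟨false, .cnotRev, [(0, false), (5, true)]⟩, ⟨true, .cnot, [(0, true), (1, true)]⟩,
    ⟨false, .cnot, [(0, true), (5, true)]⟩]

/-- The same for the `Z` parts of those images whose `X` part vanishes. -/
def stepsZ : List Step :=
  -- The same elimination for `maskedZ F`; tests 0 and 4 confine it to qubits whose diagonal entry
  -- of `xOfZ F` vanishes. On the left the CNOT is reversed in comparison with `stepsX`, since CNOT
  -- treats `Z` parts dually.
  [⟨false, .cnotRev, [(0, false), (4, false), (2, false), (6, true)]⟩,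
    ⟨true, .cnotRev, [(0, false), (2, true), (4, false), (3, true)]⟩,
    ⟨false, .cnot, [(0, false), (2, true), (4, false), (6, true)]⟩]

/-- Clear the `Z` parts of the other images. -/
def stepsL : List Step :=
  [⟨true, .phase, [(0, true), (2, true)]⟩, ⟨true, .cphase, [(0, true), (3, true)]⟩]

/-- Clear the images of the `X k`. -/
def stepsR : List Step := [⟨false, .phase, [(7, true)]⟩, ⟨false, .cphase, [(7, true)]⟩]

/-- Clear the signs. -/
def stepsSign : List Step := [⟨true, .not, [(8, true)]⟩, ⟨true, .z, [(9, true)]⟩]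

/-- All sweeps of the reduction. -/
def sweeps : List (List Step) := [stepsX, stepsZ, stepsL, stepsR, stepsSign]

/-- The reduction, on automorphisms of the Pauli group. -/
def reduceAut (F : PV n → PV n) : PV n → PV n :=
  sweeps.foldl (fun F ss => sweep (ss.map Step.onAut) F) F

theorem splitOff_isPauliAut (left : Bool) (gs : List (Gate n)) {F : PV n → PV n}
    (hF : IsPauliAut F) : IsPauliAut (splitOff left gs F) := by
  have hg : ∀ g : Gate n, IsPauliAut (g.act true) := fun g => g.implements_conjTranspose.isPauliAut
  cases left
  · simp only [splitOff, Bool.false_eq_true, if_false]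
    induction gs generalizing F with
    | nil => exact hF
    | cons g gs ih => exact (ih hF).comp (hg g)
  · simp only [splitOff, if_true]
    induction gs with
    | nil => exact hF
    | cons g gs ih => exact (hg g).comp ih

theorem Step.onAut_isPauliAut (s : Step) (k j : Fin n) {F : PV n → PV n} (hF : IsPauliAut F) :
    IsPauliAut (s.onAut k j F) := by
  rw [Step.onAut]
  split_ifs
  · exact splitOff_isPauliAut _ _ hF
  · exact hF

/-! ### Folding -/

/-- Loop rule: under the invariant `I`, every pass achieves its own goal `P b` and spoils none that
has been achieved before. -/
theorem foldl_establish {α β : Type*} (f : α → β → α) (l : List β) (I : α → Prop)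
    (P : β → α → Prop) (hI : ∀ a b, I a → I (f a b)) (hP : ∀ a b, I a → P b (f a b))
    (hk : ∀ a b c, I a → P c a → P c (f a b)) (a : α) (ha : I a) :
    I (l.foldl f a) ∧ ∀ b ∈ l, P b (l.foldl f a) := by
  induction l using List.reverseRecOn with
  | nil => simpa using ha
  | append_singleton l b ih =>
    simp only [List.foldl_append, List.foldl_cons, List.foldl_nil]
    refine ⟨hI _ _ ih.1, fun c hc => ?_⟩
    rcases List.mem_append.mp hc with hc | hc
    · exact hk _ _ _ ih.1 (ih.2 c hc)
    · rw [List.mem_singleton.mp hc]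
      exact hP _ _ ih.1

/-- The loop rule for the three nested loops of a sweep. It serves the last three sweeps, where no
step undoes the work of another; the eliminations of the first two rest on `sweep_diagonalizes`. -/
theorem sweep_establish {α ι : Type*} (act : ι → Fin n → Fin n → α → α) (ss : List ι)
    (I : α → Prop) (P : ι → Fin n → Fin n → α → Prop)
    (hI : ∀ s ∈ ss, ∀ k j a, I a → I (act s k j a))
    (hP : ∀ s ∈ ss, ∀ k j a, I a → P s k j (act s k j a))
    (hk : ∀ s ∈ ss, ∀ t ∈ ss, ∀ k j k' j' a, I a → P t k' j' a → P t k' j' (act s k j a))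
    (a : α) (ha : I a) :
    I (sweep (ss.map act) a) ∧ ∀ s ∈ ss, ∀ k j, P s k j (sweep (ss.map act) a) := by
  have row : ∀ s ∈ ss, ∀ k a, I a → I ((List.finRange n).foldl (fun a j => act s k j a) a) ∧
      (∀ j, P s k j ((List.finRange n).foldl (fun a j => act s k j a) a)) := fun s hs k a ha =>
    let h := foldl_establish (fun a j => act s k j a) (List.finRange n) I (fun j a => P s k j a)
      (fun a j => hI s hs k j a) (fun a j => hP s hs k j a)
      (fun a j j' => hk s hs s hs k j k j' a) a ha
    ⟨h.1, fun j => h.2 j (List.mem_finRange j)⟩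
  have rowKeep : ∀ s ∈ ss, ∀ t ∈ ss, ∀ k k' j' a, I a → P t k' j' a →
      P t k' j' ((List.finRange n).foldl (fun a j => act s k j a) a) :=
    fun s hs t ht k k' j' a ha h =>
      (foldl_establish (fun a j => act s k j a) (List.finRange n) (fun a => I a ∧ P t k' j' a)
        (fun _ _ => True) (fun a j h => ⟨hI s hs k j a h.1, hk s hs t ht k j k' j' a h.1 h.2⟩)
        (fun _ _ _ => trivial) (fun _ _ _ _ _ => trivial) a ⟨ha, h⟩).1.2
  have inner : ∀ l : List ι, (∀ s ∈ l, s ∈ ss) → ∀ k a, I a →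
      I (l.foldl (fun a s => (List.finRange n).foldl (fun a j => act s k j a) a) a) ∧
      (∀ s ∈ l, ∀ j, P s k j
        (l.foldl (fun a s => (List.finRange n).foldl (fun a j => act s k j a) a) a)) ∧
      ∀ t ∈ ss, ∀ k' j', P t k' j' a → P t k' j'
        (l.foldl (fun a s => (List.finRange n).foldl (fun a j => act s k j a) a) a) := by
    intro l
    induction l using List.reverseRecOn with
    | nil => exact fun _ k a ha => ⟨ha, by simp, fun t _ k' j' h => h⟩
    | append_singleton l s ih =>
      intro hl k a ha
      have hs : s ∈ ss := hl s (by simp)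
      obtain ⟨h1, h2, h3⟩ := ih (fun t ht => hl t (by simp [ht])) k a ha
      simp only [List.foldl_append, List.foldl_cons, List.foldl_nil]
      refine ⟨(row s hs k _ h1).1, fun t ht j => ?_, fun t ht k' j' h =>
        rowKeep s hs t ht k k' j' _ h1 (h3 t ht k' j' h)⟩
      rcases List.mem_append.mp ht with ht | ht
      · exact rowKeep s hs t (hl t (by simp [ht])) k k j _ h1 (h2 t ht j)
      · rw [List.mem_singleton.mp ht]
        exact (row s hs k _ h1).2 j
  have h := foldl_establish (fun a k => ss.foldl
    (fun a s => (List.finRange n).foldl (fun a j => act s k j a) a) a) (List.finRange n) I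
    (fun k a => ∀ s ∈ ss, ∀ j, P s k j a) (fun a k h => (inner ss (fun _ h => h) k a h).1)
    (fun a k h => (inner ss (fun _ h => h) k a h).2.1)
    (fun a k c h h' s hs j => (inner ss (fun _ h => h) k a h).2.2 s hs c j (h' s hs j)) a ha
  simp only [sweep, List.foldl_map]
  exact ⟨h.1, fun s hs k j => h.2 k (List.mem_finRange k) s hs j⟩

/-! ### Diagonalization of a matrix over `ℤ/2` by row and column operations -/

/-- Add row `i` to row `k`. -/
def addRow (i k : Fin n) (M : Fin n → Fin n → ZMod 2) : Fin n → Fin n → ZMod 2 :=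
  fun a b => if a = k then M a b + M i b else M a b

/-- Add column `i` to column `k`. -/
def addCol (i k : Fin n) (M : Fin n → Fin n → ZMod 2) : Fin n → Fin n → ZMod 2 :=
  fun a b => if b = k then M a b + M a i else M a b

/-- Make the `k`-th diagonal entry nonzero with the help of row `j`. -/
def pivot (k j : Fin n) (M : Fin n → Fin n → ZMod 2) : Fin n → Fin n → ZMod 2 :=
  if k ≠ j ∧ M k k = 0 ∧ M j k = 1 then addRow j k M else M

/-- Clear the entry `(k, j)`. -/
def clearRow (k j : Fin n) (M : Fin n → Fin n → ZMod 2) : Fin n → Fin n → ZMod 2 :=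
  if k ≠ j ∧ M k k = 1 ∧ M k j = 1 then addCol k j M else M

/-- Clear the entry `(j, k)`. -/
def clearCol (k j : Fin n) (M : Fin n → Fin n → ZMod 2) : Fin n → Fin n → ZMod 2 :=
  if k ≠ j ∧ M k k = 1 ∧ M j k = 1 then addRow k j M else M

/-- Column `k` is diagonal, and row `k` too unless the diagonal entry vanishes. -/
def Cleared (M : Fin n → Fin n → ZMod 2) (k : Fin n) : Prop :=
  (∀ j, j ≠ k → M j k = 0) ∧ (M k k = 1 → ∀ j, j ≠ k → M k j = 0)

/-- The critical case is `j = i`. Then `M i k = 1`, so row `i` has not been cleared, hence `M i i =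
0` and the whole column `i` vanishes; adding row `i` to row `k` does not disturb it. -/
theorem pivot_cleared {k j i : Fin n} {M : Fin n → Fin n → ZMod 2} (hi : i ≠ k)
    (h : Cleared M i) : Cleared (pivot k j M) i := by
  unfold pivot
  split_ifs with hc
  · refine ⟨fun a ha => ?_, fun h1 a ha => ?_⟩
    · have h0 := h.1 a ha
      rcases eq_or_ne a k with rfl | hak
      · rcases eq_or_ne j i with rfl | hji
        · rcases zmod2_cases (M j j) with h2 | h2
          · simp [addRow, h0, h2]
          · have := h.2 h2 a ha
            simp [this] at hc
        · simp [addRow, h0, h.1 j hji]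
      · simp [addRow, hak, h0]
    · simp only [addRow, if_neg hi] at h1 ⊢
      exact h.2 h1 a ha
  · exact h

/-- Column `i` is not the one that changes, because `M k i = 0`. In row `i` only entry `j` changes,
by `M i k`, which vanishes if row `i` is cleared. -/
theorem clearRow_cleared {k j i : Fin n} {M : Fin n → Fin n → ZMod 2} (hi : i ≠ k)
    (h : Cleared M i) : Cleared (clearRow k j M) i := by
  unfold clearRow
  split_ifs with hc
  · have hji : i ≠ j := by
      rintro rfl
      have := h.1 k hi.symm
      simp [this] at hc
    refine ⟨fun a ha => ?_, fun h1 a ha => ?_⟩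
    · simp [addCol, hji, h.1 a ha]
    · simp only [addCol, if_neg hji] at h1 ⊢
      simp [h.2 h1 a ha, h.2 h1 k hi.symm]
  · exact h

/-- Row `k` has a zero in column `i`, so adding it leaves column `i` alone. A cleared row `i` is not
changed, because it has a zero in column `k`. -/
theorem clearCol_cleared {k j i : Fin n} {M : Fin n → Fin n → ZMod 2} (hi : i ≠ k)
    (h : Cleared M i) : Cleared (clearCol k j M) i := by
  unfold clearCol
  split_ifs with hc
  · have hki : M k i = 0 := h.1 k hi.symm
    refine ⟨fun a ha => ?_, fun h1 a ha => ?_⟩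
    · simp [addRow, hki, h.1 a ha]
    · have h1' : M i i = 1 := by
        simpa [addRow, hki] using h1
      have hij : i ≠ j := by
        rintro rfl
        have := h.2 h1' k hi.symm
        simp [this] at hc
      simpa [addRow, hij] using h.2 h1' a ha
  · exact h

/-- Round `k` achieves `Cleared M k` and preserves it for the other indices. If there is no pivot,
column `k` is zero already, so swaps are unnecessary. Row `k` may then remain uncleared, but its
entries lie in columns that have rounds of their own, and in the end all columns are diagonal. -/
theorem sweep_diagonalizes (M : Fin n → Fin n → ZMod 2) :
    ∀ j k, j ≠ k → sweep [pivot, clearRow, clearCol] M j k = 0 := by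
  have round : ∀ M k, Cleared ([pivot, clearRow, clearCol].foldl (fun M s =>
      (List.finRange n).foldl (fun M j => s k j M) M) M) k ∧
      ∀ i, Cleared M i → i ≠ k → Cleared ([pivot, clearRow, clearCol].foldl (fun M s =>
        (List.finRange n).foldl (fun M j => s k j M) M) M) i := by
    intro M k
    simp only [List.foldl_cons, List.foldl_nil]
    -- After this pass the diagonal entry is `1` or column `k` vanishes.
    obtain ⟨-, h1⟩ := foldl_establish (fun M j => pivot k j M) (List.finRange n)
      (fun _ : Fin n → Fin n → ZMod 2 => True) (fun j M => M k k = 1 ∨ M j k = 0)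
      (fun _ _ _ => trivial)
      (fun M j _ => by
        rcases zmod2_cases (M k k) with h | h <;> rcases zmod2_cases (M j k) with h' | h' <;>
          rcases eq_or_ne k j with rfl | hkj <;> simp_all [pivot, addRow])
      (fun M j c _ h => by
        unfold pivot
        split_ifs with hc
        · left
          simp [addRow, hc]
        · exact h) M trivial
    -- Here only the invariant of the loop rule matters: it says that `Cleared` survives for the
    -- index `i`.
    have k1 := fun i => (foldl_establish (fun M j => pivot k j M) (List.finRange n)
      (fun N => (Cleared M i ∧ i ≠ k) → Cleared N i) (fun _ _ => True)
      (fun N j h h' => pivot_cleared h'.2 (h h')) (fun _ _ _ => trivial)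
      (fun _ _ _ _ _ => trivial) M (fun h => h.1)).1
    set M1 := (List.finRange n).foldl (fun M j => pivot k j M) M
    obtain ⟨h2, h2'⟩ := foldl_establish (fun M j => clearRow k j M) (List.finRange n)
      (fun M => M k k = 1 ∨ ∀ j, M j k = 0) (fun j M => M k k = 1 → j ≠ k → M k j = 0)
      (fun M j h => by
        unfold clearRow
        split_ifs with hc
        · simpa [addCol, hc.1] using h
        · exact h)
      (fun M j _ => by
        unfold clearRow
        split_ifs with hc
        · simp [addCol, hc, one_add_one_zmod2]
        · intro h hj
          rcases zmod2_cases (M k j) with h' | h'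
          · exact h'
          · exact absurd ⟨hj.symm, h, h'⟩ hc)
      (fun M j c _ h => by
        unfold clearRow
        split_ifs with hc
        · rcases eq_or_ne c j with rfl | hcj
          · simp [addCol, hc, one_add_one_zmod2]
          · simpa [addCol, hc.1, hcj] using h
        · exact h) M1 (by
          by_cases h : M1 k k = 1
          · exact Or.inl h
          · exact Or.inr fun j => (h1 j (List.mem_finRange j)).resolve_left h)
    have k2 := fun i => (foldl_establish (fun M j => clearRow k j M) (List.finRange n)
      (fun N => (Cleared M1 i ∧ i ≠ k) → Cleared N i) (fun _ _ => True)
      (fun N j h h' => clearRow_cleared h'.2 (h h')) (fun _ _ _ => trivial)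
      (fun _ _ _ _ _ => trivial) M1 (fun h => h.1)).1
    set M2 := (List.finRange n).foldl (fun M j => clearRow k j M) M1
    obtain ⟨h3, h3'⟩ := foldl_establish (fun M j => clearCol k j M) (List.finRange n)
      (fun M => (M k k = 1 ∨ ∀ j, M j k = 0) ∧ (∀ j, M k k = 1 → j ≠ k → M k j = 0))
      (fun j M => M k k = 1 → j ≠ k → M j k = 0)
      (fun M j h => by
        unfold clearCol
        split_ifs with hc
        · have hk1 := hc.2.1
          refine ⟨Or.inl (by simp [addRow, hc.1, hk1]), fun j' _ hj' => ?_⟩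
          simpa [addRow, hc.1] using h.2 j' hk1 hj'
        · exact h)
      (fun M j _ => by
        unfold clearCol
        split_ifs with hc
        · simp [addRow, hc, one_add_one_zmod2]
        · intro h hj
          rcases zmod2_cases (M j k) with h' | h'
          · exact h'
          · exact absurd ⟨hj.symm, h, h'⟩ hc)
      (fun M j c _ h => by
        unfold clearCol
        split_ifs with hc
        · rcases eq_or_ne c j with rfl | hcj
          · simp [addRow, hc, one_add_one_zmod2]
          · simpa [addRow, hc.1, hcj] using h
        · exact h) M2 ⟨h2, fun j => h2' j (List.mem_finRange j)⟩
    have k3 := fun i => (foldl_establish (fun M j => clearCol k j M) (List.finRange n)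
      (fun N => (Cleared M2 i ∧ i ≠ k) → Cleared N i) (fun _ _ => True)
      (fun N j h h' => clearCol_cleared h'.2 (h h')) (fun _ _ _ => trivial)
      (fun _ _ _ _ _ => trivial) M2 (fun h => h.1)).1
    refine ⟨⟨fun j hj => ?_, fun h j => h3.2 j h⟩, fun i hi hik =>
      k3 i ⟨k2 i ⟨k1 i ⟨hi, hik⟩, hik⟩, hik⟩⟩
    rcases h3.1 with h | h
    · exact h3' j (List.mem_finRange j) h hj
    · exact h j
  intro j k hjk
  refine ((foldl_establish (fun M k => [pivot, clearRow, clearCol].foldl (fun M s =>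
      (List.finRange n).foldl (fun M j => s k j M) M) M) (List.finRange n)
      (fun _ : Fin n → Fin n → ZMod 2 => True)
      (fun k M => Cleared M k) (fun _ _ _ => trivial) (fun M k _ => (round M k).1)
      (fun M k c _ h => ?_) M trivial).2 k (List.mem_finRange k)).1 j hjk
  rcases eq_or_ne c k with rfl | hck
  · exact (round M c).1
  · exact (round M k).2 c h hck

theorem foldl_transfer {α β γ : Type*} (f : α → γ → α) (g : β → γ → β) (I : α → Prop) (M : α → β)
    (l : List γ) (h : ∀ a, I a → ∀ c ∈ l, I (f a c) ∧ M (f a c) = g (M a) c) (a : α) (ha : I a) :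
    I (l.foldl f a) ∧ M (l.foldl f a) = l.foldl g (M a) := by
  induction l generalizing a with
  | nil => exact ⟨ha, rfl⟩
  | cons c l ih =>
    obtain ⟨h1, h2⟩ := h a ha c (by simp)
    simp only [List.foldl_cons, ← h2]
    exact ih (fun a ha c hc => h a ha c (by simp [hc])) _ h1

/-- Transfers the elimination to any states `a` whose steps act on an attached matrix `M a` in the
right way; the matrices will be `xOfZ` and `maskedZ`. -/
theorem sweep_off_diagonal {α : Type*} (sa sb sc : Fin n → Fin n → α → α) (I : α → Prop)
    (M : α → Fin n → Fin n → ZMod 2)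
    (ha : ∀ k j a, I a → I (sa k j a) ∧ M (sa k j a) = pivot k j (M a))
    (hb : ∀ k j a, I a → I (sb k j a) ∧ M (sb k j a) = clearRow k j (M a))
    (hc : ∀ k j a, I a → I (sc k j a) ∧ M (sc k j a) = clearCol k j (M a)) (a : α) (h : I a) :
    I (sweep [sa, sb, sc] a) ∧ ∀ j k, j ≠ k → M (sweep [sa, sb, sc] a) j k = 0 := by
  have key : I (sweep [sa, sb, sc] a) ∧
      M (sweep [sa, sb, sc] a) = sweep [pivot, clearRow, clearCol] (M a) := by
    refine foldl_transfer _ _ I M (List.finRange n) (fun a h k _ => ?_) a h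
    simp only [List.foldl_cons, List.foldl_nil]
    obtain ⟨i1, m1⟩ := foldl_transfer (fun a j => sa k j a) (fun M j => pivot k j M) I M
      (List.finRange n) (fun a h j _ => ha k j a h) a h
    obtain ⟨i2, m2⟩ := foldl_transfer (fun a j => sb k j a) (fun M j => clearRow k j M) I M
      (List.finRange n) (fun a h j _ => hb k j a h) _ i1
    obtain ⟨i3, m3⟩ := foldl_transfer (fun a j => sc k j a) (fun M j => clearCol k j M) I M
      (List.finRange n) (fun a h j _ => hc k j a h) _ i2
    exact ⟨i3, by rw [m3, m2, m1]⟩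
  exact ⟨key.1, fun j k hjk => by rw [key.2]; exact sweep_diagonalizes _ j k hjk⟩

/-! ### Images of the generators -/

theorem zmod2_ne_zero_iff (a : ZMod 2) : a ≠ 0 ↔ a = 1 := by
  rcases zmod2_cases a with rfl | rfl <;> simp

theorem zmod2_val_ne_zero_iff (a : ZMod 2) : a.val ≠ 0 ↔ a = 1 := by
  rcases zmod2_cases a with rfl | rfl <;> simp [val_one_zmod2]

theorem act_cnot_Z (inv : Bool) (c t : Fin n) (h : c ≠ t) (i : Fin n) (hi : i ≠ t) :
    (Gate.cnot c t h).act inv (.Z i) = .Z i := by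
  refine PV.ext rfl ?_ ?_ <;> simp [Gate.act, PV.Z, hi.symm]

/-- Conjugation by CNOT maps `Z t` to the product of `Z c` and `Z t` and fixes every other `Z i`.
This is why CNOT gates on the right are row operations. -/
theorem splitOff_cnot_Z {F : PV n → PV n} (hF : IsPauliAut F) (c t : Fin n) (h : c ≠ t)
    (i : Fin n) :
    (splitOff false [.cnot c t h] F (.Z i)).x =
      (if i = t then (F (.Z i)).x + (F (.Z c)).x else (F (.Z i)).x) ∧
    (splitOff false [.cnot c t h] F (.Z i)).z =
      (if i = t then (F (.Z i)).z + (F (.Z c)).z else (F (.Z i)).z) := by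
  simp only [splitOff, Bool.false_eq_true, if_false, List.foldl_cons, List.foldl_nil]
  rcases eq_or_ne i t with rfl | hi
  · simp only [if_true]
    refine hF.map_add ?_ ?_
    · simp [Gate.act, PV.Z]
    · funext k
      rcases eq_or_ne k c with rfl | hk
      · simp [Gate.act, PV.Z, h]
      · simp [Gate.act, PV.Z, hk]
  · rw [act_cnot_Z _ c t h i hi, if_neg hi, if_neg hi]
    exact ⟨rfl, rfl⟩

/-- The `X` parts of the images of the `Z j`. -/
def xOfZ (F : PV n → PV n) (j k : Fin n) : ZMod 2 := (F (.Z j)).x k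

/-- The `Z` parts of the images of the `Z j`. -/
def zOfZ (F : PV n → PV n) (j k : Fin n) : ZMod 2 := (F (.Z j)).z k

theorem xOfZ_right_cnot {F : PV n → PV n} (hF : IsPauliAut F) (c t : Fin n) (h : c ≠ t) :
    xOfZ (splitOff false [.cnot c t h] F) = addRow c t (xOfZ F) := by
  funext j k
  rw [xOfZ, (splitOff_cnot_Z hF c t h j).1, addRow]
  split_ifs <;> rfl

theorem zOfZ_right_cnot {F : PV n → PV n} (hF : IsPauliAut F) (c t : Fin n) (h : c ≠ t) :
    zOfZ (splitOff false [.cnot c t h] F) = addRow c t (zOfZ F) := by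
  funext j k
  rw [zOfZ, (splitOff_cnot_Z hF c t h j).2, addRow]
  split_ifs <;> rfl

theorem xOfZ_left_cnot (F : PV n → PV n) (c t : Fin n) (h : c ≠ t) :
    xOfZ (splitOff true [.cnot c t h] F) = addCol c t (xOfZ F) := by
  funext j k
  by_cases hk : k = t
  · subst hk
    simp [xOfZ, splitOff, addCol, Gate.act]
  · simp [xOfZ, splitOff, addCol, Gate.act, hk]

/-- CNOT acts on `Z` parts by the inverse transpose of its action on `X` parts, so control and
target change roles in comparison with `xOfZ_left_cnot`. -/
theorem zOfZ_left_cnot (F : PV n → PV n) (c t : Fin n) (h : c ≠ t) :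
    zOfZ (splitOff true [.cnot c t h] F) = addCol t c (zOfZ F) := by
  funext j k
  by_cases hk : k = c
  · subst hk
    simp [zOfZ, splitOff, addCol, Gate.act]
  · simp [zOfZ, splitOff, addCol, Gate.act, hk]

theorem splitOff_nil (b : Bool) (F : PV n → PV n) : splitOff b [] F = F := by
  cases b <;> rfl

theorem zmod2_ne_one_iff (a : ZMod 2) : ¬ a = 1 ↔ a = 0 := by
  rcases zmod2_cases a with rfl | rfl <;> simp

theorem Step.onAut_self (s : Step) (k : Fin n) (F : PV n → PV n)
    (h : s.shape.gates k k = []) : s.onAut k k F = F := by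
  unfold Step.onAut
  rw [h, splitOff_nil, ite_self]

theorem Step.onAut_of_fires {s : Step} {k j : Fin n} {F : PV n → PV n} (h : s.Fires F k j) :
    s.onAut k j F = splitOff s.left (s.shape.gates k j) F := if_pos h

theorem Step.onAut_of_not_fires {s : Step} {k j : Fin n} {F : PV n → PV n}
    (h : ¬ s.Fires F k j) : s.onAut k j F = F := if_neg h

/-! ### The first two sweeps -/

theorem sweep_stepsX {F : PV n → PV n} (hF : IsPauliAut F) :
    IsPauliAut (sweep (stepsX.map Step.onAut) F) ∧
      ∀ j k, j ≠ k → xOfZ (sweep (stepsX.map Step.onAut) F) j k = 0 := by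
  refine sweep_off_diagonal _ _ _ IsPauliAut xOfZ
    (fun k j F hF => ⟨Step.onAut_isPauliAut _ _ _ hF, ?_⟩)
    (fun k j F hF => ⟨Step.onAut_isPauliAut _ _ _ hF, ?_⟩)
    (fun k j F hF => ⟨Step.onAut_isPauliAut _ _ _ hF, ?_⟩) F hF
  · rcases eq_or_ne k j with rfl | hkj
    · rw [Step.onAut_self _ _ _ (by simp [Shape.gates])]
      simp [pivot]
    have hf : (⟨false, .cnotRev, [(0, false), (5, true)]⟩ : Step).Fires F k j ↔
        xOfZ F k k = 0 ∧ xOfZ F j k = 1 := by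
      simp only [Step.Fires, view, List.forall_mem_cons, zmod2_val_ne_zero_iff, xOfZ]
      simp [zmod2_ne_one_iff]
    by_cases h : xOfZ F k k = 0 ∧ xOfZ F j k = 1
    · rw [Step.onAut_of_fires (hf.2 h), pivot, if_pos ⟨hkj, h⟩, Shape.gates, dif_pos hkj,
        xOfZ_right_cnot hF]
    · rw [Step.onAut_of_not_fires (mt hf.1 h), pivot, if_neg fun h' => h h'.2]
  · rcases eq_or_ne k j with rfl | hkj
    · rw [Step.onAut_self _ _ _ (by simp [Shape.gates])]
      simp [clearRow]
    have hf : (⟨true, .cnot, [(0, true), (1, true)]⟩ : Step).Fires F k j ↔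
        xOfZ F k k = 1 ∧ xOfZ F k j = 1 := by
      simp only [Step.Fires, view, List.forall_mem_cons, zmod2_val_ne_zero_iff, xOfZ]
      simp
    by_cases h : xOfZ F k k = 1 ∧ xOfZ F k j = 1
    · rw [Step.onAut_of_fires (hf.2 h), clearRow, if_pos ⟨hkj, h⟩, Shape.gates, dif_pos hkj,
        xOfZ_left_cnot]
    · rw [Step.onAut_of_not_fires (mt hf.1 h), clearRow, if_neg fun h' => h h'.2]
  · rcases eq_or_ne k j with rfl | hkj
    · rw [Step.onAut_self _ _ _ (by simp [Shape.gates])]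
      simp [clearCol]
    have hf : (⟨false, .cnot, [(0, true), (5, true)]⟩ : Step).Fires F k j ↔
        xOfZ F k k = 1 ∧ xOfZ F j k = 1 := by
      simp only [Step.Fires, view, List.forall_mem_cons, zmod2_val_ne_zero_iff, xOfZ]
      simp
    by_cases h : xOfZ F k k = 1 ∧ xOfZ F j k = 1
    · rw [Step.onAut_of_fires (hf.2 h), clearCol, if_pos ⟨hkj, h⟩, Shape.gates, dif_pos hkj,
        xOfZ_right_cnot hF]
    · rw [Step.onAut_of_not_fires (mt hf.1 h), clearCol, if_neg fun h' => h h'.2]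

/-- The matrix `zOfZ`, restricted to the rows and columns where `xOfZ` vanishes on the diagonal. -/
def maskedZ (F : PV n → PV n) (j k : Fin n) : ZMod 2 :=
  if xOfZ F j j = 0 ∧ xOfZ F k k = 0 then zOfZ F j k else 0

theorem maskedZ_eq_one_iff (F : PV n → PV n) (j k : Fin n) :
    maskedZ F j k = 1 ↔ xOfZ F j j = 0 ∧ xOfZ F k k = 0 ∧ zOfZ F j k = 1 := by
  unfold maskedZ
  split_ifs with h
  · simp [h]
  · simpa [← and_assoc] using fun h1 h2 => absurd ⟨h1, h2⟩ h

theorem maskedZ_of_eq {F G : PV n → PV n} (hx : xOfZ G = xOfZ F)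
    (T : (Fin n → Fin n → ZMod 2) → Fin n → Fin n → ZMod 2) (hz : zOfZ G = T (zOfZ F))
    (hT : ∀ a b, xOfZ F a a = 0 → xOfZ F b b = 0 → T (maskedZ F) a b = T (zOfZ F) a b)
    (hT' : ∀ a b, ¬ (xOfZ F a a = 0 ∧ xOfZ F b b = 0) → T (maskedZ F) a b = 0) :
    maskedZ G = T (maskedZ F) := by
  funext a b
  by_cases h : xOfZ F a a = 0 ∧ xOfZ F b b = 0
  · rw [hT a b h.1 h.2, maskedZ, hx, if_pos h, hz]
  · rw [hT' a b h, maskedZ, hx, if_neg h]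

theorem maskedZ_addRow {F G : PV n → PV n} {i k : Fin n} (hi : xOfZ F i i = 0)
    (hk : xOfZ F k k = 0) (hx : xOfZ G = xOfZ F) (hz : zOfZ G = addRow i k (zOfZ F)) :
    maskedZ G = addRow i k (maskedZ F) := by
  refine maskedZ_of_eq hx _ hz (fun a b ha hb => ?_) (fun a b h => ?_)
  · simp [addRow, maskedZ, ha, hb, hi]
  · unfold addRow
    split_ifs with hak
    · have hb : ¬ xOfZ F b b = 0 := fun hb => h ⟨by rw [hak, hk], hb⟩
      simp [maskedZ, hb]
    · simp [maskedZ, h]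

theorem maskedZ_addCol {F G : PV n → PV n} {i k : Fin n} (hi : xOfZ F i i = 0)
    (hk : xOfZ F k k = 0) (hx : xOfZ G = xOfZ F) (hz : zOfZ G = addCol i k (zOfZ F)) :
    maskedZ G = addCol i k (maskedZ F) := by
  refine maskedZ_of_eq hx _ hz (fun a b ha hb => ?_) (fun a b h => ?_)
  · simp [addCol, maskedZ, ha, hb, hi]
  · unfold addCol
    split_ifs with hbk
    · have ha : ¬ xOfZ F a a = 0 := fun ha => h ⟨ha, by rw [hbk, hk]⟩
      simp [maskedZ, ha]
    · simp [maskedZ, h]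

theorem addRow_eq_self {M : Fin n → Fin n → ZMod 2} {i : Fin n} (k : Fin n)
    (h : ∀ b, M i b = 0) : addRow i k M = M := by
  funext a b
  simp [addRow, h]

theorem addCol_eq_self {M : Fin n → Fin n → ZMod 2} {i : Fin n} (k : Fin n)
    (h : ∀ a, M a i = 0) : addCol i k M = M := by
  funext a b
  simp [addCol, h]

/-- Every CNOT of this sweep joins qubits whose rows and columns in `xOfZ` are zero (`row`, `col`).
Hence `xOfZ` stays as it is while `maskedZ` undergoes the elimination. -/
theorem sweep_stepsZ {F : PV n → PV n} (hF : IsPauliAut F)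
    (hX : ∀ j k, j ≠ k → xOfZ F j k = 0) :
    (IsPauliAut (sweep (stepsZ.map Step.onAut) F) ∧
      ∀ j k, j ≠ k → xOfZ (sweep (stepsZ.map Step.onAut) F) j k = 0) ∧
      ∀ j k, j ≠ k → maskedZ (sweep (stepsZ.map Step.onAut) F) j k = 0 := by
  have row : ∀ F : PV n → PV n, (∀ j k, j ≠ k → xOfZ F j k = 0) → ∀ i, xOfZ F i i = 0 →
      ∀ b, xOfZ F i b = 0 := fun F hX i hi b => by
    rcases eq_or_ne i b with rfl | h
    exacts [hi, hX _ _ h]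
  have col : ∀ F : PV n → PV n, (∀ j k, j ≠ k → xOfZ F j k = 0) → ∀ i, xOfZ F i i = 0 →
      ∀ b, xOfZ F b i = 0 := fun F hX i hi b => by
    rcases eq_or_ne b i with rfl | h
    exacts [hi, hX _ _ h]
  have combine : ∀ (s : Step) (k j : Fin n) (F : PV n → PV n) (M : Fin n → Fin n → ZMod 2),
      IsPauliAut F ∧ (∀ j k, j ≠ k → xOfZ F j k = 0) →
      xOfZ (s.onAut k j F) = xOfZ F ∧ maskedZ (s.onAut k j F) = M →
      (IsPauliAut (s.onAut k j F) ∧ ∀ i l, i ≠ l → xOfZ (s.onAut k j F) i l = 0) ∧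
        maskedZ (s.onAut k j F) = M := fun s k j F M h h' =>
    ⟨⟨Step.onAut_isPauliAut _ _ _ h.1, by rw [h'.1]; exact h.2⟩, h'.2⟩
  refine sweep_off_diagonal _ _ _
    (fun F => IsPauliAut F ∧ ∀ j k, j ≠ k → xOfZ F j k = 0) maskedZ
    (fun k j F hF => combine _ _ _ _ _ hF ?_) (fun k j F hF => combine _ _ _ _ _ hF ?_)
    (fun k j F hF => combine _ _ _ _ _ hF ?_) F ⟨hF, hX⟩
  · rcases eq_or_ne k j with rfl | hkj
    · rw [Step.onAut_self _ _ _ (by simp [Shape.gates])]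
      simp [pivot]
    have hf : (⟨false, .cnotRev, [(0, false), (4, false), (2, false), (6, true)]⟩ : Step).Fires
        F k j ↔ maskedZ F k k = 0 ∧ maskedZ F j k = 1 := by
      rw [← zmod2_ne_one_iff, maskedZ_eq_one_iff, maskedZ_eq_one_iff]
      simp only [Step.Fires, view, List.forall_mem_cons, zmod2_val_ne_zero_iff, xOfZ, zOfZ,
        Bool.false_eq_true, iff_false, zmod2_ne_one_iff]
      simp only [← zmod2_ne_one_iff ((F (PV.Z k)).z k)]
      simp
      tauto
    by_cases h : maskedZ F k k = 0 ∧ maskedZ F j k = 1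
    · have hj := (maskedZ_eq_one_iff _ _ _).1 h.2
      have hx := (xOfZ_right_cnot hF.1 j k hkj.symm).trans (addRow_eq_self k (row F hF.2 j hj.1))
      rw [Step.onAut_of_fires (hf.2 h), pivot, if_pos ⟨hkj, h⟩, Shape.gates, dif_pos hkj]
      exact ⟨hx, maskedZ_addRow hj.1 hj.2.1 hx (zOfZ_right_cnot hF.1 j k _)⟩
    · rw [Step.onAut_of_not_fires (mt hf.1 h), pivot, if_neg fun h' => h h'.2]
      exact ⟨rfl, rfl⟩
  · rcases eq_or_ne k j with rfl | hkj
    · rw [Step.onAut_self _ _ _ (by simp [Shape.gates])]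
      simp [clearRow]
    have hf : (⟨true, .cnotRev, [(0, false), (2, true), (4, false), (3, true)]⟩ : Step).Fires
        F k j ↔ maskedZ F k k = 1 ∧ maskedZ F k j = 1 := by
      rw [maskedZ_eq_one_iff, maskedZ_eq_one_iff]
      simp only [Step.Fires, view, List.forall_mem_cons, zmod2_val_ne_zero_iff, xOfZ, zOfZ,
        Bool.false_eq_true, iff_false, zmod2_ne_one_iff]
      simp
      tauto
    by_cases h : maskedZ F k k = 1 ∧ maskedZ F k j = 1
    · have hj := (maskedZ_eq_one_iff _ _ _).1 h.2
      have hx := (xOfZ_left_cnot F j k hkj.symm).trans (addCol_eq_self k (col F hF.2 j hj.2.1))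
      rw [Step.onAut_of_fires (hf.2 h), clearRow, if_pos ⟨hkj, h⟩, Shape.gates, dif_pos hkj]
      exact ⟨hx, maskedZ_addCol hj.1 hj.2.1 hx (zOfZ_left_cnot F j k _)⟩
    · rw [Step.onAut_of_not_fires (mt hf.1 h), clearRow, if_neg fun h' => h h'.2]
      exact ⟨rfl, rfl⟩
  · rcases eq_or_ne k j with rfl | hkj
    · rw [Step.onAut_self _ _ _ (by simp [Shape.gates])]
      simp [clearCol]
    have hf : (⟨false, .cnot, [(0, false), (2, true), (4, false), (6, true)]⟩ : Step).Fires
        F k j ↔ maskedZ F k k = 1 ∧ maskedZ F j k = 1 := by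
      rw [maskedZ_eq_one_iff, maskedZ_eq_one_iff]
      simp only [Step.Fires, view, List.forall_mem_cons, zmod2_val_ne_zero_iff, xOfZ, zOfZ,
        Bool.false_eq_true, iff_false, zmod2_ne_one_iff]
      simp
      tauto
    by_cases h : maskedZ F k k = 1 ∧ maskedZ F j k = 1
    · have hj := (maskedZ_eq_one_iff _ _ _).1 h.2
      have hx := (xOfZ_right_cnot hF.1 k j hkj).trans (addRow_eq_self j (row F hF.2 k hj.2.1))
      rw [Step.onAut_of_fires (hf.2 h), clearCol, if_pos ⟨hkj, h⟩, Shape.gates, dif_pos hkj]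
      exact ⟨hx, maskedZ_addRow hj.2.1 hj.1 hx (zOfZ_right_cnot hF.1 k j _)⟩
    · rw [Step.onAut_of_not_fires (mt hf.1 h), clearCol, if_neg fun h' => h h'.2]
      exact ⟨rfl, rfl⟩

/-- The `X` parts of the images of the `Z k` are diagonal, and if such a part vanishes then the
`Z` part is that of `Z k`. -/
structure HalfReduced (F : PV n → PV n) : Prop where
  aut : IsPauliAut F
  x : ∀ k, (F (.Z k)).x = Pi.single k (xOfZ F k k)
  z : ∀ k, xOfZ F k k = 0 → (F (.Z k)).z = Pi.single k 1

theorem symp_Z_Z {F : PV n → PV n} (hF : IsPauliAut F) (j k : Fin n) :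
    (F (.Z j)).symp (F (.Z k)) = 0 := by
  rw [hF.symp_map]
  simp [PV.symp, PV.Z]

theorem symp_X_X {F : PV n → PV n} (hF : IsPauliAut F) (j k : Fin n) :
    (F (.X j)).symp (F (.X k)) = 0 := by
  rw [hF.symp_map]
  simp [PV.symp, PV.X]

theorem symp_X_Z {F : PV n → PV n} (hF : IsPauliAut F) (j k : Fin n) :
    (F (.X j)).symp (F (.Z k)) = if j = k then 1 else 0 := by
  rw [hF.symp_map]
  simp [PV.symp, PV.X, PV.Z, Pi.single_apply]

/-- Let the image of `Z k` have no `X` part. If the image of `Z j` has `X` part `e_j`, the two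
commute only if the former has `Z` entry `0` at `j`; this takes care of the columns outside of the
mask. The diagonal entry is not `0`, since the image of `Z k` has symplectic product `1` with that
of `X k`. -/
theorem halfReduced_of_diagonal {F : PV n → PV n} (hF : IsPauliAut F)
    (hx : ∀ j k, j ≠ k → xOfZ F j k = 0) (hz : ∀ j k, j ≠ k → maskedZ F j k = 0) :
    HalfReduced F := by
  have hx' : ∀ k, (F (.Z k)).x = Pi.single k (xOfZ F k k) := by
    intro k
    funext j
    rcases eq_or_ne k j with rfl | h
    · simp [xOfZ]
    · rw [Pi.single_eq_of_ne h.symm]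
      exact hx _ _ h
  refine ⟨hF, hx', fun k hk => ?_⟩
  have hk0 : (F (.Z k)).x = 0 := by rw [hx', hk, Pi.single_zero]
  have off : ∀ j, j ≠ k → (F (.Z k)).z j = 0 := by
    intro j hj
    rcases zmod2_cases (xOfZ F j j) with h | h
    · have := hz k j hj.symm
      rwa [maskedZ, if_pos ⟨hk, h⟩] at this
    · have := symp_Z_Z hF k j
      rw [PV.symp, hk0, hx' j, h] at this
      simpa using this
  have diag : (F (.Z k)).z = Pi.single k ((F (.Z k)).z k) := by
    funext j
    rcases eq_or_ne j k with rfl | h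
    · simp
    · rw [Pi.single_eq_of_ne h, off j h]
  have := symp_X_Z hF k k
  rw [PV.symp, hk0, diag] at this
  rcases zmod2_cases ((F (.Z k)).z k) with h | h
  · simp [h] at this
  · rw [diag, h]

/-! ### The third sweep -/

theorem HalfReduced.xOfZ_eq {F : PV n → PV n} (hF : HalfReduced F) (i b : Fin n) :
    xOfZ F i b = if i = b then xOfZ F i i else 0 := by
  rw [xOfZ, hF.x i, Pi.single_apply]
  simp [eq_comm]

theorem xOfZ_left {F : PV n → PV n} {g : Gate n} (hx : ∀ v, (g.act true v).x = v.x) :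
    xOfZ (splitOff true [g] F) = xOfZ F := by
  funext i b
  simp [xOfZ, splitOff, hx]

/-- Meant for PHASE and CPHASE: they keep `X` parts, and they change a `Z` part only where there is
an `X` part. -/
theorem HalfReduced.left {F : PV n → PV n} (hF : HalfReduced F) {g : Gate n}
    (hx : ∀ v, (g.act true v).x = v.x) (hz : ∀ v, v.x = 0 → (g.act true v).z = v.z) :
    HalfReduced (splitOff true [g] F) := by
  refine ⟨splitOff_isPauliAut _ _ hF.aut, fun k => ?_, fun k hk => ?_⟩
  · rw [xOfZ_left hx, ← hF.x]
    simp [splitOff, hx]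
  · rw [xOfZ_left hx] at hk
    have h0 := hF.x k
    rw [hk, Pi.single_zero] at h0
    rw [← hF.z k hk]
    simp [splitOff, hz _ h0]

theorem act_phase_z (inv : Bool) (k : Fin n) (v : PV n) (hv : v.x = 0) :
    ((Gate.phase k).act inv v).z = v.z := by
  simp [Gate.act, hv]

theorem act_cphase_z (inv : Bool) (k j : Fin n) (h : k ≠ j) (v : PV n) (hv : v.x = 0) :
    ((Gate.cphase k j h).act inv v).z = v.z := by
  simp [Gate.act, hv]

theorem HalfReduced.zOfZ_left_phase {F : PV n → PV n} (hF : HalfReduced F) (k i b : Fin n) :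
    zOfZ (splitOff true [.phase k] F) i b =
      if i = k ∧ b = k then zOfZ F k k + xOfZ F k k else zOfZ F i b := by
  have hx := hF.xOfZ_eq i k
  rw [xOfZ] at hx
  rcases eq_or_ne b k with rfl | hb
  · rcases eq_or_ne i b with rfl | hi
    · simp [zOfZ, splitOff, Gate.act, hx]
    · simp [zOfZ, splitOff, Gate.act, hx, hi]
  · simp [zOfZ, splitOff, Gate.act, hb]

theorem HalfReduced.zOfZ_left_cphase {F : PV n → PV n} (hF : HalfReduced F) (k j : Fin n)
    (h : k ≠ j) (i b : Fin n) :
    zOfZ (splitOff true [.cphase k j h] F) i b =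
      if i = k ∧ b = j then zOfZ F k j + xOfZ F k k
      else if i = j ∧ b = k then zOfZ F j k + xOfZ F j j else zOfZ F i b := by
  have hk := hF.xOfZ_eq i k
  have hj := hF.xOfZ_eq i j
  rw [xOfZ] at hk hj
  rcases eq_or_ne b j with rfl | hbj
  · rcases eq_or_ne i k with rfl | hi
    · simp [zOfZ, splitOff, Gate.act, hk]
    · simp [zOfZ, splitOff, Gate.act, hk, hi, h.symm]
  · rcases eq_or_ne b k with rfl | hbk
    · rcases eq_or_ne i j with rfl | hi
      · simp [zOfZ, splitOff, Gate.act, hj, hbj]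
      · simp [zOfZ, splitOff, Gate.act, hj, hi, hbj]
    · simp [zOfZ, splitOff, Gate.act, hbj, hbk]

/-- The images of `Z k` and `Z j` commute, and as their `X` parts are diagonal, the symplectic form
consists of these two terms. -/
theorem HalfReduced.zOfZ_symm {F : PV n → PV n} (hF : HalfReduced F) (k j : Fin n) :
    zOfZ F k j * xOfZ F j j + zOfZ F j k * xOfZ F k k = 0 := by
  have := symp_Z_Z hF.aut k j
  rwa [PV.symp, hF.x, hF.x, dotProduct_single, dotProduct_single] at this

/-- The images of the `Z k` are `X k` or `Z k`, up to scalars. -/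
structure ZReduced (F : PV n → PV n) : Prop where
  aut : IsPauliAut F
  x : ∀ k, (F (.Z k)).x = Pi.single k (xOfZ F k k)
  z : ∀ k, (F (.Z k)).z = Pi.single k (1 + xOfZ F k k)

/-- PHASE toggles entry `(k, k)`. CPHASE adds to `(k, j)` and to `(j, k)` the diagonal entry of
`xOfZ` in the respective row. If both of these are `1`, the two entries agree by `zOfZ_symm` and are
cleared together; if only that of row `k` is, entry `(j, k)` is not touched. -/
theorem sweep_stepsL {F : PV n → PV n} (hF : HalfReduced F) :
    ZReduced (sweep (stepsL.map Step.onAut) F) := by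
  have key := sweep_establish Step.onAut stepsL HalfReduced
    -- The guard leaves the diagonal entries to PHASE and the others to CPHASE.
    (fun s k j F => s.shape.gates k j ≠ [] → xOfZ F k k = 1 → zOfZ F k j = 0) ?_ ?_ ?_ F hF
  · obtain ⟨h, hz⟩ := key
    generalize sweep (stepsL.map Step.onAut) F = G at h hz
    refine ⟨h.aut, h.x, fun k => ?_⟩
    rcases zmod2_cases (xOfZ G k k) with h0 | h1
    · rw [h0, add_zero, h.z k h0]
    · rw [h1, one_add_one_zmod2, Pi.single_zero]
      funext j
      rcases eq_or_ne k j with rfl | hkj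
      · exact hz ⟨true, .phase, [(0, true), (2, true)]⟩ (by simp [stepsL]) k k
          (by simp [Shape.gates]) h1
      · exact hz ⟨true, .cphase, [(0, true), (3, true)]⟩ (by simp [stepsL]) k j
          (by simp [Shape.gates, hkj]) h1
  · intro s hs k j F hF
    rw [Step.onAut]
    split_ifs
    · simp only [stepsL, List.mem_cons, List.not_mem_nil, or_false] at hs
      rcases hs with rfl | rfl
      · simp only [Shape.gates]
        split_ifs
        · exact hF.left (fun _ => rfl) (act_phase_z _ _)
        · rwa [splitOff_nil]
      · simp only [Shape.gates]
        split_ifs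
        · exact hF.left (fun _ => rfl) (act_cphase_z _ _ _ _)
        · rwa [splitOff_nil]
    · exact hF
  · intro s hs k j F hF hg
    simp only [stepsL, List.mem_cons, List.not_mem_nil, or_false] at hs
    rw [Step.onAut]
    rcases hs with rfl | rfl
    · have hkj : k = j := by
        by_contra h
        exact hg (if_neg h)
      subst hkj
      split_ifs with hf
      · simp only [Step.Fires, view, List.forall_mem_cons, zmod2_val_ne_zero_iff, iff_true] at hf
        simp only [Shape.gates, if_true]
        rw [hF.zOfZ_left_phase, if_pos ⟨rfl, rfl⟩]
        intro _
        rw [zOfZ, xOfZ, hf.1, hf.2.1, one_add_one_zmod2]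
      · intro h
        by_contra h'
        refine hf ?_
        simp only [Step.Fires, view, List.forall_mem_cons, zmod2_val_ne_zero_iff, iff_true]
        exact ⟨h, (zmod2_ne_zero_iff _).1 h', by simp⟩
    · have hkj : k ≠ j := fun h => hg (dif_neg (not_not.2 h))
      split_ifs with hf
      · simp only [Step.Fires, view, List.forall_mem_cons, zmod2_val_ne_zero_iff, iff_true] at hf
        simp only [Shape.gates, dif_pos hkj]
        rw [hF.zOfZ_left_cphase, if_pos ⟨rfl, rfl⟩]
        intro _
        rw [zOfZ, xOfZ, hf.1, hf.2.1, one_add_one_zmod2]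
      · intro h
        by_contra h'
        refine hf ?_
        simp only [Step.Fires, view, List.forall_mem_cons, zmod2_val_ne_zero_iff, iff_true]
        exact ⟨h, (zmod2_ne_zero_iff _).1 h', by simp⟩
  · intro s hs t _ k j k' j' F hF hC hg
    specialize hC hg
    simp only [stepsL, List.mem_cons, List.not_mem_nil, or_false] at hs
    rw [Step.onAut]
    split_ifs with hf
    · rcases hs with rfl | rfl
      · simp only [Step.Fires, view, List.forall_mem_cons, zmod2_val_ne_zero_iff, iff_true] at hf
        simp only [Shape.gates]
        split_ifs with hkj
        · subst hkj
          rw [xOfZ_left (fun _ => rfl), hF.zOfZ_left_phase]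
          split_ifs
          · intro _
            rw [zOfZ, xOfZ, hf.1, hf.2.1, one_add_one_zmod2]
          · exact hC
        · rwa [splitOff_nil]
      · simp only [Step.Fires, view, List.forall_mem_cons, zmod2_val_ne_zero_iff, iff_true] at hf
        simp only [Shape.gates]
        split_ifs with hkj
        · rw [xOfZ_left (fun _ => rfl), hF.zOfZ_left_cphase]
          have h1 : xOfZ F k k = 1 := hf.1
          have h2 : zOfZ F k j = 1 := hf.2.1
          split_ifs with h3 h4
          · intro _
            rw [h1, h2, one_add_one_zmod2]
          -- This is the mirror image of the entry being cleared; by symmetry it was `1` as well,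
          -- and the same gate clears it.
          · intro h5
            have h6 := hF.zOfZ_symm k j
            rw [h4.1] at h5
            rw [h1, h2, h5] at h6
            rw [h5]
            linear_combination h6
          · exact hC
        · rwa [splitOff_nil]
    · exact hC

/-! ### The fourth sweep -/

/-- The part of the image of `v` at `j` that is of the type of the image of `Z j`. -/
def zPart (F : PV n → PV n) (v : PV n) (j : Fin n) : ZMod 2 :=
  if xOfZ F j j = 0 then (F v).z j else (F v).x j

/-- The part of the image of `v` at `j` that is not of the type of the image of `Z j`. -/
def xPart (F : PV n → PV n) (v : PV n) (j : Fin n) : ZMod 2 :=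
  if xOfZ F j j = 0 then (F v).x j else (F v).z j

theorem zPart_add {F : PV n → PV n} (hF : IsPauliAut F) {v a b : PV n} (hx : v.x = a.x + b.x)
    (hz : v.z = a.z + b.z) (j : Fin n) : zPart F v j = zPart F a j + zPart F b j := by
  obtain ⟨h1, h2⟩ := hF.map_add hx hz
  unfold zPart
  split_ifs <;> simp [h1, h2]

theorem ZReduced.zPart_Z {F : PV n → PV n} (hF : ZReduced F) (k j : Fin n) :
    zPart F (.Z k) j = if k = j then 1 else 0 := by
  rw [zPart, hF.x, hF.z]
  rcases eq_or_ne k j with rfl | h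
  · rcases zmod2_cases (xOfZ F k k) with h | h <;> simp [h]
  · simp [h, h.symm]

/-- The image of `Z j` is a single `X j` or `Z j`, so its symplectic product with the image of `X k`
picks the entry at `j` of the opposite type, and `F` preserves that product. -/
theorem ZReduced.xPart_X {F : PV n → PV n} (hF : ZReduced F) (k j : Fin n) :
    xPart F (.X k) j = if k = j then 1 else 0 := by
  have := symp_X_Z hF.aut k j
  rw [PV.symp, hF.x, hF.z, dotProduct_single, single_dotProduct] at this
  rw [← this, xPart]
  rcases zmod2_cases (xOfZ F j j) with h | h <;> simp [h, one_add_one_zmod2]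

/-- The images of `X k` and `X j` commute. Since `xPart` is the identity matrix, their symplectic
form is the sum of the two entries in question. -/
theorem ZReduced.zPart_X_symm {F : PV n → PV n} (hF : ZReduced F) (k j : Fin n) :
    zPart F (.X k) j = zPart F (.X j) k := by
  have h := symp_X_X hF.aut k j
  have h' : (F (.X k)).symp (F (.X j)) =
      ∑ i, (zPart F (.X k) i * xPart F (.X j) i + zPart F (.X j) i * xPart F (.X k) i) := by
    rw [PV.symp, dotProduct, dotProduct, ← Finset.sum_add_distrib]
    refine Finset.sum_congr rfl fun i _ => ?_
    unfold zPart xPart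
    split_ifs
    · rfl
    · ring
  rw [h'] at h
  simp only [hF.xPart_X, Finset.sum_add_distrib, mul_ite, mul_one, mul_zero, Finset.sum_ite_eq,
    Finset.mem_univ, if_true] at h
  rw [← sub_eq_zero, CharTwo.sub_eq_add, h]

theorem act_phase_Z (inv : Bool) (k i : Fin n) : (Gate.phase k).act inv (.Z i) = .Z i := by
  refine PV.ext ?_ ?_ ?_ <;> simp [Gate.act, PV.Z]

theorem act_cphase_Z (inv : Bool) (k j : Fin n) (h : k ≠ j) (i : Fin n) :
    (Gate.cphase k j h).act inv (.Z i) = .Z i := by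
  refine PV.ext ?_ ?_ ?_ <;> simp [Gate.act, PV.Z, two_zero]

theorem splitOff_right_Z {F : PV n → PV n} {g : Gate n} (hg : ∀ i, g.act true (.Z i) = .Z i)
    (i : Fin n) : splitOff false [g] F (.Z i) = F (.Z i) := by
  simp [splitOff, hg]

theorem xOfZ_right {F : PV n → PV n} {g : Gate n} (hg : ∀ i, g.act true (.Z i) = .Z i) :
    xOfZ (splitOff false [g] F) = xOfZ F := by
  funext i b
  rw [xOfZ, splitOff_right_Z hg, xOfZ]

theorem ZReduced.right {F : PV n → PV n} (hF : ZReduced F) {g : Gate n}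
    (hg : ∀ i, g.act true (.Z i) = .Z i) : ZReduced (splitOff false [g] F) := by
  refine ⟨splitOff_isPauliAut _ _ hF.aut, fun k => ?_, fun k => ?_⟩
  · rw [splitOff_right_Z hg, xOfZ_right hg, hF.x]
  · rw [splitOff_right_Z hg, xOfZ_right hg, hF.z]

theorem zPart_right {F : PV n → PV n} {g : Gate n} (hg : ∀ i, g.act true (.Z i) = .Z i)
    (v : PV n) (j : Fin n) : zPart (splitOff false [g] F) v j = zPart F (g.act true v) j := by
  rw [zPart, xOfZ_right hg, zPart]
  rfl

/-- Up to a scalar, the inverse of PHASE maps `X k` to the product of `X k` and `Z k`, and the image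
of `Z k` has `zPart` equal to `e_k`. -/
theorem ZReduced.zPart_right_phase {F : PV n → PV n} (hF : ZReduced F) (k i b : Fin n) :
    zPart (splitOff false [.phase k] F) (.X i) b =
      if i = k ∧ b = k then zPart F (.X k) k + 1 else zPart F (.X i) b := by
  rw [zPart_right (act_phase_Z _ _)]
  rcases eq_or_ne i k with rfl | hi
  · rw [zPart_add hF.aut (a := .X i) (b := .Z i), hF.zPart_Z]
    · rcases eq_or_ne b i with rfl | hb
      · simp
      · simp [hb, hb.symm]
    · simp [Gate.act, PV.X, PV.Z]
    · simp [Gate.act, PV.X, PV.Z, Pi.single]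
  · have h0 : (Gate.phase k).act true (.X i) = .X i := by
      refine PV.ext ?_ ?_ ?_ <;> simp [Gate.act, PV.X, hi.symm]
    simp [h0, hi]

theorem ZReduced.zPart_right_cphase {F : PV n → PV n} (hF : ZReduced F) (k j : Fin n)
    (h : k ≠ j) (i b : Fin n) :
    zPart (splitOff false [.cphase k j h] F) (.X i) b =
      if i = k ∧ b = j then zPart F (.X k) j + 1
      else if i = j ∧ b = k then zPart F (.X j) k + 1 else zPart F (.X i) b := by
  rw [zPart_right (act_cphase_Z _ _ _ _)]
  rcases eq_or_ne i k with rfl | hi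
  · rw [zPart_add hF.aut (a := .X i) (b := .Z j), hF.zPart_Z]
    · rcases eq_or_ne b j with rfl | hb
      · simp
      · simp [hb, hb.symm, h]
    · simp [Gate.act, PV.X, PV.Z]
    · simp [Gate.act, PV.X, PV.Z, h.symm, Pi.single]
  · rcases eq_or_ne i j with rfl | hj
    · rw [zPart_add hF.aut (a := .X i) (b := .Z k), hF.zPart_Z]
      · rcases eq_or_ne b k with rfl | hb
        · simp [h.symm]
        · simp [hb, hb.symm, hi]
      · simp [Gate.act, PV.X, PV.Z]
      · funext c
        rcases eq_or_ne c i with rfl | hc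
        · simp [Gate.act, PV.X, PV.Z, hi]
        · simp [Gate.act, PV.X, PV.Z, Pi.single, hc]
    · have h0 : (Gate.cphase k j h).act true (.X i) = .X i := by
        refine PV.ext ?_ ?_ ?_ <;> simp [Gate.act, PV.X, hi.symm, hj.symm, two_zero]
      simp [h0, hi, hj]

/-- The generators whose images are `Z k` in the end. -/
def preZ (F : PV n → PV n) (k : Fin n) : PV n := if xOfZ F k k = 0 then .Z k else .X k

/-- The generators whose images are `X k` in the end. -/
def preX (F : PV n → PV n) (k : Fin n) : PV n := if xOfZ F k k = 0 then .X k else .Z k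

/-- The images of all generators are generators, up to scalars. -/
structure Reduced (F : PV n → PV n) : Prop where
  aut : IsPauliAut F
  preZ_x : ∀ k, (F (preZ F k)).x = 0
  preZ_z : ∀ k, (F (preZ F k)).z = Pi.single k 1
  preX_x : ∀ k, (F (preX F k)).x = Pi.single k 1
  preX_z : ∀ k, (F (preX F k)).z = 0

theorem ZReduced.reduced {F : PV n → PV n} (hF : ZReduced F)
    (h : ∀ k j, zPart F (.X k) j = 0) : Reduced F := by
  have hx : ∀ k, (F (.X k)).x = Pi.single k (1 + xOfZ F k k) := by
    intro k
    funext j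
    have h1 := h k j
    have h2 := hF.xPart_X k j
    rw [zPart] at h1
    rw [xPart] at h2
    rcases eq_or_ne k j with rfl | hkj
    · rcases zmod2_cases (xOfZ F k k) with h0 | h0 <;> simp_all [one_add_one_zmod2]
    · rcases zmod2_cases (xOfZ F j j) with h0 | h0 <;> simp_all
  have hz : ∀ k, (F (.X k)).z = Pi.single k (xOfZ F k k) := by
    intro k
    funext j
    have h1 := h k j
    have h2 := hF.xPart_X k j
    rw [zPart] at h1
    rw [xPart] at h2
    rcases eq_or_ne k j with rfl | hkj
    · rcases zmod2_cases (xOfZ F k k) with h0 | h0 <;> simp_all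
    · rcases zmod2_cases (xOfZ F j j) with h0 | h0 <;> simp_all
  refine ⟨hF.aut, fun k => ?_, fun k => ?_, fun k => ?_, fun k => ?_⟩ <;>
  rcases zmod2_cases (xOfZ F k k) with h0 | h0 <;>
  simp [preX, preZ, h0, hx, hz, hF.x, hF.z, one_add_one_zmod2]

/-- The matrix `zPart F (.X k) j` is symmetric. PHASE toggles one diagonal entry and CPHASE one
symmetric pair of entries, so each can be cleared without side effects. -/
theorem sweep_stepsR {F : PV n → PV n} (hF : ZReduced F) :
    Reduced (sweep (stepsR.map Step.onAut) F) := by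
  have fires : ∀ (b : Bool) (s : Shape) (k j : Fin n) (F : PV n → PV n),
      (⟨b, s, [(7, true)]⟩ : Step).Fires F k j ↔ zPart F (.X k) j = 1 := by
    intro b s k j F
    by_cases h : (F (.Z j)).x j = 0 <;>
      simp [Step.Fires, view, zPart, xOfZ, h, ← zmod2_ne_zero_iff]
  have key := sweep_establish Step.onAut stepsR ZReduced
    (fun s k j F => s.shape.gates k j ≠ [] → zPart F (.X k) j = 0) ?_ ?_ ?_ F hF
  · obtain ⟨h, hz⟩ := key
    refine h.reduced fun k j => ?_
    rcases eq_or_ne k j with rfl | hkj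
    · exact hz ⟨false, .phase, [(7, true)]⟩ (by simp [stepsR]) k k (by simp [Shape.gates])
    · exact hz ⟨false, .cphase, [(7, true)]⟩ (by simp [stepsR]) k j (by simp [Shape.gates, hkj])
  · intro s hs k j F hF
    rw [Step.onAut]
    split_ifs
    · simp only [stepsR, List.mem_cons, List.not_mem_nil, or_false] at hs
      rcases hs with rfl | rfl
      · simp only [Shape.gates]
        split_ifs
        · exact hF.right (act_phase_Z _ _)
        · rwa [splitOff_nil]
      · simp only [Shape.gates]
        split_ifs
        · exact hF.right (act_cphase_Z _ _ _ _)
        · rwa [splitOff_nil]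
    · exact hF
  · intro s hs k j F hF hg
    simp only [stepsR, List.mem_cons, List.not_mem_nil, or_false] at hs
    rw [Step.onAut]
    rcases hs with rfl | rfl
    · have hkj : k = j := by
        by_contra h
        exact hg (if_neg h)
      subst hkj
      split_ifs with hf <;> rw [fires] at hf
      · simp only [Shape.gates, if_true]
        rw [hF.zPart_right_phase, if_pos ⟨rfl, rfl⟩, hf, one_add_one_zmod2]
      · exact (zmod2_ne_one_iff _).1 hf
    · have hkj : k ≠ j := fun h => hg (dif_neg (not_not.2 h))
      split_ifs with hf <;> rw [fires] at hf
      · simp only [Shape.gates, dif_pos hkj]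
        rw [hF.zPart_right_cphase, if_pos ⟨rfl, rfl⟩, hf, one_add_one_zmod2]
      · exact (zmod2_ne_one_iff _).1 hf
  · intro s hs t _ k j k' j' F hF hC hg
    specialize hC hg
    simp only [stepsR, List.mem_cons, List.not_mem_nil, or_false] at hs
    rw [Step.onAut]
    split_ifs with hf
    · rcases hs with rfl | rfl
      · rw [fires] at hf
        simp only [Shape.gates]
        split_ifs with hkj
        · subst hkj
          rw [hF.zPart_right_phase, hf, one_add_one_zmod2, hC, ite_self]
        · rwa [splitOff_nil]
      · rw [fires] at hf
        simp only [Shape.gates]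
        split_ifs with hkj
        · rw [hF.zPart_right_cphase, ← hF.zPart_X_symm k j, hf, one_add_one_zmod2, hC, ite_self,
            ite_self]
        · rwa [splitOff_nil]
    · exact hC

/-! ### The last sweep -/

theorem sq_generator {v : PV n} (hv : v.x = 0 ∨ v.z = 0) (h0 : v.ph = 0) :
    v.mul v = PV.scalar 0 := by
  refine PV.ext ?_ ?_ ?_
  · rcases hv with h | h <;> simp [PV.mul, PV.scalar, h0, h, two_zero]
  · funext i
    simp [PV.mul, PV.scalar, zmod2_add_self]
  · funext i
    simp [PV.mul, PV.scalar, zmod2_add_self]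

/-- The image of an involution is an involution; for a pure `X` or `Z` type the square is `i ^ (2
c)`. So only the phases `1` and `-1` are possible. -/
theorem IsPauliAut.ph_add_ph {F : PV n → PV n} (hF : IsPauliAut F) {v : PV n}
    (hv : v.mul v = PV.scalar 0) (h : (F v).x = 0 ∨ (F v).z = 0) :
    (F v).ph + (F v).ph = 0 := by
  have h1 := hF.map_mul v v
  rw [hv, hF.map_scalar] at h1
  have h2 := congrArg PV.ph h1
  rcases h with h | h <;> simpa [PV.mul, PV.scalar, h, two_zero, eq_comm] using h2

theorem preZ_sq (F : PV n → PV n) (k : Fin n) : (preZ F k).mul (preZ F k) = PV.scalar 0 := by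
  unfold preZ
  split_ifs
  · exact sq_generator (Or.inl rfl) rfl
  · exact sq_generator (Or.inr rfl) rfl

theorem preX_sq (F : PV n → PV n) (k : Fin n) : (preX F k).mul (preX F k) = PV.scalar 0 := by
  unfold preX
  split_ifs
  · exact sq_generator (Or.inr rfl) rfl
  · exact sq_generator (Or.inl rfl) rfl

theorem Reduced.left {F : PV n → PV n} (hF : Reduced F) {gs : List (Gate n)}
    (hx : ∀ v, (splitOff true gs F v).x = (F v).x) (hz : ∀ v, (splitOff true gs F v).z = (F v).z) :
    Reduced (splitOff true gs F) ∧ preZ (splitOff true gs F) = preZ F ∧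
      preX (splitOff true gs F) = preX F := by
  have h : xOfZ (splitOff true gs F) = xOfZ F := by
    funext i b
    rw [xOfZ, hx, xOfZ]
  have hZ : preZ (splitOff true gs F) = preZ F := by
    funext k
    rw [preZ, preZ, h]
  have hX : preX (splitOff true gs F) = preX F := by
    funext k
    rw [preX, preX, h]
  refine ⟨⟨splitOff_isPauliAut _ _ hF.aut, ?_, ?_, ?_, ?_⟩, hZ, hX⟩
  · rw [hZ]
    exact fun k => (hx _).trans (hF.preZ_x k)
  · rw [hZ]
    exact fun k => (hz _).trans (hF.preZ_z k)
  · rw [hX]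
    exact fun k => (hx _).trans (hF.preX_x k)
  · rw [hX]
    exact fun k => (hz _).trans (hF.preX_z k)

theorem splitOff_not (F : PV n → PV n) (k : Fin n) (v : PV n) :
    splitOff true [.not k] F v = ⟨(F v).ph + two ((F v).z k), (F v).x, (F v).z⟩ := rfl

theorem splitOff_phase_phase (F : PV n → PV n) (k : Fin n) (v : PV n) :
    splitOff true [.phase k, .phase k] F v =
      ⟨(F v).ph + two ((F v).x k), (F v).x, (F v).z⟩ := by
  refine PV.ext ?_ ?_ ?_
  · have h : (4 : ZMod 4) = 0 := rfl
    simp only [splitOff, if_true, List.foldr_cons, List.foldr_nil, Gate.act, two]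
    linear_combination (((F v).x k).val : ZMod 4) * h
  · simp [splitOff, Gate.act]
  · simp [splitOff, Gate.act, add_add_cancel_zmod2]

theorem zmod4_add_two_one : ∀ a : ZMod 4, a + a = 0 → a ≠ 0 → a + two 1 = 0 := by decide

/-- Among the generators, NOT on qubit `k` anticommutes with `Z k` only and `PHASE ^ 2` with `X k`
only. Each gate thus flips the sign of exactly one of the images, that of `preZ F k` or that of
`preX F k`. -/
theorem sweep_stepsSign {F : PV n → PV n} (hF : Reduced F) (k : Fin n) :
    sweep (stepsSign.map Step.onAut) F (preZ (sweep (stepsSign.map Step.onAut) F) k) = .Z k ∧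
    sweep (stepsSign.map Step.onAut) F (preX (sweep (stepsSign.map Step.onAut) F) k) = .X k := by
  have hN : ∀ (F : PV n → PV n) (k : Fin n), Reduced F →
      Reduced (splitOff true [.not k] F) ∧ preZ (splitOff true [.not k] F) = preZ F ∧
      preX (splitOff true [.not k] F) = preX F := fun F k hF => hF.left (fun _ => rfl) fun _ => rfl
  have hP : ∀ (F : PV n → PV n) (k : Fin n), Reduced F →
      Reduced (splitOff true [.phase k, .phase k] F) ∧
      preZ (splitOff true [.phase k, .phase k] F) = preZ F ∧
      preX (splitOff true [.phase k, .phase k] F) = preX F := fun F k hF =>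
    hF.left (fun _ => by rw [splitOff_phase_phase]) fun _ => by rw [splitOff_phase_phase]
  have fN : ∀ (F : PV n → PV n) (k : Fin n),
      (⟨true, .not, [(8, true)]⟩ : Step).Fires F k k ↔ (F (preZ F k)).ph ≠ 0 := by
    intro F k
    by_cases h : (F (.Z k)).x k = 0 <;> simp [Step.Fires, view, preZ, xOfZ, h]
  have fP : ∀ (F : PV n → PV n) (k : Fin n),
      (⟨true, .z, [(9, true)]⟩ : Step).Fires F k k ↔ (F (preX F k)).ph ≠ 0 := by
    intro F k
    by_cases h : (F (.Z k)).x k = 0 <;> simp [Step.Fires, view, preX, xOfZ, h]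
  have caseN : ∀ (F : PV n → PV n) (k : Fin n), Reduced F →
      ((splitOff true [.not k] F) (preZ F k)).ph = (F (preZ F k)).ph + two 1 ∧
      (∀ i, i ≠ k → ((splitOff true [.not k] F) (preZ F i)).ph = (F (preZ F i)).ph) ∧
      ∀ i, ((splitOff true [.not k] F) (preX F i)).ph = (F (preX F i)).ph := by
    intro F k hF
    simp only [splitOff_not]
    refine ⟨by simp [hF.preZ_z], fun i hi => ?_, fun i => ?_⟩
    · simp [hF.preZ_z, hi.symm, two_zero]
    · simp [hF.preX_z, two_zero]
  have caseP : ∀ (F : PV n → PV n) (k : Fin n), Reduced F →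
      ((splitOff true [.phase k, .phase k] F) (preX F k)).ph = (F (preX F k)).ph + two 1 ∧
      (∀ i, i ≠ k → ((splitOff true [.phase k, .phase k] F) (preX F i)).ph =
        (F (preX F i)).ph) ∧
      ∀ i, ((splitOff true [.phase k, .phase k] F) (preZ F i)).ph = (F (preZ F i)).ph := by
    intro F k hF
    simp only [splitOff_phase_phase]
    refine ⟨by simp [hF.preX_x], fun i hi => ?_, fun i => ?_⟩
    · simp [hF.preX_x, hi.symm, two_zero]
    · simp [hF.preZ_x, two_zero]
  have cancelZ : ∀ (F : PV n → PV n) (k : Fin n), Reduced F → (F (preZ F k)).ph ≠ 0 →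
      (F (preZ F k)).ph + two 1 = 0 := fun F k hF h =>
    zmod4_add_two_one _ (hF.aut.ph_add_ph (preZ_sq F k) (Or.inl (hF.preZ_x k))) h
  have cancelX : ∀ (F : PV n → PV n) (k : Fin n), Reduced F → (F (preX F k)).ph ≠ 0 →
      (F (preX F k)).ph + two 1 = 0 := fun F k hF h =>
    zmod4_add_two_one _ (hF.aut.ph_add_ph (preX_sq F k) (Or.inr (hF.preX_z k))) h
  have key := sweep_establish Step.onAut stepsSign Reduced
    (fun s k j F => k = j → (s.shape = .not → (F (preZ F k)).ph = 0) ∧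
      (s.shape = .z → (F (preX F k)).ph = 0)) ?_ ?_ ?_ F hF
  · obtain ⟨h, hz⟩ := key
    have h1 := (hz ⟨true, .not, [(8, true)]⟩ (by simp [stepsSign]) k k rfl).1 rfl
    have h2 := (hz ⟨true, .z, [(9, true)]⟩ (by simp [stepsSign]) k k rfl).2 rfl
    exact ⟨PV.ext h1 (h.preZ_x k) (h.preZ_z k), PV.ext h2 (h.preX_x k) (h.preX_z k)⟩
  · intro s hs k j F hF
    rw [Step.onAut]
    split_ifs
    · simp only [stepsSign, List.mem_cons, List.not_mem_nil, or_false] at hs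
      rcases hs with rfl | rfl
      · simp only [Shape.gates]
        split_ifs
        · exact (hN F k hF).1
        · rwa [splitOff_nil]
      · simp only [Shape.gates]
        split_ifs
        · exact (hP F k hF).1
        · rwa [splitOff_nil]
    · exact hF
  · rintro s hs k j F hF rfl
    simp only [stepsSign, List.mem_cons, List.not_mem_nil, or_false] at hs
    rw [Step.onAut]
    rcases hs with rfl | rfl
    · refine ⟨fun _ => ?_, fun h => by cases h⟩
      split_ifs with hf
      · simp only [Shape.gates, if_true]
        rw [(hN F k hF).2.1, (caseN F k hF).1, cancelZ F k hF ((fN F k).1 hf)]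
      · simpa using mt (fN F k).2 hf
    · refine ⟨fun h => (by cases h), fun _ => ?_⟩
      split_ifs with hf
      · simp only [Shape.gates, if_true]
        rw [(hP F k hF).2.2, (caseP F k hF).1, cancelX F k hF ((fP F k).1 hf)]
      · simpa using mt (fP F k).2 hf
  · rintro s hs t ht k j i i' F hF hC rfl
    specialize hC rfl
    simp only [stepsSign, List.mem_cons, List.not_mem_nil, or_false] at hs
    rw [Step.onAut]
    split_ifs with hf
    · rcases hs with rfl | rfl
      · simp only [Shape.gates]
        split_ifs with hkj
        · subst hkj
          rw [(hN F k hF).2.1, (hN F k hF).2.2]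
          refine ⟨fun h => ?_, fun h => ?_⟩
          · rcases eq_or_ne i k with rfl | hik
            · exact absurd (hC.1 h) ((fN F i).1 hf)
            · rw [(caseN F k hF).2.1 i hik, hC.1 h]
          · rw [(caseN F k hF).2.2, hC.2 h]
        · rwa [splitOff_nil]
      · simp only [Shape.gates]
        split_ifs with hkj
        · subst hkj
          rw [(hP F k hF).2.1, (hP F k hF).2.2]
          refine ⟨fun h => ?_, fun h => ?_⟩
          · rw [(caseP F k hF).2.2, hC.1 h]
          · rcases eq_or_ne i k with rfl | hik
            · exact absurd (hC.2 h) ((fP F i).1 hf)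
            · rw [(caseP F k hF).2.1 i hik, hC.2 h]
        · rwa [splitOff_nil]
    · exact hC

theorem reduceAut_spec {F : PV n → PV n} (hF : IsPauliAut F) (k : Fin n) :
    reduceAut F (preZ (reduceAut F) k) = .Z k ∧ reduceAut F (preX (reduceAut F) k) = .X k := by
  obtain ⟨h1, hx⟩ := sweep_stepsX hF
  obtain ⟨⟨h2, hx'⟩, hz⟩ := sweep_stepsZ h1 hx
  exact sweep_stepsSign (sweep_stepsR (sweep_stepsL (halfReduced_of_diagonal h2 hx' hz))) k

/-! ### From automorphisms to circuits and matrices: existence of the normal form -/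

/-! ### The reduction, on circuits -/

/-- The circuits collected so far: `r` is the first circuit, in reverse order, and `l` is the
second one. -/
structure St (n : ℕ) : Type where
  r : List (Gate n)
  l : List (Gate n)

/-- What remains of the automorphism `f` after splitting off both circuits. -/
def St.aut (f : PV n → PV n) (σ : St n) : PV n → PV n := fun v =>
  σ.l.foldr (Gate.act true) (f (σ.r.foldl (fun v g => g.act true v) v))

/-- The total number of gates. -/
def St.size (σ : St n) : ℕ := σ.r.length + σ.l.length

/-- Add gates to one of the circuits. -/
def St.push (left : Bool) (gs : List (Gate n)) (σ : St n) : St n :=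
  if left then ⟨σ.r, gs ++ σ.l⟩ else ⟨gs ++ σ.r, σ.l⟩

/-- The effect of a step on the circuits. -/
def Step.onSt (f : PV n → PV n) (s : Step) (k j : Fin n) (σ : St n) : St n :=
  if s.Fires (σ.aut f) k j then σ.push s.left (s.shape.gates k j) else σ

/-- The reduction of `f`. -/
def reduce (f : PV n → PV n) : St n :=
  sweeps.foldl (fun σ ss => sweep (ss.map (Step.onSt f)) σ) ⟨[], []⟩

theorem St.aut_push (f : PV n → PV n) (left : Bool) (gs : List (Gate n)) (σ : St n) :
    (σ.push left gs).aut f = splitOff left gs (σ.aut f) := by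
  cases left <;> funext v <;> simp [St.push, St.aut, splitOff]

theorem Step.aut_onSt (f : PV n → PV n) (s : Step) (k j : Fin n) (σ : St n) :
    (s.onSt f k j σ).aut f = s.onAut k j (σ.aut f) := by
  unfold Step.onSt Step.onAut
  split_ifs
  · exact St.aut_push _ _ _ _
  · rfl

theorem foldl_hom {α β γ : Type*} (f : α → γ → α) (g : β → γ → β) (M : α → β)
    (l : List γ) (h : ∀ a, ∀ c ∈ l, M (f a c) = g (M a) c) (a : α) :
    M (l.foldl f a) = l.foldl g (M a) :=
  (foldl_transfer f g (fun _ => True) M l (fun a _ c hc => ⟨trivial, h a c hc⟩) a trivial).2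

theorem reduce_aut (f : PV n → PV n) : (reduce f).aut f = reduceAut f := by
  refine foldl_hom _ _ (St.aut f) sweeps (fun σ ss _ => ?_) ⟨[], []⟩
  simp only [sweep, List.foldl_map]
  refine foldl_hom _ _ (St.aut f) _ (fun σ k _ => ?_) σ
  refine foldl_hom _ _ (St.aut f) _ (fun σ s _ => ?_) σ
  exact foldl_hom _ _ (St.aut f) _ (fun σ j _ => Step.aut_onSt f s k j σ) σ

theorem foldl_keep {α β : Type*} (f : α → β → α) (l : List β) (I : α → Prop)
    (h : ∀ a, ∀ b ∈ l, I a → I (f a b)) (a : α) (ha : I a) : I (l.foldl f a) := by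
  induction l generalizing a with
  | nil => exact ha
  | cons b l ih => exact ih (fun a c hc => h a c (by simp [hc])) _ (h a b (by simp) ha)

theorem reduce_keep (f : PV n → PV n) (I : St n → Prop) (h0 : I ⟨[], []⟩)
    (h : ∀ ss ∈ sweeps, ∀ s ∈ ss, ∀ k j σ, I σ → I (s.onSt f k j σ)) : I (reduce f) := by
  refine foldl_keep _ sweeps I (fun σ ss hss hσ => ?_) _ h0
  simp only [sweep, List.foldl_map]
  refine foldl_keep _ _ I (fun σ k _ hσ => ?_) _ hσ
  refine foldl_keep _ _ I (fun σ s hs hσ => ?_) _ hσ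
  exact foldl_keep _ _ I (fun σ j _ hσ => h ss hss s hs k j σ hσ) _ hσ

theorem Shape.gates_affine (s : Shape) (k j : Fin n) : ∀ g ∈ s.gates k j, g.IsAffineGate := by
  intro g hg
  cases s <;> simp only [Shape.gates] at hg <;> split_ifs at hg <;> simp at hg <;> subst hg <;> trivial

theorem Shape.gates_linear (s : Shape) (h : s ≠ .not) (k j : Fin n) :
    ∀ g ∈ s.gates k j, g.IsLinearGate := by
  intro g hg
  cases s <;> simp only [Shape.gates] at hg <;> first | contradiction | skip
  all_goals split_ifs at hg <;> simp at hg <;> subst hg <;> trivial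

theorem reduce_gates (f : PV n → PV n) :
    (∀ g ∈ (reduce f).r, g.IsLinearGate) ∧ ∀ g ∈ (reduce f).l, g.IsAffineGate := by
  refine reduce_keep f
    (fun σ => (∀ g ∈ σ.r, g.IsLinearGate) ∧ ∀ g ∈ σ.l, g.IsAffineGate) (by simp) ?_
  intro ss hss s hs k j σ hσ
  -- NOT gates occur in `stepsSign` only, and there on the left, which is why `M₁` needs none.
  have hleft : s.left = false → s.shape ≠ .not := by
    simp only [sweeps, stepsX, stepsZ, stepsL, stepsR, stepsSign, List.mem_cons, List.not_mem_nil,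
      or_false] at hss
    rcases hss with rfl | rfl | rfl | rfl | rfl <;>
    simp only [List.mem_cons, List.not_mem_nil, or_false] at hs <;>
    rcases hs with rfl | rfl | rfl <;> simp
  unfold Step.onSt
  split_ifs
  · unfold St.push
    split_ifs with hl
    · refine ⟨hσ.1, fun g hg => ?_⟩
      rcases List.mem_append.mp hg with hg | hg
      · exact Shape.gates_affine _ _ _ g hg
      · exact hσ.2 g hg
    · refine ⟨fun g hg => ?_, hσ.2⟩
      rcases List.mem_append.mp hg with hg | hg
      · exact Shape.gates_linear _ (hleft (by simpa using hl)) _ _ g hg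
      · exact hσ.1 g hg
  · exact hσ

theorem Shape.gates_length (s : Shape) (k j : Fin n) : (s.gates k j).length ≤ 2 := by
  cases s <;> simp only [Shape.gates] <;> split_ifs <;> simp

theorem Step.onSt_size (f : PV n → PV n) (s : Step) (k j : Fin n) (σ : St n) :
    (s.onSt f k j σ).size ≤ σ.size + 2 := by
  have h := s.shape.gates_length k j
  unfold Step.onSt St.push St.size
  split_ifs <;> simp <;> omega

theorem foldl_size_le {α β : Type*} (μ : α → ℕ) (c : ℕ) (f : α → β → α)
    (h : ∀ a b, μ (f a b) ≤ μ a + c) (l : List β) (a : α) :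
    μ (l.foldl f a) ≤ μ a + l.length * c := by
  induction l generalizing a with
  | nil => simp
  | cons b l ih =>
    have h1 := ih (f a b)
    have h2 := h a b
    simp only [List.foldl_cons, List.length_cons, add_mul, one_mul]
    omega

theorem sweep_size_le (f : PV n → PV n) (ss : List Step) (σ : St n) :
    (sweep (ss.map (Step.onSt f)) σ).size ≤ σ.size + n * (ss.length * (n * 2)) := by
  simp only [sweep, List.foldl_map]
  have h1 : ∀ (k : Fin n) (s : Step) (σ : St n),
      ((List.finRange n).foldl (fun σ j => s.onSt f k j σ) σ).size ≤ σ.size + n * 2 := by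
    intro k s σ
    simpa using foldl_size_le St.size 2 (fun σ j => s.onSt f k j σ)
      (fun σ j => Step.onSt_size f s k j σ) (List.finRange n) σ
  have h2 := foldl_size_le St.size (ss.length * (n * 2)) (fun (σ : St n) (k : Fin n) => ss.foldl
    (fun σ s => (List.finRange n).foldl (fun σ j => s.onSt f k j σ) σ) σ)
    (fun σ k => foldl_size_le St.size (n * 2) _ (fun σ s => h1 k s σ) ss σ) (List.finRange n) σ
  simpa using h2

/-- The five lists contain twelve steps; each step is tried for `n ^ 2` pairs and emits at most two
gates. -/
theorem reduce_size_le (f : PV n → PV n) : (reduce f).size ≤ 24 * n ^ 2 := by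
  have h := fun ss σ => sweep_size_le (n := n) f ss σ
  simp only [reduce, sweeps, List.foldl_cons, List.foldl_nil]
  set σ0 : St n := ⟨[], []⟩ with h0
  have e0 : σ0.size = 0 := by simp [h0, St.size]
  have e1 := h stepsX σ0
  set σ1 := sweep (stepsX.map (Step.onSt f)) σ0
  have e2 := h stepsZ σ1
  set σ2 := sweep (stepsZ.map (Step.onSt f)) σ1
  have e3 := h stepsL σ2
  set σ3 := sweep (stepsL.map (Step.onSt f)) σ2
  have e4 := h stepsR σ3
  set σ4 := sweep (stepsR.map (Step.onSt f)) σ3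
  have e5 := h stepsSign σ4
  generalize (sweep (stepsSign.map (Step.onSt f)) σ4).size = t at e5 ⊢
  simp only [stepsX, stepsZ, stepsL, stepsR, stepsSign, List.length_cons, List.length_nil]
    at e1 e2 e3 e4 e5
  nlinarith

/-! ### Matrices -/

theorem Circuit.implements (C : Circuit n) :
    Implements C.matrix (fun v => C.foldl (fun v g => g.act false v) v) := by
  induction C with
  | nil => exact Implements.one
  | cons g C ih => exact ih.comp g.implements

theorem Circuit.implements_conjTranspose (C : Circuit n) :
    Implements C.matrixᴴ (fun v => C.foldr (Gate.act true) v) := by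
  induction C with
  | nil =>
    have : (Circuit.matrix ([] : Circuit n))ᴴ = 1 := conjTranspose_one
    rw [this]
    exact Implements.one
  | cons g C ih =>
    have : (Circuit.matrix (g :: C))ᴴ = g.matrixᴴ * (Circuit.matrix C)ᴴ := conjTranspose_mul _ _
    rw [this]
    exact g.implements_conjTranspose.comp ih

theorem pauli1_zero : pauli1 0 0 = 1 := by
  apply matrix_zmod2_ext <;> simp [pauli1, sgn_zero]

/-- Meant for the generators `X k` and `Z k`; the condition `x * z = 0` excludes `Y`, for which a
sign would appear. -/
theorem hadamardOn_mul_W (S : Finset (Fin n)) (v : PV n) (k : Fin n) (x z : ZMod 2)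
    (hv : v = ⟨0, Pi.single k x, Pi.single k z⟩) (hxz : x * z = 0) :
    hadamardOn S * W v =
      W (if k ∈ S then ⟨0, Pi.single k z, Pi.single k x⟩ else v) * hadamardOn S := by
  rw [hv, W_eq_tensor, W_eq_tensor, hadamardOn, ipow_zero, one_smul, tensor_mul]
  have hph : (if k ∈ S then (⟨0, Pi.single k z, Pi.single k x⟩ : PV n)
      else ⟨0, Pi.single k x, Pi.single k z⟩).ph = 0 := by split_ifs <;> rfl
  rw [hph, ipow_zero, one_smul, tensor_mul]
  congr 1
  funext i
  rcases eq_or_ne i k with rfl | hi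
  · by_cases hS : i ∈ S
    · simpa [hS, hxz, two_zero, ipow_zero] using matH_mul_pauli1 x z
    · simp [hS]
  · by_cases hk : k ∈ S <;> simp [hi, hk, pauli1_zero]

theorem hadamardOn_unitary (S : Finset (Fin n)) : (hadamardOn S)ᴴ * hadamardOn S = 1 := by
  rw [hadamardOn, tensor_conjTranspose, tensor_mul, ← tensor_one]
  congr 1
  funext k
  split_ifs
  · exact matH_unitary
  · simp

/-- If `y` and `w` differ at `k`, they belong to different eigenvalues of `Z k`, so the entry of `V`
at `(y, w)` vanishes. Commuting with `X k` makes the diagonal invariant under flipping bit `k`. -/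
theorem eq_smul_one_of_commute (V : Op n) (hX : ∀ k, V * W (.X k) = W (.X k) * V)
    (hZ : ∀ k, V * W (.Z k) = W (.Z k) * V) : ∃ c : ℂ, V = c • 1 := by
  have mulW : ∀ (v : PV n) (y w : Bits n),
      (V * W v) y w = V y (w + v.x) * (ipow v.ph * sgn (v.z ⬝ᵥ w)) := by
    intro v y w
    rw [Matrix.mul_apply, Finset.sum_eq_single (w + v.x)]
    · simp [W, mono]
    · intro u _ hu
      simp [W, mono, hu]
    · simp
  have Wmul : ∀ (v : PV n) (y w : Bits n),
      (W v * V) (y + v.x) w = ipow v.ph * sgn (v.z ⬝ᵥ y) * V y w := by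
    intro v y w
    rw [Matrix.mul_apply, Finset.sum_eq_single y]
    · simp [W, mono]
    · intro u _ hu
      simp [W, mono, hu.symm]
    · simp
  have off : ∀ y w, y ≠ w → V y w = 0 := by
    intro y w hyw
    obtain ⟨k, hk⟩ := Function.ne_iff.mp hyw
    have h1 := mulW (.Z k) y w
    have h2 := Wmul (.Z k) y w
    rw [hZ k] at h1
    have e : y + (PV.Z k).x = y := by simp [PV.Z]
    have e' : w + (PV.Z k).x = w := by simp [PV.Z]
    rw [e] at h2
    rw [e', h2] at h1
    simp only [PV.Z, ipow_zero, one_mul, single_dotProduct] at h1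
    by_contra h0
    refine hk (sgn_injective (mul_left_cancel₀ h0 ?_))
    rw [mul_comm, h1]
  have diag : ∀ k y, V (y + Pi.single k 1) (y + Pi.single k 1) = V y y := by
    intro k y
    have h1 := mulW (.X k) (y + (PV.X k).x) y
    have h2 := Wmul (.X k) y y
    rw [hX k, h2] at h1
    simpa [PV.X, sgn_zero, ipow_zero] using h1.symm
  -- Every bit string arises from `0` by flipping one bit at a time.
  have const : ∀ (y : Bits n) (s : Finset (Fin n)),
      V (∑ k ∈ s, Pi.single k (y k)) (∑ k ∈ s, Pi.single k (y k)) = V 0 0 := by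
    intro y s
    induction s using Finset.induction_on with
    | empty => simp
    | insert k s hk ih =>
      rw [Finset.sum_insert hk, add_comm]
      rcases zmod2_cases (y k) with h | h
      · rw [h, Pi.single_zero, add_zero, ih]
      · rw [h, diag, ih]
  refine ⟨V 0 0, ?_⟩
  ext y w
  by_cases h : y = w
  · subst h
    have := const y Finset.univ
    rw [Finset.univ_sum_single] at this
    simp [this]
  · simp [off y w h, h]

theorem norm_eq_one_of_smul {U V : Op n} (hU : Uᴴ * U = 1) (hV : Vᴴ * V = 1) {c : ℂ}
    (h : U = c • V) : ‖c‖ = 1 := by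
  rw [h, conjTranspose_smul, Matrix.smul_mul, Matrix.mul_smul, hV, smul_smul] at hU
  have := congrFun (congrFun hU 0) 0
  simp only [Matrix.smul_apply, Matrix.one_apply, if_true, smul_eq_mul, mul_one] at this
  have h2 := congrArg norm this
  rw [norm_mul, norm_star, norm_one] at h2
  nlinarith [norm_nonneg c]

/-- The qubits to which the reduction applies a Hadamard gate. -/
def reduceSet (f : PV n → PV n) : Finset (Fin n) :=
  Finset.univ.filter fun k => xOfZ ((reduce f).aut f) k k ≠ 0

/-- `U` and `hadamardOn S` conjugate all generators in the same way, so their quotient is scalar. -/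
theorem exists_eq_smul_hadamardOn {U : Op n} {F : PV n → PV n} (hU : Implements U F)
    (h : ∀ k, F (preZ F k) = .Z k ∧ F (preX F k) = .X k) :
    ∃ c : ℂ, U = c • hadamardOn (Finset.univ.filter fun k => xOfZ F k k ≠ 0) := by
  set S := Finset.univ.filter fun k => xOfZ F k k ≠ 0 with hS
  have hH := hadamardOn_unitary S
  have hH2 := mul_eq_one_comm.mp hH
  have hmem : ∀ k, k ∈ S ↔ xOfZ F k k ≠ 0 := fun k => by simp [hS]
  have key : ∀ v w, hadamardOn S * W v = W w * hadamardOn S → F v = w →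
      (hadamardOn S)ᴴ * U * W v = W v * ((hadamardOn S)ᴴ * U) := by
    intro v w h1 h2
    have h3 : (hadamardOn S)ᴴ * W w = W v * (hadamardOn S)ᴴ := by
      calc (hadamardOn S)ᴴ * W w = (hadamardOn S)ᴴ * (W w * hadamardOn S) * (hadamardOn S)ᴴ := by
            rw [mul_assoc, mul_assoc, hH2, mul_one]
        _ = W v * (hadamardOn S)ᴴ := by rw [← h1, ← mul_assoc, hH, one_mul]
    rw [mul_assoc, hU.conj, h2, ← mul_assoc, h3, mul_assoc]
  obtain ⟨c, hc⟩ := eq_smul_one_of_commute ((hadamardOn S)ᴴ * U)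
    (fun k => key _ _ (hadamardOn_mul_W S (.X k) k 1 0 (by simp [PV.X]) (by simp)) (by
      by_cases hk : xOfZ F k k = 0
      · rw [if_neg (by simp [hmem, hk])]
        simpa [preX, hk] using (h k).2
      · rw [if_pos (by simp [hmem, hk])]
        simpa [preZ, hk, PV.Z] using (h k).1))
    (fun k => key _ _ (hadamardOn_mul_W S (.Z k) k 0 1 (by simp [PV.Z]) (by simp)) (by
      by_cases hk : xOfZ F k k = 0
      · rw [if_neg (by simp [hmem, hk])]
        simpa [preZ, hk] using (h k).1
      · rw [if_pos (by simp [hmem, hk])]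
        simpa [preX, hk, PV.X] using (h k).2))
  refine ⟨c, ?_⟩
  calc U = hadamardOn S * ((hadamardOn S)ᴴ * U) := by rw [← mul_assoc, hH2, one_mul]
    _ = c • hadamardOn S := by rw [hc, Matrix.mul_smul, mul_one]

/-- The matrix `Lᴴ * U * Rᴴ` implements the reduced automorphism, hence is a scalar multiple of a
Hadamard layer, and `L` and `R` can be moved to the other side. -/
theorem isNormalForm_reduce {U : Op n} {f : PV n → PV n} (hU : Implements U f) :
    IsNormalForm (24 * n ^ 2) U (reduce f).r.reverse (reduceSet f) (reduce f).l := by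
  have hg := reduce_gates f
  have hs := reduce_size_le f
  rw [St.size] at hs
  have h1 := Circuit.implements_conjTranspose (reduce f).l
  have h2 := Circuit.implements_conjTranspose (reduce f).r.reverse
  set L := Circuit.matrix (reduce f).l with hL
  set R := Circuit.matrix (reduce f).r.reverse with hR
  have h3 : Implements (Lᴴ * U * Rᴴ) ((reduce f).aut f) := by
    have := (h1.comp hU).comp h2
    simp only [List.foldr_reverse] at this
    exact this
  have h4 := h3
  rw [reduce_aut] at h4
  obtain ⟨c, hc⟩ := exists_eq_smul_hadamardOn h4 (reduceAut_spec hU.isPauliAut)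
  rw [← reduce_aut] at hc
  refine ⟨fun g hg' => hg.1 g (List.mem_reverse.mp hg'), hg.2, by simpa using by omega, by omega,
    c, norm_eq_one_of_smul h3.unitary (hadamardOn_unitary _) hc, ?_⟩
  have hLL : L * Lᴴ = 1 := by simpa using h1.unitary
  have hRR : Rᴴ * R = 1 := mul_eq_one_comm.mp (by simpa using h2.unitary)
  calc U = L * (Lᴴ * U * Rᴴ) * R := by
        rw [mul_assoc, mul_assoc, hRR, mul_one, ← mul_assoc, hLL, one_mul]
    _ = c • (L * hadamardOn (reduceSet f) * R) := by
        rw [hc, Matrix.mul_smul, Matrix.smul_mul, reduceSet]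

/-! ### Clifford operations -/

theorem isPauliMatrix_eq_pauli1 {σ : Matrix (ZMod 2) (ZMod 2) ℂ} (h : IsPauliMatrix σ) :
    ∃ (c : ZMod 4) (x z : ZMod 2), σ = ipow c • pauli1 x z := by
  rcases h with rfl | rfl | rfl | rfl
  · exact ⟨0, 0, 0, by rw [pauli1_zero, ipow_zero, one_smul]⟩
  · refine ⟨0, 1, 0, ?_⟩
    apply matrix_zmod2_ext <;> simp [matX, pauli1, sgn_zero, ipow_zero]
  · refine ⟨1, 1, 1, ?_⟩
    apply matrix_zmod2_ext <;>
      simp [matY, matX, matZ, pauli1, sgn_zero, sgn_one, ipow_one, Matrix.mul_apply,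
        Matrix.diagonal, one_add_one_zmod2, val_one_zmod2]
  · refine ⟨0, 0, 1, ?_⟩
    apply matrix_zmod2_ext <;>
      simp [matZ, pauli1, sgn_zero, sgn_one, ipow_zero, Matrix.diagonal, val_one_zmod2]

theorem pauli1_eq_isPauliMatrix (x z : ZMod 2) :
    ∃ (k : ℕ) (σ : Matrix (ZMod 2) (ZMod 2) ℂ), IsPauliMatrix σ ∧
      pauli1 x z = Complex.I ^ k • σ := by
  have h3 : Complex.I ^ 3 * Complex.I = 1 := by rw [← pow_succ, Complex.I_pow_four]
  rcases zmod2_cases x with rfl | rfl <;> rcases zmod2_cases z with rfl | rfl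
  · exact ⟨0, 1, Or.inl rfl, by rw [pauli1_zero, pow_zero, one_smul]⟩
  · refine ⟨0, matZ, Or.inr (Or.inr (Or.inr rfl)), ?_⟩
    apply matrix_zmod2_ext <;>
      simp [matZ, pauli1, sgn_zero, sgn_one, Matrix.diagonal, val_one_zmod2]
  · refine ⟨0, matX, Or.inr (Or.inl rfl), ?_⟩
    apply matrix_zmod2_ext <;> simp [matX, pauli1, sgn_zero]
  · refine ⟨3, matY, Or.inr (Or.inr (Or.inl rfl)), ?_⟩
    rw [matY, smul_smul, h3, one_smul]
    apply matrix_zmod2_ext <;>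
      simp [matX, matZ, pauli1, sgn_zero, sgn_one, Matrix.mul_apply,
        Matrix.diagonal, one_add_one_zmod2, val_one_zmod2]

theorem W_mem_pauliGroup (v : PV n) : W v ∈ pauliGroup n := by
  choose k σ hσ h using fun i => pauli1_eq_isPauliMatrix (v.x i) (v.z i)
  refine ⟨v.ph.val + ∑ i, k i, σ, hσ, ?_⟩
  rw [W_eq_tensor, funext h, tensor_smul, smul_smul, pow_add, Finset.prod_pow_eq_pow_sum, ipow]

theorem exists_W_of_mem_pauliGroup {Q : Op n} (h : Q ∈ pauliGroup n) : ∃ v, Q = W v := by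
  obtain ⟨k, σ, hσ, rfl⟩ := h
  choose c x z h using fun i => isPauliMatrix_eq_pauli1 (hσ i)
  refine ⟨⟨(k : ZMod 4) + ∑ i, c i, x, z⟩, ?_⟩
  have hprod : ∀ s : Finset (Fin n), ipow (∑ i ∈ s, c i) = ∏ i ∈ s, ipow (c i) := by
    intro s
    induction s using Finset.induction_on with
    | empty => simp [ipow_zero]
    | insert a s ha ih => rw [Finset.sum_insert ha, Finset.prod_insert ha, ipow_add, ih]
  rw [W_eq_tensor, funext h, tensor_smul, smul_smul, ipow_add, ipow_natCast, hprod]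

/-- A choice of vectors for the conjugated Pauli operators suffices; the algebraic properties of `f`
come from `Implements.isPauliAut`. -/
theorem IsClifford.exists_implements {U : Op n} (h : IsClifford U) : ∃ f, Implements U f := by
  have hU : Uᴴ * U = 1 := by
    have := (Matrix.mem_unitaryGroup_iff' (A := U)).mp h.1
    rwa [star_eq_conjTranspose] at this
  choose f hf using fun v : PV n => exists_W_of_mem_pauliGroup (h.2 _ (W_mem_pauliGroup v))
  refine ⟨f, hU, fun v => ?_⟩
  rw [← hf v, mul_assoc, hU, mul_one]

/-! ### The algorithm: a program for the reduction, its correctness and its running time -/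

/-! ### Programs with bounded loops -/

/-- Loop programs; `rep p` repeats `p` a fixed number of times. -/
inductive LProg : Type
  | skip : LProg
  | assign (a : ℕ) (e f : Expr) : LProg
  | seq (p q : LProg) : LProg
  | ite (e : Expr) (p q : LProg) : LProg
  | rep (p : LProg) : LProg

/-- The expression reads no cell of array `a`. -/
def Expr.avoids (a : ℕ) : Expr → Bool
  | .const _ => true
  | .get b e => b != a && e.avoids a
  | .add e f | .sub e f => e.avoids a && f.avoids a

namespace LProg

/-- The effect of a loop program on the memory, if `rep` means `N` repetitions. -/
def run (N : ℕ) : LProg → Mem → Mem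
  | skip, m => m
  | assign a e f, m => m.write a (e.eval m) (f.eval m)
  | seq p q, m => q.run N (p.run N m)
  | ite e p q, m => if e.eval m ≠ 0 then p.run N m else q.run N m
  | rep p, m => (p.run N)^[N] m

/-- The program does not write to array `a`. -/
def keeps (a : ℕ) : LProg → Bool
  | skip => true
  | assign b _ _ => b != a
  | seq p q | ite _ p q => p.keeps a && q.keeps a
  | rep p => p.keeps a

/-- No expression of the program reads array `a`. -/
def avoids (a : ℕ) : LProg → Bool
  | skip => true
  | assign _ e f => e.avoids a && f.avoids a
  | seq p q => p.avoids a && q.avoids a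
  | ite e p q => e.avoids a && p.avoids a && q.avoids a
  | rep p => p.avoids a

/-- Translation into programs of the machine. The number of repetitions is in cell `0` of
array `2`, and array `3` holds the loop counters; `d` is the nesting depth. -/
def compile : LProg → ℕ → Prog
  | skip, _ => .skip
  | assign a e f, _ => .assign a e f
  | seq p q, d => .seq (p.compile d) (q.compile d)
  | ite e p q, d => .ite e (p.compile d) (q.compile d)
  | rep p, d => .seq (.assign 3 (.const d) (.get 2 (.const 0)))
      (.loop (.get 3 (.const d))
        (.seq (.assign 3 (.const d) (.sub (.get 3 (.const d)) (.const 1))) (p.compile (d + 1))))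

/-- A bound for the running time. -/
noncomputable def cost : LProg → Polynomial ℕ
  | skip => 0
  | assign _ _ _ => 1
  | seq p q => p.cost + q.cost
  | ite _ p q => p.cost + q.cost + 1
  | rep p => Polynomial.X * (p.cost + 2) + 2

theorem run_of_keeps {N a : ℕ} {p : LProg} (h : p.keeps a = true) (m : Mem) :
    p.run N m a = m a := by
  induction p generalizing m with
  | skip => rfl
  | assign b e f =>
    simp only [keeps, bne_iff_ne, ne_eq] at h
    simp [run, Mem.write, Ne.symm h]
  | seq p q hp hq =>
    simp only [keeps, Bool.and_eq_true] at h
    rw [run, hq h.2, hp h.1]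
  | ite e p q hp hq =>
    simp only [keeps, Bool.and_eq_true] at h
    rw [run]
    split_ifs
    · exact hp h.1 m
    · exact hq h.2 m
  | rep p hp =>
    have key : ∀ k, ∀ m : Mem, (p.run N)^[k] m a = m a := by
      intro k
      induction k with
      | zero => exact fun _ => rfl
      | succ k ih => exact fun m => by rw [Function.iterate_succ_apply, ih, hp h]
    exact key N m

end LProg

theorem Expr.eval_of_avoids {a : ℕ} {e : Expr} (h : e.avoids a = true) {m m' : Mem}
    (hm : ∀ b, b ≠ a → m b = m' b) : e.eval m = e.eval m' := by
  induction e with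
  | const k => rfl
  | get b e ih =>
    simp only [Expr.avoids, bne_iff_ne, ne_eq, Bool.and_eq_true] at h
    rw [Expr.eval, Expr.eval, ih h.2, hm b h.1]
  | add e f he hf =>
    simp only [Expr.avoids, Bool.and_eq_true] at h
    rw [Expr.eval, Expr.eval, he h.1, hf h.2]
  | sub e f he hf =>
    simp only [Expr.avoids, Bool.and_eq_true] at h
    rw [Expr.eval, Expr.eval, he h.1, hf h.2]

theorem Mem.write_of_ne (m : Mem) {a b : ℕ} (i v : ℕ) (h : b ≠ a) : m.write a i v b = m b := by
  simp [Mem.write, h]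

theorem Mem.write_apply (m : Mem) (a i v j : ℕ) :
    m.write a i v a j = if j = i then v else m a j := by
  simp [Mem.write, Function.update_apply]

/-- The loop counters are the only difference between `m` and `m'`, and the program neither reads
nor writes their array. The counter at depth `d` is cell `d`, so inner loops leave the outer
counters alone. -/
theorem LProg.compile_runs {N : ℕ} {p : LProg} (h2 : p.keeps 2 = true) (h3 : p.keeps 3 = true)
    (ha : p.avoids 3 = true) (d : ℕ) (m m' : Mem) (hN : m 2 0 = N)
    (hm : ∀ b, b ≠ 3 → m b = m' b) :
    ∃ t ≤ p.cost.eval N, ∃ m'', Runs (p.compile d) m' t m'' ∧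
      (∀ b, b ≠ 3 → p.run N m b = m'' b) ∧ ∀ i < d, m'' 3 i = m' 3 i := by
  induction p generalizing d m m' with
  | skip => exact ⟨0, by simp, m', .skip m', hm, fun _ _ => rfl⟩
  | assign a e f =>
    simp only [keeps, bne_iff_ne, ne_eq] at h3
    simp only [avoids, Bool.and_eq_true] at ha
    refine ⟨1, by simp [cost], _, .assign a e f m', fun b hb => ?_, fun i _ => ?_⟩
    · rw [run, Expr.eval_of_avoids ha.1 hm, Expr.eval_of_avoids ha.2 hm]
      by_cases hba : b = a
      · subst hba
        simp [Mem.write, hm b hb]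
      · rw [Mem.write_of_ne _ _ _ hba, Mem.write_of_ne _ _ _ hba, hm b hb]
    · rw [Mem.write_of_ne _ _ _ (Ne.symm h3)]
  | seq p q hp hq =>
    simp only [keeps, Bool.and_eq_true] at h2 h3
    simp only [avoids, Bool.and_eq_true] at ha
    obtain ⟨s, hs, m1, r1, e1, k1⟩ := hp h2.1 h3.1 ha.1 d m m' hN hm
    obtain ⟨t, ht, m2, r2, e2, k2⟩ := hq h2.2 h3.2 ha.2 d (p.run N m) m1
      (by rw [run_of_keeps h2.1, hN]) e1
    refine ⟨s + t, ?_, m2, .seq r1 r2, e2, fun i hi => (k2 i hi).trans (k1 i hi)⟩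
    rw [cost, Polynomial.eval_add]
    omega
  | ite e p q hp hq =>
    simp only [keeps, Bool.and_eq_true] at h2 h3
    simp only [avoids, Bool.and_eq_true] at ha
    rw [cost, Polynomial.eval_add, Polynomial.eval_add, Polynomial.eval_one, run]
    have he := Expr.eval_of_avoids ha.1.1 hm
    split_ifs with hc
    · obtain ⟨s, hs, m1, r1, e1, k1⟩ := hp h2.1 h3.1 ha.1.2 d m m' hN hm
      exact ⟨s + 1, by omega, m1, .ite_true (he ▸ hc) r1, e1, k1⟩
    · obtain ⟨s, hs, m1, r1, e1, k1⟩ := hq h2.2 h3.2 ha.2 d m m' hN hm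
      exact ⟨s + 1, by omega, m1, .ite_false (by rw [← he]; simpa using hc) r1, e1, k1⟩
  | rep p ih =>
    have loop : ∀ (k : ℕ) (m m' : Mem), m 2 0 = N → (∀ b, b ≠ 3 → m b = m' b) → m' 3 d = k →
        ∃ t ≤ k * (p.cost.eval N + 2) + 1, ∃ m'', Runs (.loop (.get 3 (.const d))
          (.seq (.assign 3 (.const d) (.sub (.get 3 (.const d)) (.const 1)))
            (p.compile (d + 1)))) m' t m'' ∧
          (∀ b, b ≠ 3 → (p.run N)^[k] m b = m'' b) ∧ ∀ i < d, m'' 3 i = m' 3 i := by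
      intro k
      induction k with
      | zero =>
        intro m m' _ hm hk
        exact ⟨1, by omega, m', .loop_done (by simpa [Expr.eval] using hk), hm, fun _ _ => rfl⟩
      | succ k ihk =>
        intro m m' hN hm hk
        set m0 := m'.write 3 d k with hm0
        have r0 : Runs (.assign 3 (.const d) (.sub (.get 3 (.const d)) (.const 1))) m' 1 m0 := by
          have := Runs.assign 3 (.const d) (.sub (.get 3 (.const d)) (.const 1)) m'
          simpa [Expr.eval, hk] using this
        obtain ⟨s, hs, m1, r1, e1, k1⟩ := ih h2 h3 ha (d + 1) m m0 hN
          (fun b hb => by rw [hm0, Mem.write_of_ne _ _ _ hb, hm b hb])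
        obtain ⟨t, ht, m2, r2, e2, k2⟩ := ihk (p.run N m) m1
          (by rw [run_of_keeps (p := p) h2, hN]) e1 (by rw [k1 d (by omega), hm0, Mem.write_apply, if_pos rfl])
        -- One step decrements the counter and one tests it, which is the `2` inside the product in
        -- `cost`.
        refine ⟨1 + s + t + 1, ?_, m2, .loop_step (by simp [Expr.eval, hk]) (.seq r0 r1) r2, ?_,
          fun i hi => ?_⟩
        · rw [add_mul, one_mul]
          omega
        · simpa only [Function.iterate_succ_apply] using e2
        · rw [k2 i hi, k1 i (by omega), hm0, Mem.write_apply, if_neg (by omega)]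
    obtain ⟨t, ht, m1, r1, e1, k1⟩ := loop N m (m'.write 3 d N) hN
      (fun b hb => by rw [Mem.write_of_ne _ _ _ hb, hm b hb])
      (by rw [Mem.write_apply, if_pos rfl])
    refine ⟨1 + t, ?_, m1, .seq ?_ r1, e1, fun i hi => ?_⟩
    · rw [cost, Polynomial.eval_add, Polynomial.eval_mul, Polynomial.eval_X, Polynomial.eval_add,
        Polynomial.eval_ofNat]
      omega
    · have := Runs.assign 3 (.const d) (.get 2 (.const 0)) m'
      simpa [Expr.eval, ← hm 2 (by decide), hN] using this
    · rw [k1 i hi, Mem.write_apply, if_neg (by omega)]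

namespace LProg

/-- Repeat `p` while `e` is nonzero, at most `N ^ 3` times. -/
def loop (e : Expr) (p : LProg) : LProg := rep (rep (rep (ite e p skip)))

/-- `P c m` is an invariant saying that exactly `c` passes are left. When none is left, the
condition fails and the superfluous repetitions are idle. -/
theorem run_loop {N : ℕ} {e : Expr} {p : LProg} (P : ℕ → Mem → Prop)
    (h : ∀ c m, P (c + 1) m → e.eval m ≠ 0 ∧ P c (p.run N m)) (h0 : ∀ m, P 0 m → e.eval m = 0)
    {c : ℕ} (hc : c ≤ N ^ 3) {m : Mem} (hm : P c m) : P 0 ((loop e p).run N m) := by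
  have hrun : (loop e p).run N m = ((ite e p skip).run N)^[N ^ 3] m := by
    have h1 : ∀ q : LProg, (rep q).run N = (q.run N)^[N] := fun q => rfl
    have h2 : N ^ 3 = N * N * N := by ring
    rw [loop, h1, h1, h1, h2, Function.iterate_mul, Function.iterate_mul]
  have key : ∀ k c m, c ≤ k → P c m → P 0 (((ite e p skip).run N)^[k] m) := by
    intro k
    induction k with
    | zero =>
      intro c m hc hm
      rw [Nat.le_zero.mp hc] at hm
      exact hm
    | succ k ih =>
      intro c m hc hm
      rw [Function.iterate_succ_apply]
      cases c with
      | zero =>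
        refine ih 0 _ (by omega) ?_
        rw [run, if_neg (by simpa using h0 m hm)]
        exact hm
      | succ c =>
        refine ih c _ (by omega) ?_
        rw [run, if_pos (h c m hm).1]
        exact (h c m hm).2
  rw [hrun]
  exact key _ c m hc hm

end LProg

/-! ### Building blocks of the program

Every variable is cell `0` of an array of its own. Array `0` is the input and array `1` the output,
arrays `4` and `5` hold the two circuits `St.r` and `St.l` (as stacks, with the numbers of gates in
variables `9` and `10`), and arrays `6`, `7` and variable `12` hold a Pauli operator. Variables `8`
and `13` to `16` are used to traverse circuits, variables `18` and `19` are the indices `k` and `j`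
of the sweeps, and variables `20` to `29` hold `view`. -/

namespace LProg

/-- The value of a variable. -/
def var (a : ℕ) : Expr := .get a (.const 0)

/-- Assignment to a variable. -/
def set (a : ℕ) (e : Expr) : LProg := assign a (.const 0) e

/-- Exclusive or of bits; the value is nonzero if and only if the numbers differ. -/
def xor (e f : Expr) : Expr := .add (.sub e f) (.sub f e)

/-- Conjunction of bits. -/
def and (e f : Expr) : Expr := .sub (.add e f) (.const 1)

/-- Add `e` to the exponent of `i`, modulo `4`. -/
def addPhase (e : Expr) : LProg :=
  seq (set 12 (.add (var 12) e))
    (ite (.sub (var 12) (.const 3)) (set 12 (.sub (var 12) (.const 4))) skip)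

/-- Apply the gate in variables `14` to `16`, or its inverse, to the stored Pauli operator. -/
def applyGate (inv : Bool) : LProg :=
  let xa := Expr.get 6 (var 15)
  let xb := Expr.get 6 (var 16)
  let za := Expr.get 7 (var 15)
  let zb := Expr.get 7 (var 16)
  let had := seq (addPhase (.add (and xa za) (and xa za)))
    (seq (set 17 xa) (seq (assign 6 (var 15) za) (assign 7 (var 15) (var 17))))
  let phase := seq (addPhase (if inv then .add (.add xa xa) xa else xa))
    (assign 7 (var 15) (xor za xa))
  let cnot := seq (assign 6 (var 16) (xor xb xa)) (assign 7 (var 15) (xor za zb))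
  let cphase := seq (addPhase (.add (and xa xb) (and xa xb)))
    (seq (assign 7 (var 15) (xor za xb)) (assign 7 (var 16) (xor zb xa)))
  let flip := addPhase (.add za za)
  ite (var 14)
    (ite (.sub (var 14) (.const 1))
      (ite (.sub (var 14) (.const 2))
        (ite (.sub (var 14) (.const 3)) flip cphase) cnot) phase) had

end LProg

/-- The first entry of the code of a gate. -/
def Gate.kind : Gate n → ℕ
  | .hadamard _ => 0
  | .phase _ => 1
  | .cnot _ _ _ => 2
  | .cphase _ _ _ => 3
  | .not _ => 4

/-- The second entry of the code of a gate. -/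
def Gate.fst : Gate n → ℕ
  | .hadamard i | .phase i | .not i | .cnot i _ _ | .cphase i _ _ => i

/-- The third entry of the code of a gate. -/
def Gate.snd : Gate n → ℕ
  | .hadamard _ | .phase _ | .not _ => 0
  | .cnot _ j _ | .cphase _ j _ => j

theorem Gate.code_eq (g : Gate n) : g.code = [g.kind, g.fst, g.snd] := by
  cases g <;> rfl

/-- The gate in variables `14` to `16` is `g`. -/
def GateAt (g : Gate n) (m : Mem) : Prop := m 14 0 = g.kind ∧ m 15 0 = g.fst ∧ m 16 0 = g.snd

/-- The stored Pauli operator is `v`. -/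
def Stored (v : PV n) (m : Mem) : Prop :=
  (∀ i : Fin n, m 6 i = (v.x i).val) ∧ (∀ i : Fin n, m 7 i = (v.z i).val) ∧ m 12 0 = v.ph.val

theorem Stored.congr {v : PV n} {m m' : Mem} (h : Stored v m)
    (hm : ∀ b, b = 6 ∨ b = 7 ∨ b = 12 → m' b = m b) : Stored v m' := by
  unfold Stored
  rw [hm 6 (by simp), hm 7 (by simp), hm 12 (by simp)]
  exact h

/-- This and the next lemmas express arithmetic in `ℤ/2` and `ℤ/4` by the operations of the machine,
addition and truncated subtraction. -/
theorem val_add_zmod2 : ∀ a b : ZMod 2, (a + b).val = a.val - b.val + (b.val - a.val) := by decide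

theorem val_mul_zmod2 : ∀ a b : ZMod 2, (a * b).val = a.val + b.val - 1 := by decide

theorem val_add_two : ∀ (a : ZMod 4) (b : ZMod 2), (a + two b).val =
    if a.val + (b.val + b.val) - 3 ≠ 0 then a.val + (b.val + b.val) - 4
    else a.val + (b.val + b.val) := by decide

theorem val_add_val : ∀ (a : ZMod 4) (b : ZMod 2), (a + (b.val : ZMod 4)).val =
    if a.val + b.val - 3 ≠ 0 then a.val + b.val - 4 else a.val + b.val := by decide

theorem val_add_three_val : ∀ (a : ZMod 4) (b : ZMod 2), (a + 3 * (b.val : ZMod 4)).val =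
    if a.val + (b.val + b.val + b.val) - 3 ≠ 0 then a.val + (b.val + b.val + b.val) - 4
    else a.val + (b.val + b.val + b.val) := by decide

open LProg

theorem run_addPhase (N : ℕ) (e : Expr) (m : Mem) :
    (addPhase e).run N m = m.write 12 0 (if m 12 0 + e.eval m - 3 ≠ 0 then m 12 0 + e.eval m - 4
      else m 12 0 + e.eval m) := by
  have h : ∀ a b, (m.write 12 0 a).write 12 0 b = m.write 12 0 b := by
    intro a b
    simp [Mem.write]
  simp only [addPhase, LProg.run, LProg.set, var, Expr.eval, Mem.write_apply, if_true]
  split_ifs <;> simp [h]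

theorem stored_applyGate {N : ℕ} {inv : Bool} {g : Gate n} {v : PV n} {m : Mem}
    (hv : Stored v m) (hg : GateAt g m) :
    Stored (g.act inv v) ((applyGate inv).run N m) := by
  obtain ⟨hx, hz, hp⟩ := hv
  obtain ⟨h1, h2, h3⟩ := hg
  cases g with
  | hadamard i =>
    simp only [Gate.kind, Gate.fst, Gate.snd] at h1 h2 h3
    simp only [applyGate, LProg.run, run_addPhase, LProg.set, LProg.and, var, Expr.eval, h1,
      Mem.write_of_ne, ne_eq, Nat.reduceEqDiff, not_false_eq_true, not_true_eq_false, if_false,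
      Mem.write_apply, if_true, h2, hx, hz, hp]
    refine ⟨fun k => ?_, fun k => ?_, ?_⟩
    · simp [Mem.write_of_ne, Mem.write_apply, Gate.act, Function.update_apply, Fin.val_inj, hx]
      split_ifs <;> rfl
    · simp [Mem.write_of_ne, Mem.write_apply, Gate.act, Function.update_apply, Fin.val_inj, hz]
      split_ifs <;> rfl
    · simp [Mem.write_of_ne, Mem.write_apply, Gate.act, val_add_two, val_mul_zmod2]
  | phase i =>
    simp only [Gate.kind, Gate.fst, Gate.snd] at h1 h2 h3
    simp only [applyGate, LProg.run, run_addPhase, LProg.xor, var, Expr.eval, h1,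
      Mem.write_of_ne, ne_eq, Nat.reduceEqDiff, not_false_eq_true, not_true_eq_false, if_false,
      if_true, h2, hx, hz, hp, one_ne_zero, Nat.sub_self]
    refine ⟨fun k => ?_, fun k => ?_, ?_⟩
    · simp [Mem.write_of_ne, Gate.act, hx]
    · simp [Mem.write_of_ne, Mem.write_apply, Gate.act, Function.update_apply, Fin.val_inj, hz,
        apply_ite ZMod.val, val_add_zmod2]
    · cases inv
      · simp only [Gate.act, Bool.false_eq_true, if_false, one_mul, val_add_val]
        simp [Mem.write_of_ne, Mem.write_apply, Expr.eval, h2, hx]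
      · simp only [Gate.act, if_true, val_add_three_val]
        simp [Mem.write_of_ne, Mem.write_apply, Expr.eval, h2, hx]
  | not i =>
    simp only [Gate.kind, Gate.fst, Gate.snd] at h1 h2 h3
    simp only [applyGate, LProg.run, run_addPhase, var, Expr.eval, h1,
      ne_eq, not_false_eq_true, Nat.reduceSub, if_true, h2, hz, hp, one_ne_zero, OfNat.ofNat_ne_zero]
    refine ⟨fun k => ?_, fun k => ?_, ?_⟩
    · simp [Mem.write_of_ne, Gate.act, hx]
    · simp [Mem.write_of_ne, Gate.act, hz]
    · simp [Mem.write_apply, Gate.act, val_add_two]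
  | cnot i j h =>
    simp only [Gate.kind, Gate.fst, Gate.snd] at h1 h2 h3
    simp only [applyGate, LProg.run, LProg.xor, var, Expr.eval, h1,
      Mem.write_of_ne, ne_eq, Nat.reduceEqDiff, not_false_eq_true, not_true_eq_false, if_false,
      Nat.reduceSub, if_true, h2, h3, hx, hz, one_ne_zero, OfNat.ofNat_ne_zero]
    refine ⟨fun k => ?_, fun k => ?_, ?_⟩
    · simp [Mem.write_of_ne, Mem.write_apply, Gate.act, Function.update_apply, Fin.val_inj, hx,
        apply_ite ZMod.val, val_add_zmod2]
    · simp [Mem.write_of_ne, Mem.write_apply, Gate.act, Function.update_apply, Fin.val_inj, hz,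
        apply_ite ZMod.val, val_add_zmod2]
    · simp [Mem.write_of_ne, Gate.act, hp]
  | cphase i j h =>
    simp only [Gate.kind, Gate.fst, Gate.snd] at h1 h2 h3
    -- The second `Z` entry is read after the first has been overwritten, so the cells must be
    -- distinct.
    have hij : ¬ (j : ℕ) = i := fun e => h (Fin.ext e.symm)
    simp only [applyGate, LProg.run, run_addPhase, LProg.xor, LProg.and, var, Expr.eval, h1,
      Mem.write_of_ne, ne_eq, Nat.reduceEqDiff, not_false_eq_true, not_true_eq_false, if_false,
      Nat.reduceSub, if_true, h2, h3, hx, hz, hp, one_ne_zero, OfNat.ofNat_ne_zero,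
      Mem.write_apply, hij]
    refine ⟨fun k => ?_, fun k => ?_, ?_⟩
    · simp [Mem.write_of_ne, Gate.act, hx]
    · simp [Mem.write_of_ne, Mem.write_apply, Gate.act, Function.update_apply, Fin.val_inj, hz,
        apply_ite ZMod.val, val_add_zmod2]
    · simp [Mem.write_of_ne, Mem.write_apply, Gate.act, val_add_two, val_mul_zmod2]

/-! ### Traversing circuits -/

namespace LProg

/-- Copy the gate at position `8` of array `arr` to variables `14` to `16`. -/
def readGate (arr : ℕ) : LProg :=
  seq (set 14 (.get arr (var 8))) (seq (set 15 (.get arr (.add (var 8) (.const 1))))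
    (set 16 (.get arr (.add (var 8) (.const 2)))))

/-- Run `p` on each of the `len` gates that start at position `start` of array `arr`. -/
def forward (arr start : ℕ) (len : Expr) (p : LProg) : LProg :=
  seq (set 8 (.const start)) (seq (set 13 len) (loop (var 13)
    (seq (readGate arr) (seq p (seq (set 8 (.add (var 8) (.const 3)))
      (set 13 (.sub (var 13) (.const 1))))))))

/-- Run `p` on each of the `len` gates that start at position `0` of array `arr`, the last gate
first. -/
def backward (arr : ℕ) (len : Expr) (p : LProg) : LProg :=
  seq (set 13 len) (seq (set 8 (.add (.add (var 13) (var 13)) (var 13))) (loop (var 13)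
    (seq (set 8 (.sub (var 8) (.const 3))) (seq (readGate arr) (seq p
      (set 13 (.sub (var 13) (.const 1))))))))

end LProg

/-- The array `c` holds the given gates from position `p` on. -/
def ListAt (c : ℕ → ℕ) : ℕ → List (Gate n) → Prop
  | _, [] => True
  | p, g :: C => c p = g.kind ∧ c (p + 1) = g.fst ∧ c (p + 2) = g.snd ∧ ListAt c (p + 3) C

/-- The array `c` holds the given gates in reverse order from position `0` on. -/
def StackAt (c : ℕ → ℕ) : List (Gate n) → Prop
  | [] => True
  | g :: L => c (3 * L.length) = g.kind ∧ c (3 * L.length + 1) = g.fst ∧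
    c (3 * L.length + 2) = g.snd ∧ StackAt c L

theorem ListAt.append {c : ℕ → ℕ} {C D : List (Gate n)} {p : ℕ} (hC : ListAt c p C)
    (hD : ListAt c (p + 3 * C.length) D) : ListAt c p (C ++ D) := by
  induction C generalizing p with
  | nil => exact hD
  | cons g C ih =>
    refine ⟨hC.1, hC.2.1, hC.2.2.1, ih hC.2.2.2 ?_⟩
    have : p + 3 + 3 * C.length = p + 3 * (g :: C).length := by
      rw [List.length_cons]
      omega
    rwa [this]

theorem StackAt.listAt_reverse {c : ℕ → ℕ} {L : List (Gate n)} (h : StackAt c L) :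
    ListAt c 0 L.reverse := by
  induction L with
  | nil => trivial
  | cons g L ih =>
    rw [List.reverse_cons]
    refine (ih h.2.2.2).append ?_
    rw [List.length_reverse, zero_add]
    exact ⟨h.1, h.2.1, h.2.2.1, trivial⟩

theorem StackAt.congr {c c' : ℕ → ℕ} {L : List (Gate n)} (h : StackAt c L)
    (hc : ∀ i < 3 * L.length, c' i = c i) : StackAt c' L := by
  induction L with
  | nil => trivial
  | cons g L ih =>
    rw [List.length_cons] at hc
    refine ⟨?_, ?_, ?_, ih h.2.2.2 fun i hi => hc i (by omega)⟩
    · rw [hc _ (by omega), h.1]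
    · rw [hc _ (by omega), h.2.1]
    · rw [hc _ (by omega), h.2.2.1]

/-- The variables that are used to traverse circuits. -/
def traversal : List ℕ := [8, 13, 14, 15, 16]

theorem run_readGate {N arr : ℕ} (harr : arr ∉ traversal) (m : Mem) :
    ((readGate arr).run N m 14 0 = m arr (m 8 0) ∧
      (readGate arr).run N m 15 0 = m arr (m 8 0 + 1) ∧
      (readGate arr).run N m 16 0 = m arr (m 8 0 + 2)) ∧
    ∀ b, b ≠ 14 → b ≠ 15 → b ≠ 16 → (readGate arr).run N m b = m b := by
  simp only [traversal, List.mem_cons, List.not_mem_nil, or_false, not_or] at harr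
  refine ⟨?_, fun b h1 h2 h3 => ?_⟩
  · simp [readGate, LProg.run, LProg.set, var, Expr.eval, Mem.write_of_ne, Mem.write_apply, harr]
  · simp [readGate, LProg.run, LProg.set, Mem.write_of_ne, h1, h2, h3]

section Traversal

variable {α : Type*} {N arr : ℕ} {p : LProg} (Q : α → Mem → Prop) (s : α → Gate n → α)

/-- Invariant: folding over the gates `C'` still ahead, from the current state `a'`, gives the final
result. `hlen` mentions a write to variable `8` because that variable is set before `len` is
evaluated. -/
theorem run_forward {start : ℕ} {len : Expr} (harr : arr ∉ traversal)
    (hp8 : p.keeps 8 = true) (hp13 : p.keeps 13 = true) (hparr : p.keeps arr = true)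
    (hQ : ∀ a m m', (∀ b, b ∉ traversal → m' b = m b) → Q a m → Q a m')
    (hbody : ∀ a g m, Q a m → GateAt g m → Q (s a g) (p.run N m))
    {C : List (Gate n)} (hC : C.length ≤ N ^ 3) {a : α} {m : Mem} (hm : Q a m)
    (hlen : ∀ k, len.eval (m.write 8 0 k) = C.length) (hlist : ListAt (m arr) start C) :
    Q (C.foldl s a) ((forward arr start len p).run N m) := by
  have harr' := harr
  simp only [traversal, List.mem_cons, List.not_mem_nil, or_false, not_or] at harr
  have key := run_loop (N := N) (e := var 13) (p := seq (readGate arr) (seq p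
      (seq (set 8 (.add (var 8) (.const 3))) (set 13 (.sub (var 13) (.const 1))))))
    (fun c m => ∃ C' a', C'.length = c ∧ m 13 0 = c ∧ ListAt (m arr) (m 8 0) C' ∧ Q a' m ∧
      C'.foldl s a' = C.foldl s a) ?_ ?_ hC
      (m := (m.write 8 0 start).write 13 0 C.length) ?_
  · obtain ⟨C', a', h1, -, -, h2, h3⟩ := key
    rw [List.length_eq_zero_iff] at h1
    subst h1
    rw [← h3]
    simpa [forward, LProg.run, LProg.set, Expr.eval, hlen] using h2
  · rintro c m ⟨C', a', h1, h2, h3, h4, h5⟩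
    refine ⟨by simp [var, Expr.eval, h2], ?_⟩
    obtain _ | ⟨g, C'⟩ := C'
    · simp at h1
    obtain ⟨⟨r1, r2, r3⟩, r4⟩ := run_readGate (N := N) harr' m
    obtain ⟨l1, l2, l3, l4⟩ := h3
    simp only [LProg.run]
    set m1 := (readGate arr).run N m
    have q1 : Q (s a' g) (p.run N m1) := by
      refine hbody _ _ _ (hQ _ _ _ (fun b hb => ?_) h4) ⟨by rw [r1, l1], by rw [r2, l2],
        by rw [r3, l3]⟩
      simp only [traversal, List.mem_cons, List.not_mem_nil, or_false, not_or] at hb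
      exact r4 b hb.2.2.1 hb.2.2.2.1 hb.2.2.2.2
    have e8 : p.run N m1 8 = m 8 := by rw [run_of_keeps hp8, r4 8] <;> simp
    have e13 : p.run N m1 13 = m 13 := by rw [run_of_keeps hp13, r4 13] <;> simp
    have earr : p.run N m1 arr = m arr := by
      rw [run_of_keeps hparr, r4 arr harr.2.2.1 harr.2.2.2.1 harr.2.2.2.2]
    refine ⟨C', s a' g, by simpa using h1, ?_, ?_, hQ _ _ _ (fun b hb => ?_) q1, h5⟩
    · simp [LProg.run, LProg.set, var, Expr.eval, Mem.write_apply, Mem.write_of_ne, e13, h2]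
    · simpa [LProg.run, LProg.set, var, Expr.eval, Mem.write_apply, Mem.write_of_ne, harr, earr, e8]
        using l4
    · simp only [traversal, List.mem_cons, List.not_mem_nil, or_false, not_or] at hb
      simp [LProg.run, LProg.set, Mem.write_of_ne, hb]
  · rintro m ⟨C', a', h1, h2, -⟩
    simpa [var, Expr.eval] using h2
  · refine ⟨C, a, rfl, by simp [Mem.write_apply], ?_, hQ _ _ _ (fun b hb => ?_) hm, rfl⟩
    · simpa [Mem.write_of_ne, Mem.write_apply, harr] using hlist
    · simp only [traversal, List.mem_cons, List.not_mem_nil, or_false, not_or] at hb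
      simp [Mem.write_of_ne, hb]

/-- Same invariant as in `run_forward`; variable `8` points just above the remaining stack, whose
top is the head of the list. -/
theorem run_backward {len : Expr} (harr : arr ∉ traversal)
    (hp8 : p.keeps 8 = true) (hp13 : p.keeps 13 = true) (hparr : p.keeps arr = true)
    (hQ : ∀ a m m', (∀ b, b ∉ traversal → m' b = m b) → Q a m → Q a m')
    (hbody : ∀ a g m, Q a m → GateAt g m → Q (s a g) (p.run N m))
    {L : List (Gate n)} (hL : L.length ≤ N ^ 3) {a : α} {m : Mem} (hm : Q a m)
    (hlen : len.eval m = L.length) (hlist : StackAt (m arr) L) :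
    Q (L.foldl s a) ((backward arr len p).run N m) := by
  have harr' := harr
  simp only [traversal, List.mem_cons, List.not_mem_nil, or_false, not_or] at harr
  have key := run_loop (N := N) (e := var 13) (p := seq (set 8 (.sub (var 8) (.const 3)))
      (seq (readGate arr) (seq p (set 13 (.sub (var 13) (.const 1))))))
    (fun c m => ∃ L' a', L'.length = c ∧ m 13 0 = c ∧ m 8 0 = 3 * c ∧ StackAt (m arr) L' ∧
      Q a' m ∧ L'.foldl s a' = L.foldl s a) ?_ ?_ hL
      (m := (m.write 13 0 L.length).write 8 0 (3 * L.length)) ?_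
  · obtain ⟨L', a', h1, -, -, -, h2, h3⟩ := key
    rw [List.length_eq_zero_iff] at h1
    subst h1
    have h3L : L.length + L.length + L.length = 3 * L.length := by omega
    rw [← h3]
    simpa [backward, LProg.run, LProg.set, var, Expr.eval, hlen, Mem.write_apply, h3L] using h2
  · rintro c m ⟨L', a', h1, h2, h8, h3, h4, h5⟩
    refine ⟨by simp [var, Expr.eval, h2], ?_⟩
    obtain _ | ⟨g, L'⟩ := L'
    · simp at h1
    have h1' : L'.length = c := by simpa using h1
    set m0 := m.write 8 0 (3 * c) with hm0
    have hm0' : (set 8 (.sub (var 8) (.const 3))).run N m = m0 := by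
      have : 3 * (c + 1) - 3 = 3 * c := by omega
      simp [LProg.run, LProg.set, var, Expr.eval, h8, this, hm0]
    obtain ⟨⟨r1, r2, r3⟩, r4⟩ := run_readGate (N := N) harr' m0
    have e80 : m0 8 0 = 3 * c := by rw [hm0, Mem.write_apply, if_pos rfl]
    have earr0 : m0 arr = m arr := by rw [hm0, Mem.write_of_ne _ _ _ harr.1]
    rw [earr0, e80] at r1 r2 r3
    obtain ⟨l1, l2, l3, l4⟩ := h3
    rw [h1'] at l1 l2 l3
    simp only [LProg.run] at hm0' ⊢
    rw [hm0']
    set m1 := (readGate arr).run N m0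
    have q1 : Q (s a' g) (p.run N m1) := by
      refine hbody _ _ _ (hQ _ _ _ (fun b hb => ?_) h4) ⟨by rw [r1, l1], by rw [r2, l2],
        by rw [r3, l3]⟩
      simp only [traversal, List.mem_cons, List.not_mem_nil, or_false, not_or] at hb
      rw [r4 b hb.2.2.1 hb.2.2.2.1 hb.2.2.2.2, hm0, Mem.write_of_ne _ _ _ hb.1]
    have e8 : p.run N m1 8 = m0 8 := by rw [run_of_keeps hp8, r4 8] <;> simp
    have e13 : p.run N m1 13 = m 13 := by
      rw [run_of_keeps hp13, r4 13, hm0, Mem.write_of_ne] <;> simp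
    have earr : p.run N m1 arr = m arr := by
      rw [run_of_keeps hparr, r4 arr harr.2.2.1 harr.2.2.2.1 harr.2.2.2.2, earr0]
    refine ⟨L', s a' g, h1', ?_, ?_, ?_, hQ _ _ _ (fun b hb => ?_) q1, h5⟩
    · simp [LProg.run, LProg.set, var, Expr.eval, Mem.write_apply, e13, h2]
    · simp [LProg.run, LProg.set, Mem.write_of_ne, e8, e80]
    · simpa [LProg.run, LProg.set, Mem.write_of_ne, harr, earr] using l4
    · simp only [traversal, List.mem_cons, List.not_mem_nil, or_false, not_or] at hb
      simp [LProg.run, LProg.set, Mem.write_of_ne, hb]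
  · rintro m ⟨C', a', h1, h2, -⟩
    simpa [var, Expr.eval] using h2
  · refine ⟨L, a, rfl, by simp [Mem.write_apply, Mem.write_of_ne], by simp [Mem.write_apply], ?_,
      hQ _ _ _ (fun b hb => ?_) hm, rfl⟩
    · simpa [Mem.write_of_ne, harr] using hlist
    · simp only [traversal, List.mem_cons, List.not_mem_nil, or_false, not_or] at hb
      simp [Mem.write_of_ne, hb]

end Traversal

/-! ### The program -/

/-- The action of a circuit on Pauli operators. -/
def circuitAut (C : Circuit n) (v : PV n) : PV n := C.foldl (fun v g => g.act false v) v

/-- The memory holds the input circuit `C` and the two circuits of `σ`. -/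
structure Holds (C : Circuit n) (σ : St n) (m : Mem) : Prop where
  qubits : m 0 1 = n
  gates : m 0 2 = C.length
  input : ListAt (m 0) 3 C
  rlen : m 9 0 = σ.r.length
  llen : m 10 0 = σ.l.length
  r : StackAt (m 4) σ.r
  l : StackAt (m 5) σ.l

/-- The arrays that `Holds` refers to. -/
def mainArrays : List ℕ := [0, 4, 5, 9, 10]

theorem Holds.congr {C : Circuit n} {σ : St n} {m m' : Mem} (h : Holds C σ m)
    (hm : ∀ b ∈ mainArrays, m' b = m b) : Holds C σ m' := by
  have h0 := hm 0 (by simp [mainArrays])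
  have h4 := hm 4 (by simp [mainArrays])
  have h5 := hm 5 (by simp [mainArrays])
  have h9 := hm 9 (by simp [mainArrays])
  have h10 := hm 10 (by simp [mainArrays])
  refine ⟨?_, ?_, ?_, ?_, ?_, ?_, ?_⟩
  · rw [h0, h.qubits]
  · rw [h0, h.gates]
  · rw [h0]
    exact h.input
  · rw [h9, h.rlen]
  · rw [h10, h.llen]
  · rw [h4]
    exact h.r
  · rw [h5]
    exact h.l

namespace LProg

/-- Make the stored Pauli operator zero. -/
def clear : LProg :=
  seq (set 30 (.get 0 (.const 1))) (seq (loop (var 30) (seq (set 30 (.sub (var 30) (.const 1)))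
    (seq (assign 6 (var 30) (.const 0)) (assign 7 (var 30) (.const 0))))) (set 12 (.const 0)))

/-- Compute the image of the generator `X i` or `Z i`, where `i` is the value of variable `a`,
under what remains of the input. -/
def query (isX : Bool) (a : ℕ) : LProg :=
  seq clear (seq (assign (if isX then 6 else 7) (var a) (.const 1))
    (seq (backward 4 (var 9) (applyGate true))
      (seq (forward 0 3 (.get 0 (.const 2)) (applyGate false))
        (forward 5 0 (var 10) (applyGate true)))))

end LProg

/-- The arrays that `query` writes to. -/
def scratch : List ℕ := [6, 7, 8, 12, 13, 14, 15, 16, 17, 30]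

theorem query_keeps (isX : Bool) (a b : ℕ) (hb : b ∉ scratch) :
    (query isX a).keeps b = true := by
  simp only [scratch, List.mem_cons, List.not_mem_nil, or_false, not_or] at hb
  obtain ⟨h1, h2, h3, h4, h5, h6, h7, h8, h9, h10⟩ := hb
  cases isX <;>
    simp [query, clear, backward, forward, applyGate, addPhase, readGate, LProg.set, loop, keeps,
      Ne.symm h1, Ne.symm h2, Ne.symm h3, Ne.symm h4, Ne.symm h5, Ne.symm h6, Ne.symm h7,
      Ne.symm h8, Ne.symm h9, Ne.symm h10]

theorem run_query_of_notMem (N : ℕ) (isX : Bool) (a b : ℕ) (hb : b ∉ scratch) (m : Mem) :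
    (query isX a).run N m b = m b := run_of_keeps (query_keeps isX a b hb) m

theorem stored_clear {N : ℕ} {m : Mem} (hn : m 0 1 = n) (hN : n ≤ N ^ 3) :
    Stored (⟨0, 0, 0⟩ : PV n) (clear.run N m) := by
  have key := run_loop (N := N) (e := var 30) (p := seq (set 30 (.sub (var 30) (.const 1)))
      (seq (assign 6 (var 30) (.const 0)) (assign 7 (var 30) (.const 0))))
    (fun c m => m 30 0 = c ∧ ∀ i, c ≤ i → i < n → m 6 i = 0 ∧ m 7 i = 0) ?_ ?_ hN
      (m := m.write 30 0 n) ?_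
  · refine ⟨fun i => ?_, fun i => ?_, ?_⟩
    · simpa [clear, LProg.run, LProg.set, Expr.eval, Mem.write_of_ne, hn]
        using (key.2 i (by omega) i.2).1
    · simpa [clear, LProg.run, LProg.set, Expr.eval, Mem.write_of_ne, hn]
        using (key.2 i (by omega) i.2).2
    · simp [clear, LProg.run, LProg.set, Expr.eval, Mem.write_apply]
  · rintro c m ⟨h1, h2⟩
    refine ⟨by simp [var, Expr.eval, h1], ?_, fun i hi hin => ?_⟩
    · simp [LProg.run, LProg.set, var, Expr.eval, Mem.write_of_ne, Mem.write_apply, h1]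
    · have h3 : i ≠ c → m 6 i = 0 ∧ m 7 i = 0 := fun h => h2 i (by omega) hin
      by_cases hic : i = c
      · simp [LProg.run, LProg.set, var, Expr.eval, Mem.write_of_ne, Mem.write_apply, h1, hic]
      · simp [LProg.run, LProg.set, var, Expr.eval, Mem.write_of_ne, Mem.write_apply, h1, hic,
          h3 hic]
  · rintro m ⟨h, -⟩
    simpa [var, Expr.eval] using h
  · refine ⟨by simp [Mem.write_apply], fun i hi hin => absurd hin (by omega)⟩

/-- The generator `X i` or `Z i`. -/
def gen (isX : Bool) (i : Fin n) : PV n := if isX then .X i else .Z i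

theorem stored_gen {m : Mem} (h : Stored (⟨0, 0, 0⟩ : PV n) m) (isX : Bool) (i : Fin n) :
    Stored (gen isX i) (m.write (if isX then 6 else 7) i 1) := by
  obtain ⟨hx, hz, hp⟩ := h
  cases isX
  · refine ⟨fun k => ?_, fun k => ?_, ?_⟩
    · simpa [gen, PV.Z, Mem.write_of_ne] using hx k
    · have := hz k
      rcases eq_or_ne k i with rfl | hk
      · simp [gen, PV.Z, Mem.write_apply, val_one_zmod2]
      · simpa [gen, PV.Z, Mem.write_apply, hk, Fin.val_inj] using this
    · simpa [gen, PV.Z, Mem.write_of_ne] using hp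
  · refine ⟨fun k => ?_, fun k => ?_, ?_⟩
    · have := hx k
      rcases eq_or_ne k i with rfl | hk
      · simp [gen, PV.X, Mem.write_apply, val_one_zmod2]
      · simpa [gen, PV.X, Mem.write_apply, hk, Fin.val_inj] using this
    · simpa [gen, PV.X, Mem.write_of_ne] using hz k
    · simpa [gen, PV.X, Mem.write_of_ne] using hp

theorem applyGate_keeps (inv : Bool) (b : ℕ) (hb : b ≠ 6 ∧ b ≠ 7 ∧ b ≠ 12 ∧ b ≠ 17) :
    (applyGate inv).keeps b = true := by
  simp [applyGate, addPhase, LProg.set, keeps, Ne.symm hb.1, Ne.symm hb.2.1, Ne.symm hb.2.2.1,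
    Ne.symm hb.2.2.2]

theorem stored_traversal (v : PV n) (m m' : Mem) (h : ∀ b, b ∉ traversal → m' b = m b)
    (hv : Stored v m) : Stored v m' :=
  hv.congr fun b hb => h b (by rcases hb with rfl | rfl | rfl <;> simp [traversal])

/-- The directions follow from `St.aut`: `r` is folded from its head, the top of the stack, hence
backward; `l` is folded from its last entry, the bottom of the stack, hence forward. -/
theorem stored_query {N : ℕ} {C : Circuit n} {σ : St n} {m : Mem} (h : Holds C σ m)
    (hn : n ≤ N ^ 3) (hC : C.length ≤ N ^ 3) (hσ : σ.size ≤ N ^ 3) (isX : Bool) {a : ℕ}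
    (ha : a ∉ scratch) (i : Fin n) (hi : m a 0 = i) :
    Stored (σ.aut (circuitAut C) (gen isX i)) ((query isX a).run N m) := by
  rw [St.size] at hσ
  have kc : ∀ b, b ∉ scratch → clear.keeps b = true := by
    intro b hb
    simp only [scratch, List.mem_cons, List.not_mem_nil, or_false, not_or] at hb
    obtain ⟨h1, h2, h3, h4, h5, h6, h7, h8, h9, h10⟩ := hb
    simp [clear, LProg.set, loop, keeps, Ne.symm h1, Ne.symm h2, Ne.symm h4, Ne.symm h10]
  set m1 := clear.run N m with hm1
  set m2 := m1.write (if isX then 6 else 7) i 1 with hm2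
  have e2 : ∀ b, b ∉ scratch → m2 b = m b := by
    intro b hb
    rw [hm2, Mem.write_of_ne, hm1, run_of_keeps (kc b hb)]
    intro h
    rw [h] at hb
    cases isX <;> simp [scratch] at hb
  have s2 : Stored (gen isX i) m2 := stored_gen (stored_clear h.qubits hn) isX i
  set m3 := (backward 4 (var 9) (applyGate true)).run N m2 with hm3
  have s3 : Stored (σ.r.foldl (fun v g => g.act true v) (gen isX i)) m3 :=
    run_backward Stored (fun v g => g.act true v) (by simp [traversal])
      (applyGate_keeps _ _ (by simp)) (applyGate_keeps _ _ (by simp))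
      (applyGate_keeps _ _ (by simp)) stored_traversal
      (fun _ _ _ hv hg => stored_applyGate hv hg) (by omega) s2
      (by rw [var, Expr.eval, Expr.eval, e2 9 (by simp [scratch]), h.rlen])
      (by rw [e2 4 (by simp [scratch])]; exact h.r)
  have e3 : ∀ b, b ∉ scratch → m3 b = m b := by
    intro b hb
    rw [← e2 b hb, hm3]
    refine run_of_keeps ?_ m2
    simp only [scratch, List.mem_cons, List.not_mem_nil, or_false, not_or] at hb
    obtain ⟨h1, h2, h3, h4, h5, h6, h7, h8, h9, h10⟩ := hb
    simp [backward, readGate, LProg.set, loop, keeps, applyGate_keeps _ b ⟨h1, h2, h4, h9⟩,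
      Ne.symm h3, Ne.symm h5, Ne.symm h6, Ne.symm h7, Ne.symm h8]
  set m4 := (forward 0 3 (.get 0 (.const 2)) (applyGate false)).run N m3 with hm4
  have s4 : Stored (circuitAut C (σ.r.foldl (fun v g => g.act true v) (gen isX i))) m4 :=
    run_forward Stored (fun v g => g.act false v) (by simp [traversal])
      (applyGate_keeps _ _ (by simp)) (applyGate_keeps _ _ (by simp))
      (applyGate_keeps _ _ (by simp)) stored_traversal
      (fun _ _ _ hv hg => stored_applyGate hv hg) hC s3
      (by
        intro k
        rw [Expr.eval, Expr.eval, Mem.write_of_ne _ _ _ (by simp), e3 0 (by simp [scratch]),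
          h.gates])
      (by rw [e3 0 (by simp [scratch])]; exact h.input)
  have e4 : ∀ b, b ∉ scratch → m4 b = m b := by
    intro b hb
    rw [← e3 b hb, hm4]
    refine run_of_keeps ?_ m3
    simp only [scratch, List.mem_cons, List.not_mem_nil, or_false, not_or] at hb
    obtain ⟨h1, h2, h3, h4, h5, h6, h7, h8, h9, h10⟩ := hb
    simp [forward, readGate, LProg.set, loop, keeps, applyGate_keeps _ b ⟨h1, h2, h4, h9⟩,
      Ne.symm h3, Ne.symm h5, Ne.symm h6, Ne.symm h7, Ne.symm h8]
  have s5 : Stored (σ.l.reverse.foldl (fun v g => g.act true v)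
      (circuitAut C (σ.r.foldl (fun v g => g.act true v) (gen isX i))))
      ((forward 5 0 (var 10) (applyGate true)).run N m4) :=
    run_forward Stored (fun v g => g.act true v) (by simp [traversal])
      (applyGate_keeps _ _ (by simp)) (applyGate_keeps _ _ (by simp))
      (applyGate_keeps _ _ (by simp)) stored_traversal
      (fun _ _ _ hv hg => stored_applyGate hv hg) (by rw [List.length_reverse]; omega) s4
      (by
        intro k
        rw [var, Expr.eval, Expr.eval, Mem.write_of_ne _ _ _ (by simp), e4 10 (by simp [scratch]),
          h.llen, List.length_reverse])
      (by rw [e4 5 (by simp [scratch])]; exact h.l.listAt_reverse)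
  rw [List.foldl_reverse] at s5
  have hrun : (query isX a).run N m = (forward 5 0 (var 10) (applyGate true)).run N m4 := by
    have e1 : m1 a 0 = i := by rw [hm1, run_of_keeps (kc a ha), hi]
    rw [hm4, hm3, hm2]
    simp only [query, LProg.run, var, Expr.eval, ← hm1, e1]
  rw [hrun]
  exact s5

namespace LProg

/-- Compute `view` and put it into variables `20` to `29`. -/
def loadView : LProg :=
  seq (query false 18) (seq (set 20 (.get 6 (var 18))) (seq (set 21 (.get 6 (var 19)))
  (seq (set 22 (.get 7 (var 18))) (seq (set 23 (.get 7 (var 19))) (seq (set 31 (var 12))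
  (seq (query false 19) (seq (set 24 (.get 6 (var 19))) (seq (set 25 (.get 6 (var 18)))
  (seq (set 26 (.get 7 (var 18))) (seq (query true 18)
  (seq (ite (var 24) (set 27 (.get 6 (var 19))) (set 27 (.get 7 (var 19))))
  (ite (var 20) (seq (set 28 (var 12)) (set 29 (var 31)))
    (seq (set 28 (var 31)) (set 29 (var 12)))))))))))))))

/-- Run `p` if all tests have the given results. -/
def onTests (p : LProg) : List (ℕ × Bool) → LProg
  | [] => p
  | (i, true) :: ts => ite (var (20 + i)) (onTests p ts) skip
  | (i, false) :: ts => ite (var (20 + i)) skip (onTests p ts)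

/-- Add a gate to one of the circuits. -/
def pushGate (left : Bool) (kind : ℕ) (a b : Expr) : LProg :=
  let arr := if left then 5 else 4
  let len := if left then 10 else 9
  let pos : Expr := .add (.add (var len) (var len)) (var len)
  seq (assign arr pos (.const kind)) (seq (assign arr (.add pos (.const 1)) a)
    (seq (assign arr (.add pos (.const 2)) b) (set len (.add (var len) (.const 1)))))

/-- Add the gates of a shape to one of the circuits. -/
def pushShape (left : Bool) : Shape → LProg
  | .cnot => ite (xor (var 18) (var 19)) (pushGate left 2 (var 18) (var 19)) skip
  | .cnotRev => ite (xor (var 18) (var 19)) (pushGate left 2 (var 19) (var 18)) skip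
  | .cphase => ite (xor (var 18) (var 19)) (pushGate left 3 (var 18) (var 19)) skip
  | .phase => ite (xor (var 18) (var 19)) skip (pushGate left 1 (var 18) (.const 0))
  | .not => ite (xor (var 18) (var 19)) skip (pushGate left 4 (var 18) (.const 0))
  | .z => ite (xor (var 18) (var 19)) skip
      (seq (pushGate left 1 (var 18) (.const 0)) (pushGate left 1 (var 18) (.const 0)))

/-- One step of the reduction. -/
def stepProg (s : Step) : LProg := seq loadView (onTests (pushShape s.left s.shape) s.tests)

/-- Run `p` for all values of variable `v` below the number of qubits. -/
def forQubits (v : ℕ) (p : LProg) : LProg :=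
  seq (set v (.const 0)) (loop (.sub (.get 0 (.const 1)) (var v))
    (seq p (set v (.add (var v) (.const 1)))))

/-- Run several programs one after the other. -/
def seqAll {ι : Type*} (prog : ι → LProg) (l : List ι) : LProg :=
  l.foldr (fun i p => seq (prog i) p) skip

/-- One sweep of the reduction. -/
def sweepProg (ss : List Step) : LProg :=
  forQubits 18 (seqAll (fun s => forQubits 19 (stepProg s)) ss)

/-- Append the value of `e` to the output. -/
def emit (e : Expr) : LProg :=
  seq (assign 1 (.add (.get 1 (.const 0)) (.const 1)) e)
    (assign 1 (.const 0) (.add (.get 1 (.const 0)) (.const 1)))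

/-- Append the gate in variables `14` to `16` to the output. -/
def emitGate : LProg := seq (emit (var 14)) (seq (emit (var 15)) (emit (var 16)))

/-- Write the output. -/
def output : LProg :=
  seq (emit (var 9)) (seq (forward 4 0 (var 9) emitGate)
    (seq (forQubits 18 (seq (query false 18) (emit (.get 6 (var 18)))))
      (seq (emit (var 10)) (backward 5 (var 10) emitGate))))

/-- The reduction with input and output. -/
def main : LProg := seq (seqAll sweepProg sweeps) output

end LProg

/-! ### Correctness -/

section Steps

variable {N : ℕ} {C : Circuit n}

/-- Each query overwrites the stored Pauli operator, so what is needed of it is saved before the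
next one. Variable `31` keeps the phase of the image of `Z k` until that of `X k` is known. -/
theorem run_loadView {σ : St n} {m : Mem} (h : Holds C σ m)
    (hn : n ≤ N ^ 3) (hC : C.length ≤ N ^ 3) (hσ : σ.size ≤ N ^ 3) {k j : Fin n}
    (hk : m 18 0 = k) (hj : m 19 0 = j) :
    ∀ i < 10, loadView.run N m (20 + i) 0 = view (σ.aut (circuitAut C)) k j i := by
  set F := σ.aut (circuitAut C) with hF
  obtain ⟨x1, z1, p1⟩ : Stored (F (gen false k)) _ := stored_query h hn hC hσ false (a := 18) (by simp [scratch]) k hk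
  have kq := fun (isX : Bool) (a : ℕ) (m : Mem) (b : ℕ) (hb : b ∉ scratch) =>
    run_query_of_notMem N isX a b hb m
  set m1 := (query false 18).run N m with hm1
  have k1 : ∀ b, b ∉ scratch → m1 b = m b := kq false 18 m
  set m2 := (((((m1.write 20 0 ((F (.Z k)).x k).val).write 21 0 ((F (.Z k)).x j).val).write 22 0
    ((F (.Z k)).z k).val).write 23 0 ((F (.Z k)).z j).val).write 31 0 (F (.Z k)).ph.val) with hm2
  have k2 : ∀ b ∈ mainArrays ++ [18, 19], m2 b = m b := by
    intro b hb
    simp only [mainArrays, List.cons_append, List.nil_append, List.mem_cons, List.not_mem_nil,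
      or_false] at hb
    rcases hb with rfl | rfl | rfl | rfl | rfl | rfl | rfl <;>
      simp [hm2, Mem.write_of_ne, k1, scratch]
  have h2 : Holds C σ m2 := h.congr fun b hb => k2 b (by simp [hb])
  have hk2 : m2 18 0 = k := by rw [k2 18 (by simp), hk]
  have hj2 : m2 19 0 = j := by rw [k2 19 (by simp), hj]
  obtain ⟨x3, z3, p3⟩ : Stored (F (gen false j)) _ := stored_query h2 hn hC hσ false (a := 19) (by simp [scratch]) j hj2
  set m3 := (query false 19).run N m2 with hm3
  have k3 : ∀ b, b ∉ scratch → m3 b = m2 b := kq false 19 m2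
  set m4 := ((m3.write 24 0 ((F (.Z j)).x j).val).write 25 0 ((F (.Z j)).x k).val).write 26 0
    ((F (.Z j)).z k).val with hm4
  have k4 : ∀ b ∈ mainArrays ++ [18, 19], m4 b = m b := by
    intro b hb
    rw [← k2 b hb]
    simp only [mainArrays, List.cons_append, List.nil_append, List.mem_cons, List.not_mem_nil,
      or_false] at hb
    rcases hb with rfl | rfl | rfl | rfl | rfl | rfl | rfl <;>
      simp [hm4, Mem.write_of_ne, k3, scratch]
  have h4 : Holds C σ m4 := h.congr fun b hb => k4 b (by simp [hb])
  have hk4 : m4 18 0 = k := by rw [k4 18 (by simp), hk]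
  have hj4 : m4 19 0 = j := by rw [k4 19 (by simp), hj]
  obtain ⟨x5, z5, p5⟩ : Stored (F (gen true k)) _ := stored_query h4 hn hC hσ true (a := 18) (by simp [scratch]) k hk4
  set m5 := (query true 18).run N m4 with hm5
  have k5 : ∀ b, b ∉ scratch → m5 b = m4 b := kq true 18 m4
  have hk1 : m1 18 0 = k := by rw [k1 18 (by simp [scratch]), hk]
  have hj1 : m1 19 0 = j := by rw [k1 19 (by simp [scratch]), hj]
  have hk3 : m3 18 0 = k := by rw [k3 18 (by simp [scratch]), hk2]
  have hj3 : m3 19 0 = j := by rw [k3 19 (by simp [scratch]), hj2]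
  have hk5 : m5 18 0 = k := by rw [k5 18 (by simp [scratch]), hk4]
  have hj5 : m5 19 0 = j := by rw [k5 19 (by simp [scratch]), hj4]
  have e24 : m5 24 0 = ((F (.Z j)).x j).val := by
    rw [k5 24 (by simp [scratch])]
    simp [hm4, Mem.write_of_ne, Mem.write_apply]
  have e25 : m5 25 0 = ((F (.Z j)).x k).val := by
    rw [k5 25 (by simp [scratch])]
    simp [hm4, Mem.write_of_ne, Mem.write_apply]
  have e26 : m5 26 0 = ((F (.Z j)).z k).val := by
    rw [k5 26 (by simp [scratch])]
    simp [hm4, Mem.write_apply]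
  have low : ∀ b, b = 20 ∨ b = 21 ∨ b = 22 ∨ b = 23 ∨ b = 31 → m5 b = m2 b := by
    rintro b (rfl | rfl | rfl | rfl | rfl) <;>
      rw [k5 _ (by simp [scratch]), ← k3 _ (by simp [scratch])] <;> simp [hm4, Mem.write_of_ne]
  have e20 : m5 20 0 = ((F (.Z k)).x k).val := by
    rw [low 20 (by simp)]
    simp [hm2, Mem.write_of_ne, Mem.write_apply]
  have e21 : m5 21 0 = ((F (.Z k)).x j).val := by
    rw [low 21 (by simp)]
    simp [hm2, Mem.write_of_ne, Mem.write_apply]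
  have e22 : m5 22 0 = ((F (.Z k)).z k).val := by
    rw [low 22 (by simp)]
    simp [hm2, Mem.write_of_ne, Mem.write_apply]
  have e23 : m5 23 0 = ((F (.Z k)).z j).val := by
    rw [low 23 (by simp)]
    simp [hm2, Mem.write_of_ne, Mem.write_apply]
  have e31 : m5 31 0 = (F (.Z k)).ph.val := by
    rw [low 31 (by simp)]
    simp [hm2, Mem.write_apply]
  have hrun : loadView.run N m = (ite (var 20) (seq (set 28 (var 12)) (set 29 (var 31)))
      (seq (set 28 (var 31)) (set 29 (var 12)))).run N
      ((ite (var 24) (set 27 (.get 6 (var 19))) (set 27 (.get 7 (var 19)))).run N m5) := by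
    have r2 : (set 31 (var 12)).run N ((set 23 (.get 7 (var 19))).run N
        ((set 22 (.get 7 (var 18))).run N ((set 21 (.get 6 (var 19))).run N
          ((set 20 (.get 6 (var 18))).run N m1)))) = m2 := by
      simp [LProg.run, LProg.set, var, Expr.eval, Mem.write_of_ne, hk1, hj1, x1, z1, p1, hm2, gen]
    have r4 : (set 26 (.get 7 (var 18))).run N ((set 25 (.get 6 (var 18))).run N
        ((set 24 (.get 6 (var 19))).run N m3)) = m4 := by
      simp [LProg.run, LProg.set, var, Expr.eval, Mem.write_of_ne, hk3, hj3, x3, z3, hm4, gen]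
    rw [hm5, ← r4, hm3, ← r2, hm1]
    rfl
  have r27 : (ite (var 24) (set 27 (.get 6 (var 19))) (set 27 (.get 7 (var 19)))).run N m5 =
      m5.write 27 0 (view F k j 7) := by
    have hv : view F k j 7 =
      if (F (.Z j)).x j = 0 then ((F (.X k)).z j).val else ((F (.X k)).x j).val := rfl
    by_cases h0 : (F (.Z j)).x j = 0
    · simp [LProg.run, LProg.set, var, Expr.eval, e24, h0, hv, hj5, z5, gen]
    · simp [LProg.run, LProg.set, var, Expr.eval, e24, h0, hv, hj5, x5, gen]
  rw [hrun, r27]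
  have r2829 : (ite (var 20) (seq (set 28 (var 12)) (set 29 (var 31)))
      (seq (set 28 (var 31)) (set 29 (var 12)))).run N (m5.write 27 0 (view F k j 7)) =
      ((m5.write 27 0 (view F k j 7)).write 28 0 (view F k j 8)).write 29 0 (view F k j 9) := by
    have hv8 : view F k j 8 =
      if (F (.Z k)).x k = 0 then (F (.Z k)).ph.val else (F (.X k)).ph.val := rfl
    have hv9 : view F k j 9 =
      if (F (.Z k)).x k = 0 then (F (.X k)).ph.val else (F (.Z k)).ph.val := rfl
    by_cases h0 : (F (.Z k)).x k = 0
    · simp [LProg.run, LProg.set, var, Expr.eval, Mem.write_of_ne, e20, e31, p5, h0, hv8, hv9, gen]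
    · simp [LProg.run, LProg.set, var, Expr.eval, Mem.write_of_ne, e20, e31, p5, h0, hv8, hv9, gen]
  rw [r2829]
  intro i hi
  interval_cases i
  · simpa [view, Mem.write_of_ne] using e20
  · simpa [view, Mem.write_of_ne] using e21
  · simpa [view, Mem.write_of_ne] using e22
  · simpa [view, Mem.write_of_ne] using e23
  · simpa [view, Mem.write_of_ne] using e24
  · simpa [view, Mem.write_of_ne] using e25
  · simpa [view, Mem.write_of_ne] using e26
  · simp [Mem.write_of_ne, Mem.write_apply]
  · simp [Mem.write_of_ne, Mem.write_apply]
  · simp [Mem.write_apply]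

theorem loadView_keeps (b : ℕ) (hb : b ∈ mainArrays ++ [18, 19]) : loadView.keeps b = true := by
  simp only [mainArrays, List.cons_append, List.nil_append, List.mem_cons, List.not_mem_nil,
      or_false] at hb
  rcases hb with rfl | rfl | rfl | rfl | rfl | rfl | rfl <;> rfl

theorem run_onTests {p : LProg} {w : ℕ → ℕ} {ts : List (ℕ × Bool)} (hts : ∀ t ∈ ts, t.1 < 10)
    {m : Mem} (hm : ∀ i < 10, m (20 + i) 0 = w i) :
    (onTests p ts).run N m =
      if ∀ t ∈ ts, (w t.1 ≠ 0 ↔ t.2 = true) then p.run N m else m := by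
  induction ts with
  | nil => simp [onTests]
  | cons t ts ih =>
    have ih := ih fun t ht => hts t (by simp [ht])
    have h0 := hm t.1 (hts t (by simp))
    obtain ⟨i, b⟩ := t
    simp only [List.forall_mem_cons]
    cases b
    · by_cases hw : w i = 0
      · have h1 : (onTests p ((i, false) :: ts)).run N m = (onTests p ts).run N m := by
          simp [onTests, LProg.run, var, Expr.eval, h0, hw]
        rw [h1, ih]
        exact if_congr (by simp [hw]) rfl rfl
      · simp [onTests, LProg.run, var, Expr.eval, h0, hw]
    · by_cases hw : w i = 0
      · simp [onTests, LProg.run, var, Expr.eval, h0, hw]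
      · have h1 : (onTests p ((i, true) :: ts)).run N m = (onTests p ts).run N m := by
          simp [onTests, LProg.run, var, Expr.eval, h0, hw]
        rw [h1, ih]
        exact if_congr (by simp [hw]) rfl rfl

/-- `a` and `b` are evaluated when part of the gate has already been written, so their values must
not depend on arrays `4` and `5`. -/
theorem holds_pushGate {σ : St n} {m : Mem} (h : Holds C σ m) (left : Bool) (g : Gate n)
    {kind : ℕ} {a b : Expr} (hkind : kind = g.kind)
    (ha : ∀ m' : Mem, (∀ b, b ≠ 4 → b ≠ 5 → m' b = m b) → a.eval m' = g.fst)
    (hb : ∀ m' : Mem, (∀ b, b ≠ 4 → b ≠ 5 → m' b = m b) → b.eval m' = g.snd) :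
    Holds C (σ.push left [g]) ((pushGate left kind a b).run N m) := by
  subst hkind
  cases left
  · set t := 3 * σ.r.length with ht
    have hpos : m 9 0 + m 9 0 + m 9 0 = t := by
      rw [h.rlen]
      omega
    set m1 := m.write 4 t g.kind with hm1
    have ea : a.eval m1 = g.fst := ha m1 fun b h4 _ => by rw [hm1, Mem.write_of_ne _ _ _ h4]
    set m2 := m1.write 4 (t + 1) g.fst with hm2
    have eb : b.eval m2 = g.snd := hb m2 fun b h4 _ => by
      rw [hm2, Mem.write_of_ne _ _ _ h4, hm1, Mem.write_of_ne _ _ _ h4]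
    have hrun : (pushGate false g.kind a b).run N m =
        (m2.write 4 (t + 2) g.snd).write 9 0 (m 9 0 + 1) := by
      rw [hm1] at ea
      rw [hm2, hm1] at eb
      simp [pushGate, LProg.run, LProg.set, var, Expr.eval, Mem.write_of_ne, hpos, hm2, hm1,
        ea, eb]
    rw [hrun, hm2, hm1]
    refine ⟨?_, ?_, ?_, ?_, ?_, ⟨?_, ?_, ?_, h.r.congr fun i hi => ?_⟩, ?_⟩
    · simpa [Mem.write_of_ne] using h.qubits
    · simpa [Mem.write_of_ne] using h.gates
    · simpa [Mem.write_of_ne] using h.input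
    · simp [Mem.write_apply, St.push, h.rlen]
    · simpa [Mem.write_of_ne, St.push] using h.llen
    · simp [Mem.write_of_ne, Mem.write_apply, ht]
    · simp [Mem.write_of_ne, Mem.write_apply, ht]
    · simp [Mem.write_of_ne, Mem.write_apply, ht]
    · have hi0 : i < t := by simpa using hi
      have hi1 : i ≠ t := by omega
      have hi2 : i ≠ t + 1 := by omega
      have hi3 : i ≠ t + 2 := by omega
      simp [Mem.write_of_ne, Mem.write_apply, hi1, hi2, hi3]
    · simpa [Mem.write_of_ne, St.push] using h.l
  · set t := 3 * σ.l.length with ht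
    have hpos : m 10 0 + m 10 0 + m 10 0 = t := by
      rw [h.llen]
      omega
    set m1 := m.write 5 t g.kind with hm1
    have ea : a.eval m1 = g.fst := ha m1 fun b _ h5 => by rw [hm1, Mem.write_of_ne _ _ _ h5]
    set m2 := m1.write 5 (t + 1) g.fst with hm2
    have eb : b.eval m2 = g.snd := hb m2 fun b _ h5 => by
      rw [hm2, Mem.write_of_ne _ _ _ h5, hm1, Mem.write_of_ne _ _ _ h5]
    have hrun : (pushGate true g.kind a b).run N m =
        (m2.write 5 (t + 2) g.snd).write 10 0 (m 10 0 + 1) := by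
      rw [hm1] at ea
      rw [hm2, hm1] at eb
      simp [pushGate, LProg.run, LProg.set, var, Expr.eval, Mem.write_of_ne, hpos, hm2, hm1,
        ea, eb]
    rw [hrun, hm2, hm1]
    refine ⟨?_, ?_, ?_, ?_, ?_, ?_, ⟨?_, ?_, ?_, h.l.congr fun i hi => ?_⟩⟩
    · simpa [Mem.write_of_ne] using h.qubits
    · simpa [Mem.write_of_ne] using h.gates
    · simpa [Mem.write_of_ne] using h.input
    · simpa [Mem.write_of_ne, St.push] using h.rlen
    · simp [Mem.write_apply, St.push, h.llen]
    · simpa [Mem.write_of_ne, St.push] using h.r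
    · simp [Mem.write_of_ne, Mem.write_apply, ht]
    · simp [Mem.write_of_ne, Mem.write_apply, ht]
    · simp [Mem.write_of_ne, Mem.write_apply, ht]
    · have hi0 : i < t := by simpa using hi
      have hi1 : i ≠ t := by omega
      have hi2 : i ≠ t + 1 := by omega
      have hi3 : i ≠ t + 2 := by omega
      simp [Mem.write_of_ne, Mem.write_apply, hi1, hi2, hi3]

theorem St.push_nil (left : Bool) (σ : St n) : σ.push left [] = σ := by
  cases left <;> rfl

theorem St.push_push (left : Bool) (g : Gate n) (σ : St n) :
    (σ.push left [g]).push left [g] = σ.push left [g, g] := by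
  cases left <;> rfl

theorem pushGate_keeps (left : Bool) (kind : ℕ) (a b : Expr) (c : ℕ)
    (hc : c ≠ 4 ∧ c ≠ 5 ∧ c ≠ 9 ∧ c ≠ 10) : (pushGate left kind a b).keeps c = true := by
  cases left <;> simp [pushGate, LProg.set, keeps, hc.1.symm, hc.2.1.symm, hc.2.2.1.symm,
    hc.2.2.2.symm]

theorem holds_pushShape {σ : St n} {m : Mem} (h : Holds C σ m) (left : Bool) (s : Shape)
    {k j : Fin n} (hk : m 18 0 = k) (hj : m 19 0 = j) :
    Holds C (σ.push left (s.gates k j)) ((pushShape left s).run N m) := by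
  have hk' : ∀ m' : Mem, (∀ b, b ≠ 4 → b ≠ 5 → m' b = m b) → (var 18).eval m' = k := fun m' h => by
    rw [var, Expr.eval, h 18 (by simp) (by simp)]
    exact hk
  have hj' : ∀ m' : Mem, (∀ b, b ≠ 4 → b ≠ 5 → m' b = m b) → (var 19).eval m' = j := fun m' h => by
    rw [var, Expr.eval, h 19 (by simp) (by simp)]
    exact hj
  have hxor : (xor (var 18) (var 19)).eval m ≠ 0 ↔ k ≠ j := by
    simp only [LProg.xor, var, Expr.eval, hk, hj, ne_eq, Fin.ext_iff]
    omega
  by_cases hkj : k = j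
  · have h0 : ¬(xor (var 18) (var 19)).eval m ≠ 0 := fun h => hxor.1 h hkj
    cases s with
    | cnot | cnotRev | cphase =>
      rw [pushShape, Shape.gates, LProg.run, if_neg h0]
      first | rw [dif_pos hkj] | rw [dif_neg (not_not.2 hkj)]
      rw [St.push_nil]
      exact h
    | phase =>
      rw [pushShape, Shape.gates, LProg.run, if_neg h0, if_pos hkj]
      exact holds_pushGate h left (.phase k) rfl hk' fun _ _ => rfl
    | not =>
      rw [pushShape, Shape.gates, LProg.run, if_neg h0, if_pos hkj]
      exact holds_pushGate h left (.not k) rfl hk' fun _ _ => rfl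
    | z =>
      rw [pushShape, Shape.gates, LProg.run, if_neg h0, if_pos hkj, ← St.push_push, LProg.run]
      refine holds_pushGate (holds_pushGate h left (.phase k) rfl hk' fun _ _ => rfl) left
        (.phase k) rfl (fun m' hm' => ?_) fun _ _ => rfl
      rw [var, Expr.eval, Expr.eval, hm' 18 (by simp) (by simp),
        run_of_keeps (pushGate_keeps _ _ _ _ _ (by simp))]
      exact hk
  · have h0 : (xor (var 18) (var 19)).eval m ≠ 0 := hxor.2 hkj
    cases s with
    | cnot =>
      rw [pushShape, Shape.gates, LProg.run, if_pos h0, dif_pos hkj]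
      exact holds_pushGate h left (.cnot k j hkj) rfl hk' hj'
    | cnotRev =>
      rw [pushShape, Shape.gates, LProg.run, if_pos h0, dif_pos hkj]
      exact holds_pushGate h left (.cnot j k (Ne.symm hkj)) rfl hj' hk'
    | cphase =>
      rw [pushShape, Shape.gates, LProg.run, if_pos h0, dif_pos hkj]
      exact holds_pushGate h left (.cphase k j hkj) rfl hk' hj'
    | phase | not | z =>
      rw [pushShape, Shape.gates, LProg.run, if_pos h0, if_neg hkj, St.push_nil]
      exact h

theorem holds_stepProg {σ : St n} {m : Mem} (h : Holds C σ m)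
    (hn : n ≤ N ^ 3) (hC : C.length ≤ N ^ 3) (hσ : σ.size ≤ N ^ 3) {k j : Fin n}
    (hk : m 18 0 = k) (hj : m 19 0 = j) {s : Step} (hs : ∀ t ∈ s.tests, t.1 < 10) :
    Holds C (s.onSt (circuitAut C) k j σ) ((stepProg s).run N m) := by
  have e : ∀ b ∈ mainArrays ++ [18, 19], loadView.run N m b = m b := fun b hb =>
    run_of_keeps (loadView_keeps b hb) m
  have h1 : Holds C σ (loadView.run N m) := h.congr fun b hb => e b (by simp [hb])
  rw [stepProg, LProg.run, run_onTests hs (run_loadView h hn hC hσ hk hj), Step.onSt]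
  by_cases hf : s.Fires (σ.aut (circuitAut C)) k j
  · rw [if_pos hf, if_pos (show ∀ t ∈ s.tests, _ from hf)]
    exact holds_pushShape h1 s.left s.shape (by rw [e 18 (by simp), hk]) (by rw [e 19 (by simp), hj])
  · rw [if_neg hf, if_neg (show ¬∀ t ∈ s.tests, _ from hf)]
    exact h1

theorem onTests_keeps {p : LProg} {b : ℕ} (h : p.keeps b = true) (ts : List (ℕ × Bool)) :
    (onTests p ts).keeps b = true := by
  induction ts with
  | nil => exact h
  | cons t ts ih =>
    obtain ⟨i, _ | _⟩ := t <;> simp [onTests, keeps, ih]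

theorem pushShape_keeps (left : Bool) (s : Shape) {b : ℕ}
    (hb : b ≠ 4 ∧ b ≠ 5 ∧ b ≠ 9 ∧ b ≠ 10) : (pushShape left s).keeps b = true := by
  cases s <;> simp [pushShape, keeps, pushGate_keeps _ _ _ _ _ hb]

theorem stepProg_keeps (s : Step) (b : ℕ) (hb : b = 18 ∨ b = 19) :
    (stepProg s).keeps b = true := by
  rw [stepProg, keeps, loadView_keeps b (by rcases hb with rfl | rfl <;> simp), Bool.true_and]
  exact onTests_keeps (pushShape_keeps _ _ (by omega)) _

end Steps

section Computes

variable {N : ℕ} {α : Type*}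

/-- If the memory represents `a` in the sense of `Q`, then it represents `s a` after a run of `p`,
as long as the size of `s a` is at most `N ^ 3`. -/
structure Computes (N : ℕ) (μ : α → ℕ) (Q : α → Mem → Prop) (p : LProg) (s : α → α) : Prop where
  mono : ∀ a, μ a ≤ μ (s a)
  run : ∀ a m, Q a m → μ (s a) ≤ N ^ 3 → Q (s a) (p.run N m)

theorem computes_seqAll {ι : Type*} {μ : α → ℕ} {Q : α → Mem → Prop} {prog : ι → LProg}
    {f : α → ι → α} (l : List ι) (h : ∀ i ∈ l, Computes N μ Q (prog i) fun a => f a i) :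
    Computes N μ Q (seqAll prog l) fun a => l.foldl f a := by
  induction l with
  | nil => exact ⟨fun _ => le_rfl, fun _ _ h _ => h⟩
  | cons i l ih =>
    have h1 := h i (by simp)
    have h2 := ih fun j hj => h j (by simp [hj])
    exact ⟨fun a => (h1.mono a).trans (h2.mono _),
      fun a m hq hle => h2.run _ _ (h1.run a m hq ((h2.mono _).trans hle)) hle⟩

theorem le_foldl_of_le {β : Type*} (μ : α → ℕ) (f : α → β → α) (h : ∀ a b, μ a ≤ μ (f a b))
    (l : List β) (a : α) : μ a ≤ μ (l.foldl f a) := by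
  induction l generalizing a with
  | nil => exact le_rfl
  | cons b l ih => exact (h a b).trans (ih _)

theorem computes_forQubits {μ : α → ℕ} {Q : α → Mem → Prop} {v : ℕ} {p : LProg}
    {s : Fin n → α → α} (hn : n ≤ N ^ 3) (hQn : ∀ a m, Q a m → m 0 1 = n)
    (hQ : ∀ a m x, Q a m → Q a (m.write v 0 x))
    (hp : ∀ i, Computes N μ (fun a m => Q a m ∧ m v 0 = (i : Fin n)) p (s i)) :
    Computes N μ Q (forQubits v p) fun a => (List.finRange n).foldl (fun a i => s i a) a := by
  have mono := le_foldl_of_le μ (fun a i => s i a) fun a i => (hp i).mono a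
  refine ⟨mono _, fun a m hq hle => ?_⟩
  have key := run_loop (N := N) (e := .sub (.get 0 (.const 1)) (var v))
    (p := seq p (set v (.add (var v) (.const 1))))
    (fun c m => ∃ i a', i + c = n ∧ m v 0 = i ∧ Q a' m ∧
      ((List.finRange n).drop i).foldl (fun a i => s i a) a' =
        (List.finRange n).foldl (fun a i => s i a) a) ?_ ?_ hn (m := m.write v 0 0)
    ⟨0, a, by omega, by simp [Mem.write_apply], hQ _ _ _ hq, rfl⟩
  · obtain ⟨i, a', h1, -, h2, h3⟩ := key
    have hi : i = n := by omega
    rw [List.drop_eq_nil_of_le (by simp [hi])] at h3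
    rw [← h3]
    exact h2
  · rintro c m ⟨i, a', h1, h2, h3, h4⟩
    have hi : i < n := by omega
    rw [List.drop_eq_getElem_cons (by simpa using hi), List.getElem_finRange,
      List.foldl_cons] at h4
    -- Sizes never decrease, so the bound for the final state covers this intermediate one.
    obtain ⟨q1, q2⟩ := (hp ⟨i, hi⟩).run a' m ⟨h3, h2⟩ ((le_foldl_of_le μ (fun a i => s i a)
      (fun a i => (hp i).mono a) _ _).trans (h4 ▸ hle))
    refine ⟨?_, i + 1, s ⟨i, hi⟩ a', by omega, ?_, hQ _ _ _ q1, h4⟩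
    · simp only [var, Expr.eval, hQn _ _ h3, h2]
      omega
    · simp [LProg.run, LProg.set, var, Expr.eval, Mem.write_apply, q2]
  · rintro m ⟨i, a', h1, h2, h3, -⟩
    simp only [var, Expr.eval, hQn _ _ h3, h2]
    omega

end Computes

theorem Step.size_le_onSt (f : PV n → PV n) (s : Step) (k j : Fin n) (σ : St n) :
    σ.size ≤ (s.onSt f k j σ).size := by
  unfold Step.onSt St.push St.size
  split_ifs <;> simp

theorem Holds.write {C : Circuit n} {σ : St n} {m : Mem} (h : Holds C σ m) {b : ℕ}
    (hb : b ∉ mainArrays) (i v : ℕ) : Holds C σ (m.write b i v) :=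
  h.congr fun c hc => Mem.write_of_ne _ _ _ (by
    rintro rfl
    exact hb hc)

theorem computes_sweepProg {N : ℕ} {C : Circuit n} (hn : n ≤ N ^ 3) (hC : C.length ≤ N ^ 3)
    {ss : List Step} (hss : ∀ s ∈ ss, ∀ t ∈ s.tests, t.1 < 10) :
    Computes N St.size (Holds C) (sweepProg ss) (sweep (ss.map (Step.onSt (circuitAut C)))) := by
  have step : ∀ s ∈ ss, ∀ k j : Fin n, Computes N St.size
      (fun σ m => (Holds C σ m ∧ m 18 0 = k) ∧ m 19 0 = j) (stepProg s)
      (s.onSt (circuitAut C) k j) := by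
    refine fun s hs k j => ⟨Step.size_le_onSt _ s k j, ?_⟩
    rintro σ m ⟨⟨h, hk⟩, hj⟩ hσ
    refine ⟨⟨holds_stepProg h hn hC ((Step.size_le_onSt _ s k j σ).trans hσ) hk hj (hss s hs),
      ?_⟩, ?_⟩
    · rw [run_of_keeps (stepProg_keeps s 18 (by simp)), hk]
    · rw [run_of_keeps (stepProg_keeps s 19 (by simp)), hj]
  have := computes_forQubits (Q := Holds C) (v := 18) hn (fun _ _ h => h.qubits)
    (fun _ _ _ h => h.write (by simp [mainArrays]) _ _) fun k : Fin n => computes_seqAll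
      (f := fun σ s => (List.finRange n).foldl (fun σ j => s.onSt (circuitAut C) k j σ) σ) ss
      fun s hs => computes_forQubits (v := 19) hn (fun _ _ h => h.1.qubits)
        (fun _ _ _ h => ⟨h.1.write (by simp [mainArrays]) _ _,
          by rw [Mem.write_of_ne _ _ _ (by simp), h.2]⟩)
        (step s hs k)
  have e : sweep (ss.map (Step.onSt (circuitAut C))) = fun σ => (List.finRange n).foldl
      (fun σ k => ss.foldl (fun σ s => (List.finRange n).foldl
        (fun σ j => s.onSt (circuitAut C) k j σ) σ) σ) σ := by
    funext σ
    simp only [sweep, List.foldl_map]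
  rw [e]
  exact this

theorem sweeps_tests : ∀ ss ∈ sweeps, ∀ s ∈ ss, ∀ t ∈ s.tests, t.1 < 10 := by
  decide

theorem holds_reduce {N : ℕ} {C : Circuit n} (hn : n ≤ N ^ 3) (hC : C.length ≤ N ^ 3)
    (hN : 24 * n ^ 2 ≤ N ^ 3) {m : Mem} (h : Holds C ⟨[], []⟩ m) :
    Holds C (reduce (circuitAut C)) ((seqAll sweepProg sweeps).run N m) := by
  have key : Computes N St.size (Holds C) (seqAll sweepProg sweeps) fun σ =>
      sweeps.foldl (fun σ ss => sweep (ss.map (Step.onSt (circuitAut C))) σ) σ :=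
    computes_seqAll sweeps fun ss hss => computes_sweepProg hn hC (sweeps_tests ss hss)
  exact key.run _ _ h ((reduce_size_le _).trans hN)

/-! ### The output -/

theorem outputOf_congr {m m' : Mem} (h : m' 1 = m 1) : outputOf m' = outputOf m := by
  rw [outputOf, outputOf, h]

theorem outputOf_emit (N : ℕ) (e : Expr) (m : Mem) :
    outputOf ((emit e).run N m) = outputOf m ++ [e.eval m] := by
  have h : ∀ i, (emit e).run N m 1 i =
      if i = 0 then m 1 0 + 1 else if i = m 1 0 + 1 then e.eval m else m 1 i := by
    intro i
    simp [emit, LProg.run, Expr.eval, Mem.write_apply]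
  rw [outputOf, h 0, if_pos rfl, List.range_succ, List.map_append, outputOf]
  congr 1
  · refine List.map_congr_left fun i hi => ?_
    rw [List.mem_range] at hi
    rw [h, if_neg (by omega), if_neg (by omega)]
  · simp [h]

theorem emit_keeps (e : Expr) {b : ℕ} (hb : b ≠ 1) : (emit e).keeps b = true := by
  simp [emit, keeps, hb.symm]

theorem run_emit_of_ne (N : ℕ) (e : Expr) (m : Mem) {b : ℕ} (hb : b ≠ 1) :
    (emit e).run N m b = m b := run_of_keeps (emit_keeps e hb) m

theorem outputOf_emitGate (N : ℕ) {g : Gate n} {m : Mem} (hg : GateAt g m) :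
    outputOf (emitGate.run N m) = outputOf m ++ g.code := by
  obtain ⟨h1, h2, h3⟩ := hg
  rw [emitGate, LProg.run, LProg.run, outputOf_emit, outputOf_emit, outputOf_emit, g.code_eq]
  simp only [var, Expr.eval, run_emit_of_ne N _ _ (show 15 ≠ 1 by simp),
    run_emit_of_ne N _ _ (show 16 ≠ 1 by simp), h1, h2, h3]
  simp

theorem emitGate_keeps {b : ℕ} (hb : b ≠ 1) : emitGate.keeps b = true := by
  simp [emitGate, keeps, emit_keeps _ hb]

theorem foldl_append_code (C : Circuit n) (w : List ℕ) :
    C.foldl (fun w g => w ++ g.code) w = w ++ C.flatMap Gate.code := by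
  rw [List.foldl_append_eq_append, List.flatMap_def]

theorem reduceSet_bit (f : PV n → PV n) (k : Fin n) :
    (((reduce f).aut f (.Z k)).x k).val = if k ∈ reduceSet f then 1 else 0 := by
  have h : ∀ a : ZMod 2, a.val = if a ≠ 0 then 1 else 0 := by decide
  have hk : k ∈ reduceSet f ↔ ((reduce f).aut f (.Z k)).x k ≠ 0 :=
    Finset.mem_filter.trans (and_iff_right (Finset.mem_univ k))
  rw [h]
  exact if_congr hk.symm rfl rfl

theorem holds_of_keeps {N : ℕ} {C : Circuit n} {σ : St n} {p : LProg}
    (hp : ∀ b ∈ mainArrays, p.keeps b = true) {m : Mem} (h : Holds C σ m) :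
    Holds C σ (p.run N m) := h.congr fun b hb => run_of_keeps (hp b hb) m

/-- `M₁` is `r` reversed, so its stack is read from the bottom; `M₂` is `l` itself, read from the
top. The indicator vector of `S` comes from fresh queries for the `Z k`. -/
theorem outputOf_output {N : ℕ} {C : Circuit n} (hn : n ≤ N ^ 3) (hC : C.length ≤ N ^ 3)
    (hN : 24 * n ^ 2 ≤ N ^ 3) {m : Mem} (h : Holds C (reduce (circuitAut C)) m)
    (hm : outputOf m = []) :
    outputOf (output.run N m) = Circuit.code (reduce (circuitAut C)).r.reverse ++
      subsetCode (reduceSet (circuitAut C)) ++ Circuit.code (reduce (circuitAut C)).l := by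
  set f := circuitAut C with hf
  set σ := reduce f with hσ
  have hsize : σ.size ≤ N ^ 3 := (reduce_size_le f).trans hN
  have hsize' := hsize
  rw [St.size] at hsize'
  have traverse : ∀ (w : List ℕ) (m m' : Mem), (∀ b, b ∉ traversal → m' b = m b) →
      outputOf m = w → outputOf m' = w := fun w m m' h hw => by
    rw [outputOf_congr (h 1 (by simp [traversal])), hw]
  have body : ∀ (w : List ℕ) (g : Gate n) (m : Mem), outputOf m = w → GateAt g m →
      outputOf (emitGate.run N m) = w ++ g.code := fun w g m hw hg => by
    rw [outputOf_emitGate N hg, hw]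
  have e1 := outputOf_emit N (var 9) m
  have h1 : Holds C σ ((emit (var 9)).run N m) :=
    holds_of_keeps (fun b hb => emit_keeps _ (by rintro rfl; simp [mainArrays] at hb)) h
  rw [hm, List.nil_append, show (var 9).eval m = σ.r.length from h.rlen] at e1
  set m1 := (emit (var 9)).run N m with hm1
  have e2 := run_forward (N := N) (fun w m => outputOf m = w) (fun w (g : Gate n) => w ++ g.code)
    (arr := 4) (p := emitGate) (start := 0) (len := var 9) (by simp [traversal])
    (emitGate_keeps (by simp)) (emitGate_keeps (by simp)) (emitGate_keeps (by simp)) traverse body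
    (C := σ.r.reverse) (by rw [List.length_reverse]; omega) e1
    (fun k => by
      rw [var, Expr.eval, Expr.eval, Mem.write_of_ne _ _ _ (by simp), h1.rlen, List.length_reverse])
    h1.r.listAt_reverse
  have h2 : Holds C σ ((forward 4 0 (var 9) emitGate).run N m1) :=
    holds_of_keeps (by decide) h1
  rw [foldl_append_code] at e2
  set m2 := (forward 4 0 (var 9) emitGate).run N m1 with hm2
  -- The circuits do not grow any more, so the trivial measure suffices.
  obtain ⟨h3, e3⟩ := (computes_forQubits (N := N) (μ := fun _ : List ℕ => 0)
    (Q := fun w m => Holds C σ m ∧ outputOf m = w) (v := 18)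
    (p := seq (query false 18) (emit (.get 6 (var 18))))
    (s := fun (k : Fin n) w => w ++ [if k ∈ reduceSet f then 1 else 0]) hn
    (fun _ _ h => h.1.qubits)
    (fun _ _ _ h => ⟨h.1.write (by simp [mainArrays]) _ _, by
      rw [outputOf_congr (Mem.write_of_ne _ _ _ (by simp)), h.2]⟩)
    fun k => ⟨fun _ => le_rfl, by
      rintro w m ⟨⟨h, hw⟩, hk⟩ -
      have hq : ∀ b, b ∉ scratch → (query false 18).run N m b = m b := fun b hb =>
        run_query_of_notMem N false 18 b hb m
      have hs := (stored_query h hn hC hsize false (a := 18) (by simp [scratch]) k hk).1 k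
      refine ⟨⟨h.congr fun b hb => ?_, ?_⟩, ?_⟩
      · simp only [mainArrays, List.mem_cons, List.not_mem_nil, or_false] at hb
        rw [LProg.run, run_emit_of_ne _ _ _ (by omega), hq]
        simp only [scratch, List.mem_cons, List.not_mem_nil, or_false]
        omega
      · rw [LProg.run, outputOf_emit, outputOf_congr (hq 1 (by simp [scratch])), hw,
          ← reduceSet_bit, var, Expr.eval, Expr.eval, Expr.eval, hq 18 (by simp [scratch]), hk, hs]
        rfl
      · rw [LProg.run, run_emit_of_ne _ _ _ (by simp), hq 18 (by simp [scratch]), hk]⟩).run _ m2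
        ⟨h2, e2⟩ (Nat.zero_le _)
  rw [List.foldl_append_eq_append] at e3
  set m3 := (forQubits 18 (seq (query false 18) (emit (.get 6 (var 18))))).run N m2 with hm3
  have e4 := outputOf_emit N (var 10) m3
  have h4 : Holds C σ ((emit (var 10)).run N m3) :=
    holds_of_keeps (fun b hb => emit_keeps _ (by rintro rfl; simp [mainArrays] at hb)) h3
  rw [show (var 10).eval m3 = σ.l.length from h3.llen, e3] at e4
  set m4 := (emit (var 10)).run N m3 with hm4
  have e5 := run_backward (N := N) (fun w m => outputOf m = w) (fun w (g : Gate n) => w ++ g.code)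
    (arr := 5) (p := emitGate) (len := var 10) (by simp [traversal])
    (emitGate_keeps (by simp)) (emitGate_keeps (by simp)) (emitGate_keeps (by simp)) traverse body
    (L := σ.l) (by omega) e4 (by rw [var, Expr.eval, Expr.eval, h4.llen]) h4.l
  rw [foldl_append_code] at e5
  have hrun : output.run N m = (backward 5 (var 10) emitGate).run N m4 := rfl
  rw [hrun, e5, Circuit.code, Circuit.code, subsetCode, List.ofFn_eq_map, List.length_reverse,
    ← List.flatMap_def, List.map_eq_flatMap]
  simp

/-! ### Running time -/

theorem listAt_flatMap (C : Circuit n) (u : List ℕ) (c : ℕ → ℕ)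
    (hc : ∀ i, c i = (u ++ C.flatMap Gate.code).getD i 0) : ListAt c u.length C := by
  induction C generalizing u with
  | nil => trivial
  | cons g C ih =>
    refine ⟨?_, ?_, ?_, ?_⟩
    · simp [hc, g.code_eq]
    · simp [hc, g.code_eq]
    · simp [hc, g.code_eq]
    · have := ih (u ++ g.code) fun i => by rw [hc i, List.flatMap_cons, List.append_assoc]
      rwa [List.length_append, g.code_eq] at this

theorem length_flatMap_code (C : Circuit n) : (C.flatMap Gate.code).length = 3 * C.length := by
  induction C with
  | nil => rfl
  | cons g C ih =>
    rw [List.flatMap_cons, List.length_append, ih, g.code_eq, List.length_cons, List.length_cons,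
      List.length_cons, List.length_cons, List.length_nil]
    omega

/-- The number of repetitions of the loops. -/
def repetitions : Expr :=
  .add (.const 24) (.add (.get 0 (.const 0)) (.add (.get 0 (.const 1))
    (.add (.get 0 (.const 1)) (.get 0 (.const 1)))))

theorem holds_inputMem (C : Circuit n) : Holds C ⟨[], []⟩ (inputMem (n :: C.code)) := by
  refine ⟨rfl, rfl, ?_, rfl, rfl, trivial, trivial⟩
  -- Three cells precede the gates, whence the start position `3` in `Holds`.
  exact listAt_flatMap C [(n :: C.code).length, n, C.length] _ fun i => rfl

/-- The input has length `2 + 3 * C.length`, and adding `n` three times gives a function of `n +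
C.length`. The constant `24` ensures `24 * n ^ 2 ≤ N ^ 3`. -/
theorem eval_repetitions (C : Circuit n) :
    repetitions.eval (inputMem (n :: C.code)) = 26 + 3 * (n + C.length) := by
  have h0 : inputMem (n :: C.code) 0 0 = 2 + 3 * C.length := by
    rw [← length_flatMap_code]
    simp [inputMem, Circuit.code]
    omega
  have h1 : inputMem (n :: C.code) 0 1 = n := rfl
  simp only [repetitions, Expr.eval, h0, h1]
  ring

/-- The program of the theorem. -/
def program : Prog :=
  .seq (.assign 2 (.const 0) repetitions) (main.compile 0)

theorem outputsWithin_program (C : Circuit n) :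
    OutputsWithin program (n :: C.code)
      ((1 + main.cost.comp (26 + 3 * Polynomial.X)).eval (n + C.length))
      (Circuit.code (reduce (circuitAut C)).r.reverse ++ subsetCode (reduceSet (circuitAut C)) ++
        Circuit.code (reduce (circuitAut C)).l) := by
  set N := 26 + 3 * (n + C.length) with hN
  set m := (inputMem (n :: C.code)).write 2 0 N with hm
  have hm2 : m 2 0 = N := by rw [hm, Mem.write_apply, if_pos rfl]
  obtain ⟨t, ht, m', hr, he, -⟩ := LProg.compile_runs (p := main) (by decide) (by decide)
    (by decide) 0 m m hm2 fun _ _ => rfl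
  refine ⟨1 + t, ?_, m', .seq ?_ hr, ?_⟩
  · simp only [Polynomial.eval_add, Polynomial.eval_one, Polynomial.eval_comp, Polynomial.eval_mul,
      Polynomial.eval_X, Polynomial.eval_ofNat, ← hN]
    omega
  · have := Runs.assign 2 (.const 0) repetitions (inputMem (n :: C.code))
    rwa [eval_repetitions] at this
  · have hn : n ≤ N := by omega
    have h1 : N ≤ N ^ 3 := Nat.le_self_pow (by simp) N
    have h2 : 24 * n ^ 2 ≤ N ^ 3 := by
      rw [pow_succ' N 2]
      exact Nat.mul_le_mul (by omega) (Nat.pow_le_pow_left hn 2)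
    rw [outputOf_congr (he 1 (by simp)).symm]
    have h := (holds_inputMem C).write (b := 2) (by simp [mainArrays]) 0 N
    have hC : C.length ≤ N ^ 3 := by omega
    refine outputOf_output (hn.trans h1) hC h2 (holds_reduce (hn.trans h1) hC h2 h) ?_
    rw [outputOf_congr (run_of_keeps (by decide) _), outputOf_congr (Mem.write_of_ne _ _ _ (by simp))]
    rfl

end CliffordNF

/-- The algorithmic half reduces `circuitAut C` instead of a chosen automorphism, because a program
can evaluate it gate by gate. -/
theorem mainTheorem3 :
    ∃ size : Polynomial ℕ,
      (∀ (n : ℕ) (U : Op n), IsClifford U →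
        ∃ (M₁ : Circuit n) (S : Finset (Fin n)) (M₂ : Circuit n),
          IsNormalForm (size.eval n) U M₁ S M₂) ∧
      ∃ (p : Prog) (time : Polynomial ℕ), ∀ (n : ℕ) (C : Circuit n),
        (∀ g ∈ C, g.IsCliffordGate) →
        ∃ (M₁ : Circuit n) (S : Finset (Fin n)) (M₂ : Circuit n),
          IsNormalForm (size.eval n) C.matrix M₁ S M₂ ∧
          OutputsWithin p (n :: C.code) (time.eval (n + C.length))
            (M₁.code ++ subsetCode S ++ M₂.code) := by
  have hsize : ∀ n : ℕ, (24 * Polynomial.X ^ 2 : Polynomial ℕ).eval n = 24 * n ^ 2 := by simp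
  refine ⟨24 * Polynomial.X ^ 2, fun n U hU => ?_, program, _, fun n C _ =>
    ⟨_, _, _, ?_, outputsWithin_program C⟩⟩
  · obtain ⟨f, hf⟩ := hU.exists_implements
    rw [hsize]
    exact ⟨_, _, _, isNormalForm_reduce hf⟩
  · rw [hsize]
    exact isNormalForm_reduce C.implements
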